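/- **Setting.** A two-player zero-sum stochastic game $\mathcal G$ consists of finite nonempty sets $\mathcal S,\mathcal A,\mathcal B$ of sizes $S,A,B$, rewards $R:\mathcal S\times\mathcal A\times\mathcal B\to[-1,1]$, an initial distribution $\rho\in\Delta(\mathcal S)$ and transition probabilities $P(s'\mid s,a,b)\ge 0$ such that the stopping probabilities $1-\sum_{s'}P(s'\mid s,a,b)$ are at least $\zeta>0$ for all $s,a,b$. Policies $\pi_1:\mathcal S\to\Delta(\mathcal A)$ (min-player) and $\pi_2:\mathcal S\to\Delta(\mathcal B)$ (max-player) induce random trajectories $(s_t,a_t,b_t)_{0\le t\le T}$, where $s_0\sim\rho$ and $T$ is the last step before the game stops; $V_\rho(\pi_1,\pi_2)=\mathbb E\big[\sum_{t=0}^TR(s_t,a_t,b_t)\big]$. Let $d^{\pi_1,\pi_2}_{s_0}\in\Delta(\mathcal S)$ be proportional to $s\mapsto\sum_{t\ge0}\Pr^{\pi_1,\pi_2}(s_t=s\mid s_0)$ and $d_\rho^{\pi_1,\pi_2}=\mathbb E_{s_0\sim\rho}\,d^{\pi_1,\pi_2}_{s_0}$. The minimax mismatch coefficient is $$C_{\mathcal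 G}=\max\Big\{\max_{\pi_2}\min_{\pi_1\in\Pi_1^*(\pi_2)}\Big\|\tfrac{d_\rho^{\pi_1,\pi_2}}{\rho}\Big\|_\infty,\ \max_{\pi_1}\min_{\pi_2\in\Pi_2^*(\pi_1)}\Big\|\tfrac{d_\rho^{\pi_1,\pi_2}}{\rho}\Big\|_\infty\Big\},$$ with $\Pi_1^*(\pi_2)$, $\Pi_2^*(\pi_1)$ the sets of best responses, and is assumed to be finite. **Algorithm.** For $x\in\Delta(\mathcal A)^{\mathcal S}$, $y\in\Delta(\mathcal B)^{\mathcal S}$ put $\pi_x(a\mid s)=(1-\varepsilon_x)x_{s,a}+\varepsilon_x/A$ and $\pi_y(b\mid s)=(1-\varepsilon_y)y_{s,b}+\varepsilon_y/B$ with $\varepsilon_x,\varepsilon_y\in[0,1]$. Starting from arbitrary $x^{(0)},y^{(0)}$, in episode $i$ a trajectory is drawn under $(\pi_{x^{(i)}},\pi_{y^{(i)}})$ and $$x^{(i+1)}=\mathcal P\big(x^{(i)}-\eta_x\hat\nabla_x^{(i)}\big),\qquad y^{(i+1)}=\mathcal P\big(y^{(i)}+\eta_y\hat\nabla_y^{(i)}\big),$$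 where $\mathcal P$ is the Euclidean projection onto $\Delta(\mathcal A)^{\mathcal S}$, respectively $\Delta(\mathcal B)^{\mathcal S}$, and $\hat\nabla_x^{(i)}=\big(\sum_{t=0}^TR(s_t,a_t,b_t)\big)\sum_{t=0}^T\nabla_x\log\pi_x(a_t\mid s_t)$, $\hat\nabla_y^{(i)}=\big(\sum_{t=0}^TR(s_t,a_t,b_t)\big)\sum_{t=0}^T\nabla_y\log\pi_y(b_t\mid s_t)$, evaluated on that trajectory at $x=x^{(i)}$, $y=y^{(i)}$. **Theorem.** Let $\epsilon>0$ and write $A\vee B=\max\{A,B\}$. If the exploration parameters and the learning rates satisfy $$\varepsilon_x=\Theta\Big(\frac{\zeta^3\epsilon}{\sqrt S\sqrt{A\vee B}\,C_{\mathcal G}}\Big),\quad \varepsilon_y=\Theta\Big(\frac{\zeta^8\epsilon^2}{C_{\mathcal G}^3(A\vee B)S}\Big),\quad \eta_x=\Theta\Big(\frac{\epsilon^{10.5}\zeta^{44.5}}{C_{\mathcal G}^{15.5}(A\vee B)^{9.75}S^{7.25}}\Big),\quad \eta_y=\Theta\Big(\frac{\epsilon^6\zeta^{27}}{C_{\mathcal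 G}^9(A\vee B)^6S^4}\Big),$$ then $$\mathbb E\Big[\frac1N\sum_{i=1}^N\max_{\pi_2}V_\rho(\pi_{x^{(i)}},\pi_2)\Big]-\min_{\pi_1}\max_{\pi_2}V_\rho(\pi_1,\pi_2)\le\epsilon$$ for every number of episodes $$N\ \ge\ K\,\frac{(A\vee B)^{10.75}S^{8.75}C_{\mathcal G}^{17.5}}{\epsilon^{12.5}\zeta^{48.5}}.$$ In particular $N=\mathrm{poly}(1/\epsilon,C_{\mathcal G},S,A,B,1/\zeta)$ episodes suffice. Here $\Theta$ stands for suitable fixed lower and upper universal constant multiples; these and $K$ are universal constants, independent of the game, of $\epsilon$ and of the initial point. -/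

import Mathlib

universe u v w

/-- A two-player zero-sum stochastic game. `P s a b s'` is the (substochastic) probability of moving
to `s'`; with the remaining, positive, probability the game stops. -/
structure StochasticGame (S : Type u) (A : Type v) (B : Type w) [Fintype S] where
  /-- transition probabilities -/
  P : S → A → B → S → ℝ
  /-- rewards (paid by the min-player to the max-player) -/
  R : S → A → B → ℝ
  /-- initial distribution -/
  rho : stdSimplex ℝ S
  P_nonneg : ∀ s a b s', 0 ≤ P s a b s'
  sum_P_lt_one : ∀ s a b, ∑ s', P s a b s' < 1
  abs_R_le_one : ∀ s a b, |R s a b| ≤ 1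

/-- Stationary randomized policies `S → Δ(A)`. -/
abbrev Policy (S : Type u) (A : Type v) [Fintype A] := S → stdSimplex ℝ A

/-- Trajectories `(s_t, a_t, b_t)_{0 ≤ t ≤ T}`: the first component is the last time step `T`
before the game stops. -/
abbrev Traj (S : Type u) (A : Type v) (B : Type w) := Σ T : ℕ, (Fin (T + 1) → S × A × B)

/-- Expectation of a real function under a discrete probability law. -/
noncomputable def PMF.expect {α : Type*} (p : PMF α) (f : α → ℝ) : ℝ :=
  ∑' a, (p a).toReal * f a

namespace StochasticGame

set_option linter.unusedSectionVars false

variable {S : Type u} {A : Type v} {B : Type w} [Fintype S] [Fintype A] [Fintype B]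

/-- The probability that the game stops at `s` when `a, b` are played. -/
def stopProb (G : StochasticGame S A B) (s : S) (a : A) (b : B) : ℝ := 1 - ∑ s', G.P s a b s'

/-- Probability that, starting from `s₀ ∼ μ`, the game is still running at time `n` and the states
and actions up to time `n` are `z`. -/
def pathProb (G : StochasticGame S A B) (μ : stdSimplex ℝ S) (π₁ : Policy S A) (π₂ : Policy S B)
    {n : ℕ} (z : Fin (n + 1) → S × A × B) : ℝ :=
  μ (z 0).1 * (∏ t, π₁ (z t).1 (z t).2.1 * π₂ (z t).1 (z t).2.2) *
    ∏ t : Fin n, G.P (z t.castSucc).1 (z t.castSucc).2.1 (z t.castSucc).2.2 (z t.succ).1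

/-- Probability of the complete trajectory `τ` when `s₀ ∼ μ`. -/
def trajProb (G : StochasticGame S A B) (μ : stdSimplex ℝ S) (π₁ : Policy S A) (π₂ : Policy S B)
    (τ : Traj S A B) : ℝ :=
  G.pathProb μ π₁ π₂ τ.2 *
    G.stopProb (τ.2 (Fin.last τ.1)).1 (τ.2 (Fin.last τ.1)).2.1 (τ.2 (Fin.last τ.1)).2.2

theorem stopProb_pos (G : StochasticGame S A B) (s : S) (a : A) (b : B) : 0 < G.stopProb s a b :=
  sub_pos.2 (G.sum_P_lt_one s a b)

theorem pathProb_nonneg (G : StochasticGame S A B) (μ : stdSimplex ℝ S) (π₁ : Policy S A)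
    (π₂ : Policy S B) {n : ℕ} (z : Fin (n + 1) → S × A × B) : 0 ≤ G.pathProb μ π₁ π₂ z :=
  mul_nonneg (mul_nonneg (μ.2.1 _) (Finset.prod_nonneg fun _ _ =>
    mul_nonneg ((π₁ _).2.1 _) ((π₂ _).2.1 _))) (Finset.prod_nonneg fun _ _ => G.P_nonneg _ _ _ _)

theorem trajProb_nonneg (G : StochasticGame S A B) (μ : stdSimplex ℝ S) (π₁ : Policy S A)
    (π₂ : Policy S B) (τ : Traj S A B) : 0 ≤ G.trajProb μ π₁ π₂ τ :=
  mul_nonneg (G.pathProb_nonneg μ π₁ π₂ _) (G.stopProb_pos _ _ _).le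

theorem sum_actions (π₁ : Policy S A) (π₂ : Policy S B) (f : S → ℝ) :
    ∑ q : S × A × B, f q.1 * (π₁ q.1 q.2.1 * π₂ q.1 q.2.2) = ∑ s, f s := by
  rw [Fintype.sum_prod_type]
  refine Finset.sum_congr rfl fun s _ => ?_
  rw [Fintype.sum_prod_type]
  simp only [← Finset.mul_sum]
  have h : ∀ a, ∑ b, π₂ s b = 1 := fun _ : A => (π₂ s).2.2
  have h' : ∑ a, π₁ s a = 1 := (π₁ s).2.2
  have h2 : ∑ b, π₂ s b = 1 := (π₂ s).2.2
  simp [h2, h']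

theorem sum_pathProb_zero (G : StochasticGame S A B) (μ : stdSimplex ℝ S) (π₁ : Policy S A)
    (π₂ : Policy S B) : ∑ z : Fin (0 + 1) → S × A × B, G.pathProb μ π₁ π₂ z = 1 := by
  have h := sum_actions π₁ π₂ (fun s => μ s)
  have hμ : ∑ s, μ s = 1 := μ.2.2
  rw [hμ] at h
  rw [← h]
  refine Fintype.sum_equiv (Equiv.funUnique (Fin 1) (S × A × B)) _ _ fun z => ?_
  simp [pathProb]

theorem pathProb_snoc (G : StochasticGame S A B) (μ : stdSimplex ℝ S) (π₁ : Policy S A)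
    (π₂ : Policy S B) {n : ℕ} (z : Fin (n + 1) → S × A × B) (q : S × A × B) :
    G.pathProb μ π₁ π₂ (Fin.snoc z q : Fin (n + 1 + 1) → S × A × B) =
      G.pathProb μ π₁ π₂ z *
        (G.P (z (Fin.last n)).1 (z (Fin.last n)).2.1 (z (Fin.last n)).2.2 q.1 *
          (π₁ q.1 q.2.1 * π₂ q.1 q.2.2)) := by
  have h0 : (Fin.snoc z q : Fin (n + 1 + 1) → S × A × B) 0 = z 0 := by
    exact Fin.snoc_castSucc (α := fun _ => S × A × B) q z 0
  have hc : ∀ t : Fin (n + 1), (Fin.snoc z q : Fin (n + 1 + 1) → S × A × B) t.castSucc = z t :=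
    fun t => Fin.snoc_castSucc (α := fun _ => S × A × B) q z t
  have hs : ∀ t : Fin n, (Fin.snoc z q : Fin (n + 1 + 1) → S × A × B) t.castSucc.succ =
      z t.succ := fun t => hc t.succ
  have hl : (Fin.snoc z q : Fin (n + 1 + 1) → S × A × B) (Fin.last (n + 1)) = q :=
    Fin.snoc_last (α := fun _ => S × A × B) q z
  have hl' : (Fin.snoc z q : Fin (n + 1 + 1) → S × A × B) (Fin.last n).succ = q := hl
  simp only [pathProb, h0, hc]
  rw [Fin.prod_univ_castSucc (n := n + 1), Fin.prod_univ_castSucc (n := n)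
    (f := fun t => G.P (z t).1 (z t).2.1 (z t).2.2 _)]
  simp only [hs, hc, hl, hl']
  ring

theorem sum_pathProb_succ (G : StochasticGame S A B) (μ : stdSimplex ℝ S) (π₁ : Policy S A)
    (π₂ : Policy S B) (n : ℕ) :
    ∑ z : Fin (n + 1 + 1) → S × A × B, G.pathProb μ π₁ π₂ z =
      ∑ z : Fin (n + 1) → S × A × B, G.pathProb μ π₁ π₂ z *
        (1 - G.stopProb (z (Fin.last n)).1 (z (Fin.last n)).2.1 (z (Fin.last n)).2.2) := by
  rw [← (Fin.snocEquiv (fun _ : Fin (n + 1 + 1) => S × A × B)).sum_comp, Fintype.sum_prod_type,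
    Finset.sum_comm]
  refine Finset.sum_congr rfl fun z _ => ?_
  have h : ∀ q, G.pathProb μ π₁ π₂ ((Fin.snocEquiv (fun _ : Fin (n + 1 + 1) => S × A × B)) (q, z)) =
      _ := fun q => G.pathProb_snoc μ π₁ π₂ z q
  simp only [h]
  rw [← Finset.mul_sum, sum_actions π₁ π₂]
  simp [stopProb]

theorem hasSum_trajProb (G : StochasticGame S A B) (μ : stdSimplex ℝ S) (π₁ : Policy S A)
    (π₂ : Policy S B) :
    HasSum (fun τ : Traj S A B => ENNReal.ofReal (G.trajProb μ π₁ π₂ τ)) 1 := by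
  let f : ℕ → ℝ := fun n => ∑ z : Fin (n + 1) → S × A × B, G.pathProb μ π₁ π₂ z
  let g : ℕ → ℝ := fun n => ∑ z : Fin (n + 1) → S × A × B, G.trajProb μ π₁ π₂ ⟨n, z⟩
  have hg0 : ∀ n, 0 ≤ g n := fun n => Finset.sum_nonneg fun _ _ => G.trajProb_nonneg _ _ _ _
  have hf0 : ∀ n, 0 ≤ f n := fun n => Finset.sum_nonneg fun _ _ => G.pathProb_nonneg _ _ _ _
  have hfg : ∀ n, g n = f n - f (n + 1) := fun n => by
    simp only [f, g, sum_pathProb_succ, ← Finset.sum_sub_distrib, trajProb]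
    exact Finset.sum_congr rfl fun _ _ => by ring
  obtain ⟨c, hc0, hc1, hc⟩ : ∃ c : ℝ, 0 ≤ c ∧ c < 1 ∧
      ∀ s a b, 1 - G.stopProb s a b ≤ c := by
    rcases isEmpty_or_nonempty (S × A × B) with h | h
    · exact ⟨0, le_rfl, one_pos, fun s a b => (h.false (s, a, b)).elim⟩
    · obtain ⟨q, hq⟩ := Finite.exists_max fun q : S × A × B => 1 - G.stopProb q.1 q.2.1 q.2.2
      refine ⟨1 - G.stopProb q.1 q.2.1 q.2.2, ?_, by linarith [G.stopProb_pos q.1 q.2.1 q.2.2],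
        fun s a b => hq (s, a, b)⟩
      simpa [stopProb] using Finset.sum_nonneg fun s' _ => G.P_nonneg q.1 q.2.1 q.2.2 s'
  have hfc : ∀ n, f n ≤ c ^ n := fun n => by
    induction n with
    | zero => exact (G.sum_pathProb_zero μ π₁ π₂).le.trans (by simp)
    | succ n ih =>
      calc f (n + 1) ≤ ∑ z : Fin (n + 1) → S × A × B, G.pathProb μ π₁ π₂ z * c := by
            simp only [f, sum_pathProb_succ]
            exact Finset.sum_le_sum fun z _ =>
              mul_le_mul_of_nonneg_left (hc _ _ _) (G.pathProb_nonneg _ _ _ _)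
        _ = f n * c := (Finset.sum_mul _ _ _).symm
        _ ≤ c ^ (n + 1) := by rw [pow_succ]; exact mul_le_mul_of_nonneg_right ih hc0
  have hlim : Filter.Tendsto f Filter.atTop (nhds 0) :=
    squeeze_zero hf0 hfc (tendsto_pow_atTop_nhds_zero_of_lt_one hc0 hc1)
  have hsum : HasSum g 1 := by
    rw [hasSum_iff_tendsto_nat_of_nonneg hg0]
    have h1 : ∀ n, ∑ i ∈ Finset.range n, g i = 1 - f n := fun n => by
      have h0 : f 0 = 1 := G.sum_pathProb_zero μ π₁ π₂
      rw [← h0, ← Finset.sum_range_sub' f n]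
      exact Finset.sum_congr rfl fun i _ => hfg i
    simp only [h1]
    simpa using hlim.const_sub 1
  have : ∑' τ : Traj S A B, ENNReal.ofReal (G.trajProb μ π₁ π₂ τ) = 1 := by
    rw [ENNReal.tsum_sigma']
    have h2 : ∀ n, ∑' z : Fin (n + 1) → S × A × B, ENNReal.ofReal (G.trajProb μ π₁ π₂ ⟨n, z⟩) =
        ENNReal.ofReal (g n) := fun n => by
      rw [tsum_fintype, ENNReal.ofReal_sum_of_nonneg fun _ _ => G.trajProb_nonneg _ _ _ _]
    simp only [h2]
    rw [← ENNReal.ofReal_tsum_of_nonneg hg0 hsum.summable, hsum.tsum_eq, ENNReal.ofReal_one]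
  rw [← this]
  exact ENNReal.summable.hasSum

/-- The law `ℙ^{π₁,π₂}` of the trajectory when `s₀ ∼ μ`. -/
noncomputable def trajLaw (G : StochasticGame S A B) (μ : stdSimplex ℝ S) (π₁ : Policy S A)
    (π₂ : Policy S B) : PMF (Traj S A B) :=
  ⟨fun τ => ENNReal.ofReal (G.trajProb μ π₁ π₂ τ), G.hasSum_trajProb μ π₁ π₂⟩

/-- Total reward `∑_{t ≤ T} R(s_t, a_t, b_t)` of a trajectory. -/
def totalReward (G : StochasticGame S A B) (τ : Traj S A B) : ℝ :=
  ∑ t, G.R (τ.2 t).1 (τ.2 t).2.1 (τ.2 t).2.2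

open Classical in
/-- The point mass at the state `s`. -/
noncomputable def dirac (s : S) : stdSimplex ℝ S := ⟨Pi.single s 1, single_mem_stdSimplex ℝ s⟩

/-- The value `V_s(π₁, π₂)`. -/
noncomputable def stateValue (G : StochasticGame S A B) (π₁ : Policy S A) (π₂ : Policy S B)
    (s : S) : ℝ :=
  (G.trajLaw (dirac s) π₁ π₂).expect G.totalReward

/-- The value `V_ρ(π₁, π₂)`. -/
noncomputable def value (G : StochasticGame S A B) (π₁ : Policy S A) (π₂ : Policy S B) : ℝ :=
  ∑ s, G.rho s * G.stateValue π₁ π₂ s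

open Classical in
/-- `∑_{t ≥ 0} ℙ^{π₁,π₂}(s_t = s | s₀)`, where `s_t = s` includes that the game has not stopped
before time `t`. -/
noncomputable def visits (G : StochasticGame S A B) (π₁ : Policy S A) (π₂ : Policy S B)
    (s₀ s : S) : ℝ :=
  ∑' t : ℕ, ∑ z : Fin (t + 1) → S × A × B,
    if (z (Fin.last t)).1 = s then G.pathProb (dirac s₀) π₁ π₂ z else 0

/-- The discounted state visitation distribution `d_ρ^{π₁,π₂}`. -/
noncomputable def visitDist (G : StochasticGame S A B) (π₁ : Policy S A) (π₂ : Policy S B)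
    (s : S) : ℝ :=
  ∑ s₀, G.rho s₀ * (G.visits π₁ π₂ s₀ s / ∑ s', G.visits π₁ π₂ s₀ s')

/-- Best responses of the min-player to `π₂`. -/
def minBestResponses (G : StochasticGame S A B) (π₂ : Policy S B) : Set (Policy S A) :=
  {π₁ | ∀ π₁', G.value π₁ π₂ ≤ G.value π₁' π₂}

/-- Best responses of the max-player to `π₁`. -/
def maxBestResponses (G : StochasticGame S A B) (π₁ : Policy S A) : Set (Policy S B) :=
  {π₂ | ∀ π₂', G.value π₁ π₂' ≤ G.value π₁ π₂}

/-- `‖d_ρ^{π₁,π₂} / ρ‖_∞`, with values in `[0, ∞]`; here `0 / 0 = 0` and `c / 0 = ∞` for `c > 0`. -/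
noncomputable def mismatchRatio (G : StochasticGame S A B) (π₁ : Policy S A) (π₂ : Policy S B) :
    ENNReal :=
  ⨆ s, ENNReal.ofReal (G.visitDist π₁ π₂ s) / ENNReal.ofReal (G.rho s)

/-- The minimax mismatch coefficient `C_G`. -/
noncomputable def mismatch (G : StochasticGame S A B) : ENNReal :=
  max (⨆ π₂ : Policy S B, ⨅ π₁ ∈ G.minBestResponses π₂, G.mismatchRatio π₁ π₂)
    (⨆ π₁ : Policy S A, ⨅ π₂ ∈ G.maxBestResponses π₁, G.mismatchRatio π₁ π₂)

end StochasticGame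

/-- The parameter set `Δ(A)^S` as a subset of the Euclidean space `ℝ^{S × A}`. -/
def paramSet (S : Type u) (A : Type v) [Fintype S] [Fintype A] : Set (EuclideanSpace ℝ (S × A)) :=
  {x | ∀ s, (fun a => x (s, a)) ∈ stdSimplex ℝ A}

theorem isClosed_paramSet (S : Type u) (A : Type v) [Fintype S] [Fintype A] :
    IsClosed (paramSet S A) := by
  have h : paramSet S A = ⋂ s, (fun x : EuclideanSpace ℝ (S × A) => fun a => x (s, a)) ⁻¹'
      stdSimplex ℝ A := by
    ext x; simp [paramSet]
  rw [h]
  exact isClosed_iInter fun s => (isClosed_stdSimplex ℝ A).preimage (by fun_prop)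

theorem paramSet_nonempty (S : Type u) (A : Type v) [Fintype S] [Fintype A] [Nonempty A] :
    (paramSet S A).Nonempty :=
  let p : stdSimplex ℝ A := Classical.arbitrary _
  ⟨WithLp.toLp 2 fun q => p q.2, fun _ => p.2⟩

/-- The Euclidean projection onto `Δ(A)^S`: a nearest point, which is unique since the set is
convex. -/
noncomputable def projParam {S : Type u} {A : Type v} [Fintype S] [Fintype A] [Nonempty A]
    (x : EuclideanSpace ℝ (S × A)) : paramSet S A :=
  let h := (isClosed_paramSet S A).exists_infDist_eq_dist (paramSet_nonempty S A) x
  ⟨h.choose, h.choose_spec.1⟩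

/-- `π_x(a | s) = (1 - ε) x_{s,a} + ε / |A|`, for every `x ∈ ℝ^{S × A}`. -/
noncomputable def greedyProb {S : Type u} {A : Type v} [Fintype A] (ε : unitInterval)
    (x : EuclideanSpace ℝ (S × A)) (s : S) (a : A) : ℝ :=
  (1 - (ε : ℝ)) * x (s, a) + (ε : ℝ) / Fintype.card A

theorem greedyProb_mem {S : Type u} {A : Type v} [Fintype S] [Fintype A] [Nonempty A]
    (ε : unitInterval) (x : paramSet S A) (s : S) :
    greedyProb ε (x : EuclideanSpace ℝ (S × A)) s ∈ stdSimplex ℝ A := by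
  have h1 : (0 : ℝ) ≤ 1 - (ε : ℝ) := sub_nonneg.2 ε.2.2
  have h2 : (0 : ℝ) ≤ (ε : ℝ) := ε.2.1
  refine ⟨fun a => ?_, ?_⟩
  · exact add_nonneg (mul_nonneg h1 ((x.2 s).1 a)) (div_nonneg h2 (Nat.cast_nonneg _))
  · have h : ∑ a, (x : EuclideanSpace ℝ (S × A)) (s, a) = 1 := (x.2 s).2
    have hc : (Fintype.card A : ℝ) ≠ 0 := Nat.cast_ne_zero.2 Fintype.card_ne_zero
    simp only [greedyProb, Finset.sum_add_distrib, ← Finset.mul_sum, h, Finset.sum_const,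
      Finset.card_univ, nsmul_eq_mul]
    field_simp
    ring

/-- The `ε`-greedy direct parameterization `x ↦ π_x`. -/
noncomputable def greedyPolicy {S : Type u} {A : Type v} [Fintype S] [Fintype A] [Nonempty A]
    (ε : unitInterval) (x : paramSet S A) : Policy S A :=
  fun s => ⟨greedyProb ε x s, greedyProb_mem ε x s⟩

/-- The REINFORCE estimate `R_T ∑_{t ≤ T} ∇ log π_x(a_t | s_t)`, computed by a player from the total
reward and the sequence of the states and of its own actions. -/
noncomputable def reinforce {S : Type u} {A : Type v} [Fintype S] [Fintype A] (ε : unitInterval)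
    (x : EuclideanSpace ℝ (S × A)) (totalReward : ℝ) {n : ℕ} (z : Fin n → S × A) :
    EuclideanSpace ℝ (S × A) :=
  totalReward • ∑ t, gradient
    (fun x' : EuclideanSpace ℝ (S × A) => Real.log (greedyProb ε x' (z t).1 (z t).2)) x

namespace StochasticGame

variable {S : Type u} {A : Type v} {B : Type w} [Fintype S] [Fintype A] [Fintype B]
  [Nonempty A] [Nonempty B]

/-- One projected policy gradient step of both players, from the trajectory of one episode. -/
noncomputable def pgStep (G : StochasticGame S A B) (εx εy : unitInterval) (ηx ηy : ℝ)
    (p : paramSet S A × paramSet S B) (τ : Traj S A B) : paramSet S A × paramSet S B :=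
  (projParam ((p.1 : EuclideanSpace ℝ (S × A)) -
      ηx • reinforce εx p.1 (G.totalReward τ) fun t => ((τ.2 t).1, (τ.2 t).2.1)),
    projParam ((p.2 : EuclideanSpace ℝ (S × B)) +
      ηy • reinforce εy p.2 (G.totalReward τ) fun t => ((τ.2 t).1, (τ.2 t).2.2)))

/-- The joint law of the iterates `(x⁽⁰⁾, y⁽⁰⁾), …, (x⁽ⁿ⁾, y⁽ⁿ⁾)` of independent policy gradient started
at `p₀`: in each episode a fresh trajectory is drawn from the current pair of policies. -/
noncomputable def iterateLaw (G : StochasticGame S A B) (εx εy : unitInterval) (ηx ηy : ℝ)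
    (p₀ : paramSet S A × paramSet S B) :
    (n : ℕ) → PMF (Fin (n + 1) → paramSet S A × paramSet S B)
  | 0 => PMF.pure fun _ => p₀
  | n + 1 => (iterateLaw G εx εy ηx ηy p₀ n).bind fun h =>
      (G.trajLaw G.rho (greedyPolicy εx (h (Fin.last n)).1)
        (greedyPolicy εy (h (Fin.last n)).2)).map
          fun τ => Fin.snoc h (G.pgStep εx εy ηx ηy (h (Fin.last n)) τ)

/-- The averaged expected duality gap of the min-player's iterates after `N` episodes:
`E[(1/N) ∑_{i=1}^N max_{π₂} V_ρ(π_{x⁽ⁱ⁾}, π₂)] - min_{π₁} max_{π₂} V_ρ(π₁, π₂)`. -/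
noncomputable def avgGap (G : StochasticGame S A B) (εx εy : unitInterval) (ηx ηy : ℝ)
    (p₀ : paramSet S A × paramSet S B) (N : ℕ) : ℝ :=
  (G.iterateLaw εx εy ηx ηy p₀ N).expect
      (fun h => (1 / (N : ℝ)) * ∑ i : Fin N,
        ⨆ π₂ : Policy S B, G.value (greedyPolicy εx (h i.succ).1) π₂) -
    ⨅ π₁ : Policy S A, ⨆ π₂ : Policy S B, G.value π₁ π₂

end StochasticGame

/-! Write Φ(x) = max over π₂ of V_ρ(π_x, π₂), let V(x, y) be the value of the two greedy policies,
and let v be the minimax value. The max-player uses the larger step size and nearly tracks a best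
response to π_x, so the min-player nearly performs gradient descent on Φ. Neither V nor Φ has the
convexity that would make stationary points optimal. What replaces it is gradient dominance, proved
by exact performance differences (`value_sub_eq`).

For the max-player (`exists_ascent_policy`), moving towards the greedy policy for the current action
values raises V at a linear rate of at least (ζ/C)(Φ - V), up to an exploration error. For the
min-player (`exists_descent_policy`), let u be the state values of an optimal response to π_x and
solve, at every state, the matrix game with payoffs R + Pu. Moving towards its minimizing strategies
lowers V against every π₂ at once, hence lowers Φ, at rate (ζ/C)(Φ - v). The bound on Φ - v comes
from letting the min-player answer the maximizing matrix strategies by a best response with small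
mismatch, and this is why C_G controls both orders of play.

Stationarity is measured by Moreau envelopes on the compact parameter sets. If z is a proximal point
of x, then linear descent from z at rate g forces g = O(l √S ‖z - x‖) (`IsProx.le_of_descent`), so
optimality gaps are bounded by distances to proximal points (`maxValue_sub_le_of_isProx`,
`maxValue_sub_value_le_of_isProx`).

A projected step moves each envelope by the inner product of the gradient estimate with z - x, plus
a second moment term. The policy gradient theorem makes the mean inner product the exact first order
term of V (`hasSum_inner_gradMin`, `hasSum_inner_gradMax`), V is smooth with constant of order (A ∨
B)/ζ³ (`abs_value_sub_sub_le`), and the second moments are at most of order A²/(ε_x ζ⁴) and B²/(ε_y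
ζ⁴) (`hasSum_sq_gradMin`, `hasSum_sq_gradMax`). A weighted sum of the envelope of Φ at x and the
envelope of -V(x, ·) at y then drops in expectation by Φ(x) - v, up to errors
(`maxValue_sub_le_potential_drift`). Telescoping (`avgGap_le`) bounds the averaged gap, and the
parameter choices make the total error at most ε. -/

/-! ### Green kernels of substochastic matrices -/

section GreenKernel

variable {S : Type*} [Fintype S]

/-- Nonnegative kernels whose rows sum to at most `1 - ζ`. -/
structure IsSubstochastic (K : S → S → ℝ) (ζ : ℝ) : Prop where
  nonneg : ∀ s s', 0 ≤ K s s'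
  sum_le : ∀ s, ∑ s', K s s' ≤ 1 - ζ

/-- Iterated kernel. -/
noncomputable def kernelPow (K : S → S → ℝ) (s : S) : ℕ → S → ℝ
  | 0 => fun s' => by classical exact if s = s' then 1 else 0
  | n + 1 => fun s' => ∑ r, kernelPow K s n r * K r s'

/-- The Green kernel `∑ₙ Kⁿ`. -/
noncomputable def greenKernel (K : S → S → ℝ) (s s' : S) : ℝ := ∑' n, kernelPow K s n s'

theorem kernelPow_succ' (K : S → S → ℝ) (s : S) (n : ℕ) (s' : S) :
    kernelPow K s (n + 1) s' = ∑ r, K s r * kernelPow K r n s' := by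
  classical
  induction n generalizing s' with
  | zero => simp [kernelPow]
  | succ n ih =>
    have h : kernelPow K s (n + 1 + 1) s' = ∑ r, kernelPow K s (n + 1) r * K r s' := rfl
    rw [h, Finset.sum_congr rfl fun r _ => congrArg (· * K r s') (ih r)]
    simp only [kernelPow, Finset.sum_mul, Finset.mul_sum]
    rw [Finset.sum_comm]
    exact Finset.sum_congr rfl fun _ _ => Finset.sum_congr rfl fun _ _ => by ring

namespace IsSubstochastic

variable {K : S → S → ℝ} {ζ : ℝ}

theorem kernelPow_nonneg (hK : IsSubstochastic K ζ) (s : S) (n : ℕ) (s' : S) :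
    0 ≤ kernelPow K s n s' := by
  induction n generalizing s' with
  | zero => simp only [kernelPow]; split_ifs <;> norm_num
  | succ n ih => exact Finset.sum_nonneg fun r _ => mul_nonneg (ih r) (hK.nonneg _ _)

theorem sum_kernelPow_le (hK : IsSubstochastic K ζ) (hζ1 : ζ ≤ 1) (s : S) (n : ℕ) :
    ∑ s', kernelPow K s n s' ≤ (1 - ζ) ^ n := by
  classical
  induction n with
  | zero => simp [kernelPow]
  | succ n ih =>
    simp only [kernelPow]
    rw [Finset.sum_comm]
    simp only [← Finset.mul_sum]
    calc ∑ r, kernelPow K s n r * ∑ s', K r s' ≤ ∑ r, kernelPow K s n r * (1 - ζ) :=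
          Finset.sum_le_sum fun r _ =>
            mul_le_mul_of_nonneg_left (hK.sum_le r) (hK.kernelPow_nonneg s n r)
      _ = (∑ r, kernelPow K s n r) * (1 - ζ) := (Finset.sum_mul _ _ _).symm
      _ ≤ (1 - ζ) ^ n * (1 - ζ) := mul_le_mul_of_nonneg_right ih (by linarith)
      _ = _ := (pow_succ _ _).symm

theorem kernelPow_le (hK : IsSubstochastic K ζ) (hζ1 : ζ ≤ 1) (s : S) (n : ℕ) (s' : S) :
    kernelPow K s n s' ≤ (1 - ζ) ^ n :=
  (Finset.single_le_sum (fun r _ => hK.kernelPow_nonneg s n r) (Finset.mem_univ s')).trans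
    (hK.sum_kernelPow_le hζ1 s n)

theorem summable_kernelPow (hK : IsSubstochastic K ζ) (hζ : 0 < ζ) (hζ1 : ζ ≤ 1) (s s' : S) :
    Summable fun n => kernelPow K s n s' :=
  Summable.of_nonneg_of_le (fun n => hK.kernelPow_nonneg s n s')
    (fun n => hK.kernelPow_le hζ1 s n s')
    (summable_geometric_of_lt_one (by linarith) (by linarith))

theorem greenKernel_nonneg (hK : IsSubstochastic K ζ) (s s' : S) : 0 ≤ greenKernel K s s' :=
  tsum_nonneg fun n => hK.kernelPow_nonneg s n s'

theorem sum_greenKernel_le (hK : IsSubstochastic K ζ) (hζ : 0 < ζ) (hζ1 : ζ ≤ 1) (s : S) :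
    ∑ s', greenKernel K s s' ≤ 1 / ζ := by
  have h := fun s' => hK.summable_kernelPow hζ hζ1 s s'
  have hg := summable_geometric_of_lt_one (r := 1 - ζ) (by linarith) (by linarith)
  unfold greenKernel
  rw [← Summable.tsum_finsetSum fun s' _ => h s']
  calc ∑' n, ∑ s', kernelPow K s n s' ≤ ∑' n, (1 - ζ) ^ n :=
        Summable.tsum_le_tsum (fun n => hK.sum_kernelPow_le hζ1 s n)
          (summable_sum fun s' _ => h s') hg
    _ = 1 / ζ := by
        rw [tsum_geometric_of_lt_one (by linarith) (by linarith)]; simp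

theorem one_le_greenKernel_self (hK : IsSubstochastic K ζ) (hζ : 0 < ζ) (hζ1 : ζ ≤ 1) (s : S) :
    1 ≤ greenKernel K s s := by
  have := (hK.summable_kernelPow hζ hζ1 s s).le_tsum 0 fun n _ => hK.kernelPow_nonneg s n s
  simpa [greenKernel, kernelPow] using this

theorem greenKernel_eq (hK : IsSubstochastic K ζ) (hζ : 0 < ζ) (hζ1 : ζ ≤ 1) (s s' : S) :
    greenKernel K s s' = kernelPow K s 0 s' + ∑ r, greenKernel K s r * K r s' := by
  have h := fun s' => hK.summable_kernelPow hζ hζ1 s s'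
  unfold greenKernel
  rw [(h s').tsum_eq_zero_add]
  simp only [← tsum_mul_right]
  rw [← Summable.tsum_finsetSum fun r _ => (h r).mul_right _]
  rfl

/-- The solution of `u = h + K u` is given by the Green kernel. -/
theorem eq_sum_greenKernel (hK : IsSubstochastic K ζ) (hζ : 0 < ζ) (hζ1 : ζ ≤ 1) {u h : S → ℝ}
    (hu : ∀ s, u s = h s + ∑ s', K s s' * u s') (s : S) :
    u s = ∑ s', greenKernel K s s' * h s' := by
  classical
  -- Substitute h = u - Ku and move K onto the Green kernel g: the coefficients of u become g - gK,
  -- which is the identity by `greenKernel_eq`.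
  have h1 : ∑ s', greenKernel K s s' * h s' =
      ∑ s', greenKernel K s s' * u s' - ∑ s', (∑ r, greenKernel K s r * K r s') * u s' := by
    simp only [Finset.sum_mul]
    rw [Finset.sum_comm (s := Finset.univ) (t := Finset.univ)
      (f := fun s' r => greenKernel K s r * K r s' * u s'), ← Finset.sum_sub_distrib]
    refine Finset.sum_congr rfl fun r _ => ?_
    simp only [mul_assoc]
    rw [← Finset.mul_sum]
    rw [← mul_sub, hu r]
    ring
  rw [h1, ← Finset.sum_sub_distrib]
  simp only [← sub_mul]
  have h2 : ∀ s', greenKernel K s s' - ∑ r, greenKernel K s r * K r s' = kernelPow K s 0 s' :=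
    fun s' => by rw [hK.greenKernel_eq hζ hζ1 s s']; ring
  simp [h2, kernelPow]

/-- The Green kernel is nonnegative with row sums at most 1/ζ. This one estimate bounds state
values, kills expectations of centered weights (take c = 0), and enters the second order expansion
of the value. -/
theorem abs_le_of_eq (hK : IsSubstochastic K ζ) (hζ : 0 < ζ) (hζ1 : ζ ≤ 1) {u h : S → ℝ}
    (hu : ∀ s, u s = h s + ∑ s', K s s' * u s') {c : ℝ} (hc : ∀ s, |h s| ≤ c) (s : S) :
    |u s| ≤ c / ζ := by
  have hc0 : 0 ≤ c := (abs_nonneg _).trans (hc s)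
  rw [hK.eq_sum_greenKernel hζ hζ1 hu s]
  calc |∑ s', greenKernel K s s' * h s'| ≤ ∑ s', |greenKernel K s s' * h s'| :=
        Finset.abs_sum_le_sum_abs _ _
    _ ≤ ∑ s', greenKernel K s s' * c := Finset.sum_le_sum fun s' _ => by
        rw [abs_mul, abs_of_nonneg (hK.greenKernel_nonneg s s')]
        exact mul_le_mul_of_nonneg_left (hc s') (hK.greenKernel_nonneg s s')
    _ = (∑ s', greenKernel K s s') * c := (Finset.sum_mul _ _ _).symm
    _ ≤ 1 / ζ * c := mul_le_mul_of_nonneg_right (hK.sum_greenKernel_le hζ hζ1 s) hc0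
    _ = c / ζ := by ring

end IsSubstochastic

end GreenKernel

/-! ### One-step averages, the state kernel, and the Markov property of paths -/

namespace StochasticGame

set_option linter.unusedSectionVars false

variable {S : Type u} {A : Type v} {B : Type w} [Fintype S] [Fintype A] [Fintype B]

/-- Expectation of `f a b` when both players draw their actions at the state `s`. -/
def play (π₁ : Policy S A) (π₂ : Policy S B) (s : S) (f : A → B → ℝ) : ℝ :=
  ∑ a, ∑ b, π₁ s a * π₂ s b * f a b

section Play

variable (π₁ : Policy S A) (π₂ : Policy S B) (s : S)

theorem play_const (c : ℝ) : play π₁ π₂ s (fun _ _ => c) = c := by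
  have h1 : ∑ a, π₁ s a = 1 := (π₁ s).2.2
  have h2 : ∑ b, π₂ s b = 1 := (π₂ s).2.2
  simp only [play, mul_assoc, ← Finset.mul_sum, ← Finset.sum_mul, h1, h2, one_mul]

theorem play_mono {f g : A → B → ℝ} (h : ∀ a b, f a b ≤ g a b) :
    play π₁ π₂ s f ≤ play π₁ π₂ s g :=
  Finset.sum_le_sum fun a _ => Finset.sum_le_sum fun b _ =>
    mul_le_mul_of_nonneg_left (h a b) (mul_nonneg ((π₁ s).2.1 a) ((π₂ s).2.1 b))

theorem play_add (f g : A → B → ℝ) :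
    play π₁ π₂ s (fun a b => f a b + g a b) = play π₁ π₂ s f + play π₁ π₂ s g := by
  simp only [play, mul_add, Finset.sum_add_distrib]

theorem play_const_mul (c : ℝ) (f : A → B → ℝ) :
    play π₁ π₂ s (fun a b => c * f a b) = c * play π₁ π₂ s f := by
  simp only [play, Finset.mul_sum]
  exact Finset.sum_congr rfl fun a _ => Finset.sum_congr rfl fun b _ => by ring

theorem play_sum {ι : Type*} (t : Finset ι) (f : ι → A → B → ℝ) :
    play π₁ π₂ s (fun a b => ∑ i ∈ t, f i a b) = ∑ i ∈ t, play π₁ π₂ s (f i) := by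
  classical
  induction t using Finset.induction_on with
  | empty => simp [play]
  | insert i t hi ih =>
    simp only [Finset.sum_insert hi, ← ih]
    exact play_add π₁ π₂ s _ _

theorem abs_play_le {f : A → B → ℝ} {c : ℝ} (h : ∀ a b, |f a b| ≤ c) :
    |play π₁ π₂ s f| ≤ c := by
  rw [abs_le]
  constructor
  · rw [← play_const π₁ π₂ s (-c)]
    exact play_mono π₁ π₂ s fun a b => (abs_le.1 (h a b)).1
  · rw [← play_const π₁ π₂ s c]
    exact play_mono π₁ π₂ s fun a b => (abs_le.1 (h a b)).2

theorem play_eq_sum_left (f : A → B → ℝ) :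
    play π₁ π₂ s f = ∑ a, π₁ s a * ∑ b, π₂ s b * f a b := by
  simp only [play, Finset.mul_sum, mul_assoc]

theorem play_eq_sum_right (f : A → B → ℝ) :
    play π₁ π₂ s f = ∑ b, π₂ s b * ∑ a, π₁ s a * f a b := by
  rw [play, Finset.sum_comm]
  simp only [Finset.mul_sum]
  exact Finset.sum_congr rfl fun a _ => Finset.sum_congr rfl fun b _ => by ring

end Play

/-- The transition kernel on states induced by a pair of policies. -/
def kernel (G : StochasticGame S A B) (π₁ : Policy S A) (π₂ : Policy S B) (s s' : S) : ℝ :=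
  play π₁ π₂ s fun a b => G.P s a b s'

theorem sum_kernel_mul (G : StochasticGame S A B) (π₁ : Policy S A) (π₂ : Policy S B) (s : S)
    (u : S → ℝ) :
    ∑ s', G.kernel π₁ π₂ s s' * u s' = play π₁ π₂ s fun a b => ∑ s', G.P s a b s' * u s' := by
  rw [play_sum]
  refine Finset.sum_congr rfl fun s' _ => ?_
  rw [kernel, mul_comm, ← play_const_mul]
  simp only [mul_comm]

theorem isSubstochastic_kernel (G : StochasticGame S A B) {ζ : ℝ}
    (hG : ∀ s a b, ζ ≤ G.stopProb s a b) (π₁ : Policy S A) (π₂ : Policy S B) :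
    IsSubstochastic (G.kernel π₁ π₂) ζ where
  nonneg s s' := by
    rw [← play_const π₁ π₂ s 0]
    exact play_mono π₁ π₂ s fun a b => G.P_nonneg s a b s'
  sum_le s := by
    have h := G.sum_kernel_mul π₁ π₂ s fun _ => 1
    simp only [mul_one] at h
    rw [h, ← play_const π₁ π₂ s (1 - ζ)]
    refine play_mono π₁ π₂ s fun a b => ?_
    have := hG s a b
    unfold stopProb at this
    linarith

theorem sum_dirac_mul (s : S) (f : S → ℝ) : ∑ s', dirac s s' * f s' = f s := by
  classical
  have h : ∀ s', dirac s s' = if s' = s then (1 : ℝ) else 0 := fun s' => by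
    change (Pi.single s 1 : S → ℝ) s' = _
    simp [Pi.single_apply]
  simp [h]

theorem sum_mul_dirac (s : S) (f : S → ℝ) : ∑ s', f s' * dirac s' s = f s := by
  classical
  have h : ∀ s', dirac s' s = if s' = s then (1 : ℝ) else 0 := fun s' => by
    change (Pi.single s' 1 : S → ℝ) s = _
    simp [Pi.single_apply, eq_comm]
  simp [h]

theorem pathProb_eq_sum (G : StochasticGame S A B) (μ : stdSimplex ℝ S) (π₁ : Policy S A)
    (π₂ : Policy S B) {n : ℕ} (z : Fin (n + 1) → S × A × B) :
    G.pathProb μ π₁ π₂ z = ∑ s, μ s * G.pathProb (dirac s) π₁ π₂ z := by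
  have h := sum_mul_dirac (z 0).1 (fun s => μ s)
  simp only [pathProb, mul_assoc]
  simp only [← mul_assoc (μ _)]
  rw [← Finset.sum_mul, h, mul_assoc]

/-- The Markov property at time 1. The sum over s' has only one nonzero term, the first state of z;
writing it as a sum lets later recursions restart from point masses. -/
theorem pathProb_cons (G : StochasticGame S A B) (μ : stdSimplex ℝ S) (π₁ : Policy S A)
    (π₂ : Policy S B) {n : ℕ} (q : S × A × B) (z : Fin (n + 1) → S × A × B) :
    G.pathProb μ π₁ π₂ (Fin.cons q z : Fin (n + 1 + 1) → S × A × B) =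
      μ q.1 * (π₁ q.1 q.2.1 * π₂ q.1 q.2.2) *
        ∑ s', G.P q.1 q.2.1 q.2.2 s' * G.pathProb (dirac s') π₁ π₂ z := by
  have h := sum_mul_dirac (z 0).1 (fun s => G.P q.1 q.2.1 q.2.2 s)
  have h1 : ∀ i : Fin n, (Fin.cons q z : Fin (n + 1 + 1) → S × A × B) (Fin.castSucc (Fin.succ i)) =
    z (Fin.castSucc i) := fun i => by
      rw [Fin.castSucc_succ]; exact Fin.cons_succ (α := fun _ => S × A × B) q z _
  simp only [pathProb, mul_assoc]
  simp only [← mul_assoc (G.P _ _ _ _) (dirac _ _)]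
  rw [← Finset.sum_mul, h, Fin.prod_univ_succ (n := n + 1), Fin.prod_univ_succ (n := n)
    (f := fun t => G.P ((Fin.cons q z : Fin (n + 1 + 1) → S × A × B) t.castSucc).1 _ _ _)]
  simp only [h1, Fin.cons_succ, Fin.cons_zero, Fin.castSucc_zero]
  ring

/-- The one-step trajectory. -/
def Traj.single (q : S × A × B) : Traj S A B := ⟨0, fun _ => q⟩

/-- Add a first step to a trajectory. -/
def Traj.cons (q : S × A × B) (τ : Traj S A B) : Traj S A B := ⟨τ.1 + 1, Fin.cons q τ.2⟩

theorem trajProb_single (G : StochasticGame S A B) (μ : stdSimplex ℝ S) (π₁ : Policy S A)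
    (π₂ : Policy S B) (q : S × A × B) :
    G.trajProb μ π₁ π₂ (Traj.single q) =
      μ q.1 * (π₁ q.1 q.2.1 * π₂ q.1 q.2.2) * G.stopProb q.1 q.2.1 q.2.2 := by
  change G.pathProb μ π₁ π₂ (n := 0) (fun _ => q) * G.stopProb q.1 q.2.1 q.2.2 = _
  rw [pathProb, Fin.prod_univ_succ, Fin.prod_univ_zero, Fin.prod_univ_zero]
  simp

theorem trajProb_cons (G : StochasticGame S A B) (μ : stdSimplex ℝ S) (π₁ : Policy S A)
    (π₂ : Policy S B) (q : S × A × B) (τ : Traj S A B) :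
    G.trajProb μ π₁ π₂ (Traj.cons q τ) =
      μ q.1 * (π₁ q.1 q.2.1 * π₂ q.1 q.2.2) *
        ∑ s', G.P q.1 q.2.1 q.2.2 s' * G.trajProb (dirac s') π₁ π₂ τ := by
  have h : (Fin.cons q τ.2 : Fin (τ.1 + 1 + 1) → S × A × B) (Fin.last (τ.1 + 1)) =
      τ.2 (Fin.last τ.1) := by
    rw [← Fin.succ_last]; exact Fin.cons_succ (α := fun _ => S × A × B) q τ.2 _
  simp only [trajProb, Traj.cons, pathProb_cons, h, ← mul_assoc, ← Finset.sum_mul]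

theorem sum_dirac_actions (π₁ : Policy S A) (π₂ : Policy S B) (s : S) (f : S × A × B → ℝ) :
    ∑ q : S × A × B, dirac s q.1 * (π₁ q.1 q.2.1 * π₂ q.1 q.2.2) * f q =
      play π₁ π₂ s fun a b => f (s, a, b) := by
  rw [Fintype.sum_prod_type]
  simp only [Fintype.sum_prod_type, mul_assoc, ← Finset.mul_sum]
  rw [sum_dirac_mul]
  simp only [play_eq_sum_left, Finset.mul_sum]

theorem sum_fin_succ_fun {M : Type*} [AddCommMonoid M] {Q : Type*} [Fintype Q] {n : ℕ}
    (f : (Fin (n + 1) → Q) → M) :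
    ∑ z, f z = ∑ q : Q, ∑ z : Fin n → Q, f (Fin.cons q z) := by
  rw [← (Fin.consEquiv (fun _ : Fin (n + 1) => Q)).sum_comp, Fintype.sum_prod_type]
  rfl

theorem sum_fin_one_fun {M : Type*} [AddCommMonoid M] {Q : Type*} [Fintype Q]
    (f : (Fin 1 → Q) → M) : ∑ z, f z = ∑ q : Q, f fun _ => q :=
  Fintype.sum_equiv (Equiv.funUnique (Fin 1) Q) _ _ fun z => by
    congr 1; funext i; rw [Subsingleton.elim i 0]; rfl

/-- Splitting off the first step reproduces the recursion `kernelPow_succ'`, so the law of the state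
at time n is a kernel power; summed over n this turns visit counts into the Green kernel. -/
theorem sum_pathProb_last (G : StochasticGame S A B) (π₁ : Policy S A) (π₂ : Policy S B)
    (s₀ : S) (n : ℕ) (f : S → ℝ) :
    ∑ z : Fin (n + 1) → S × A × B, G.pathProb (dirac s₀) π₁ π₂ z * f (z (Fin.last n)).1 =
      ∑ s, kernelPow (G.kernel π₁ π₂) s₀ n s * f s := by
  classical
  induction n generalizing s₀ with
  | zero =>
    have h2 : ∑ s, kernelPow (G.kernel π₁ π₂) s₀ 0 s * f s = f s₀ := by simp [kernelPow]
    rw [h2, sum_fin_one_fun]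
    have h := (sum_dirac_actions π₁ π₂ s₀ fun q => f q.1).trans (play_const π₁ π₂ s₀ (f s₀))
    rw [← h]
    refine Finset.sum_congr rfl fun q _ => ?_
    rw [pathProb, Fin.prod_univ_succ, Fin.prod_univ_zero]
    simp
  | succ n ih =>
    have hl : ∀ (q : S × A × B) (z : Fin (n + 1) → S × A × B),
        (Fin.cons q z : Fin (n + 1 + 1) → S × A × B) (Fin.last (n + 1)) = z (Fin.last n) :=
      fun q z => by
        rw [← Fin.succ_last]; exact Fin.cons_succ (α := fun _ => S × A × B) q z _
    rw [sum_fin_succ_fun]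
    simp only [pathProb_cons, hl]
    have h1 : ∀ q : S × A × B, ∑ z : Fin (n + 1) → S × A × B,
        dirac s₀ q.1 * (π₁ q.1 q.2.1 * π₂ q.1 q.2.2) *
          (∑ s', G.P q.1 q.2.1 q.2.2 s' * G.pathProb (dirac s') π₁ π₂ z) *
            f (z (Fin.last n)).1 =
        dirac s₀ q.1 * (π₁ q.1 q.2.1 * π₂ q.1 q.2.2) *
          ∑ s', G.P q.1 q.2.1 q.2.2 s' * ∑ s, kernelPow (G.kernel π₁ π₂) s' n s * f s := by
      intro q
      simp only [← ih, mul_assoc, ← Finset.mul_sum, Finset.sum_mul]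
      rw [Finset.sum_comm]
      simp only [Finset.mul_sum]
    simp only [h1, kernelPow_succ']
    rw [sum_dirac_actions π₁ π₂ s₀ (fun q => ∑ s', G.P q.1 q.2.1 q.2.2 s' *
      ∑ s, kernelPow (G.kernel π₁ π₂) s' n s * f s), ← sum_kernel_mul]
    simp only [Finset.sum_mul, Finset.mul_sum]
    rw [Finset.sum_comm]
    exact Finset.sum_congr rfl fun _ _ => Finset.sum_congr rfl fun _ _ => by ring

theorem visits_eq (G : StochasticGame S A B) (π₁ : Policy S A) (π₂ : Policy S B) (s₀ s : S) :
    G.visits π₁ π₂ s₀ s = greenKernel (G.kernel π₁ π₂) s₀ s := by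
  classical
  unfold visits greenKernel
  refine tsum_congr fun n => ?_
  have h := G.sum_pathProb_last π₁ π₂ s₀ n fun s' => if s' = s then 1 else 0
  simp only [mul_ite, mul_one, mul_zero, Finset.sum_ite_eq', Finset.mem_univ, if_true] at h
  rw [← h]

end StochasticGame

/-! ### Expectations over trajectories by first-step analysis -/

namespace StochasticGame

set_option linter.unusedSectionVars false

variable {S : Type u} {A : Type v} {B : Type w} [Fintype S] [Fintype A] [Fintype B]

/-- The part of the expectation of `F` that comes from trajectories with last time step `n`. -/
noncomputable def levelSum (G : StochasticGame S A B) (π₁ : Policy S A) (π₂ : Policy S B) (s : S)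
    (F : Traj S A B → ℝ) (n : ℕ) : ℝ :=
  ∑ z : Fin (n + 1) → S × A × B, G.trajProb (dirac s) π₁ π₂ ⟨n, z⟩ * F ⟨n, z⟩

/-- The part of the expectation of `F` that comes from trajectories with last time step `< n`. -/
noncomputable def partialExp (G : StochasticGame S A B) (π₁ : Policy S A) (π₂ : Policy S B) (s : S)
    (F : Traj S A B → ℝ) (n : ℕ) : ℝ :=
  ∑ k ∈ Finset.range n, G.levelSum π₁ π₂ s F k

/-- Integrability of `F` for the trajectories started at `s`. -/
def TrajIntegrable (G : StochasticGame S A B) (π₁ : Policy S A) (π₂ : Policy S B) (s : S)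
    (F : Traj S A B → ℝ) : Prop :=
  Summable fun τ => G.trajProb (dirac s) π₁ π₂ τ * F τ

/-- Expectation of `F` for the trajectories started at `s`. -/
noncomputable def trajExp (G : StochasticGame S A B) (π₁ : Policy S A) (π₂ : Policy S B) (s : S)
    (F : Traj S A B → ℝ) : ℝ :=
  ∑' τ, G.trajProb (dirac s) π₁ π₂ τ * F τ

variable (G : StochasticGame S A B) (π₁ : Policy S A) (π₂ : Policy S B)

theorem levelSum_zero (s : S) (F : Traj S A B → ℝ) :
    G.levelSum π₁ π₂ s F 0 = play π₁ π₂ s fun a b => G.stopProb s a b * F (Traj.single (s, a, b)) := by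
  rw [← sum_dirac_actions π₁ π₂ s (fun q => G.stopProb q.1 q.2.1 q.2.2 * F (Traj.single q)),
    levelSum, sum_fin_one_fun]
  refine Finset.sum_congr rfl fun q _ => ?_
  rw [← mul_assoc, ← trajProb_single]
  rfl

theorem levelSum_succ (s : S) (F : Traj S A B → ℝ) (n : ℕ) :
    G.levelSum π₁ π₂ s F (n + 1) = play π₁ π₂ s fun a b =>
      ∑ s', G.P s a b s' * G.levelSum π₁ π₂ s' (fun τ => F (Traj.cons (s, a, b) τ)) n := by
  rw [← sum_dirac_actions π₁ π₂ s (fun q =>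
    ∑ s', G.P q.1 q.2.1 q.2.2 s' * G.levelSum π₁ π₂ s' (fun τ => F (Traj.cons q τ)) n),
    levelSum, sum_fin_succ_fun]
  refine Finset.sum_congr rfl fun q _ => ?_
  have h : ∀ z : Fin (n + 1) → S × A × B,
      G.trajProb (dirac s) π₁ π₂ ⟨n + 1, Fin.cons q z⟩ * F ⟨n + 1, Fin.cons q z⟩ = _ :=
    fun z => congrArg (· * F (Traj.cons q ⟨n, z⟩)) (G.trajProb_cons (dirac s) π₁ π₂ q ⟨n, z⟩)
  rw [Finset.sum_congr rfl fun z _ => h z]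
  simp only [levelSum, mul_assoc, ← Finset.mul_sum, Finset.sum_mul]
  rw [Finset.sum_comm]
  simp only [Finset.mul_sum]

/-- Truncated expectations are finite sums, so moment bounds can be proved by induction on n with
this recursion before any integrability is known. -/
theorem partialExp_succ (s : S) (F : Traj S A B → ℝ) (n : ℕ) :
    G.partialExp π₁ π₂ s F (n + 1) = play π₁ π₂ s fun a b =>
      G.stopProb s a b * F (Traj.single (s, a, b)) +
        ∑ s', G.P s a b s' * G.partialExp π₁ π₂ s' (fun τ => F (Traj.cons (s, a, b) τ)) n := by
  rw [partialExp, Finset.sum_range_succ', levelSum_zero, play_add, add_comm]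
  congr 1
  simp only [levelSum_succ, partialExp, Finset.mul_sum]
  rw [← play_sum]
  congr 1
  funext a b
  rw [Finset.sum_comm]

theorem partialExp_zero (s : S) (F : Traj S A B → ℝ) : G.partialExp π₁ π₂ s F 0 = 0 := by
  simp [partialExp]

theorem partialExp_add (s : S) (F F' : Traj S A B → ℝ) (n : ℕ) :
    G.partialExp π₁ π₂ s (fun τ => F τ + F' τ) n =
      G.partialExp π₁ π₂ s F n + G.partialExp π₁ π₂ s F' n := by
  simp only [partialExp, levelSum, mul_add, Finset.sum_add_distrib]

theorem partialExp_const_mul (s : S) (c : ℝ) (F : Traj S A B → ℝ) (n : ℕ) :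
    G.partialExp π₁ π₂ s (fun τ => c * F τ) n = c * G.partialExp π₁ π₂ s F n := by
  simp only [partialExp, levelSum, Finset.mul_sum]
  exact Finset.sum_congr rfl fun _ _ => Finset.sum_congr rfl fun _ _ => by ring

variable {G π₁ π₂}

/-- Monotone convergence: for nonnegative functions the truncations increase to the full
expectation. -/
theorem trajIntegrable_of_partialExp_le {s : S} {F : Traj S A B → ℝ} (hF : ∀ τ, 0 ≤ F τ) {c : ℝ}
    (hc : ∀ n, G.partialExp π₁ π₂ s F n ≤ c) :
    G.TrajIntegrable π₁ π₂ s F ∧ G.trajExp π₁ π₂ s F ≤ c := by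
  have h0 : ∀ τ, 0 ≤ G.trajProb (dirac s) π₁ π₂ τ * F τ := fun τ =>
    mul_nonneg (G.trajProb_nonneg _ _ _ τ) (hF τ)
  have hl : ∀ n, 0 ≤ G.levelSum π₁ π₂ s F n := fun n => Finset.sum_nonneg fun z _ => h0 _
  have hs : Summable (G.levelSum π₁ π₂ s F) := summable_of_sum_range_le hl hc
  have h1 : G.TrajIntegrable π₁ π₂ s F := by
    refine (summable_sigma_of_nonneg h0).2 ⟨fun n => (hasSum_fintype _).summable, ?_⟩
    simp only [tsum_fintype]
    exact hs
  refine ⟨h1, ?_⟩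
  have h2 : G.trajExp π₁ π₂ s F = ∑' n, G.levelSum π₁ π₂ s F n := by
    unfold trajExp
    rw [Summable.tsum_sigma' (fun n => (hasSum_fintype _).summable) h1]
    simp only [tsum_fintype]
    rfl
  rw [h2]
  exact hs.tsum_le_of_sum_range_le hc

theorem TrajIntegrable.hasSum_levelSum {s : S} {F : Traj S A B → ℝ}
    (h : G.TrajIntegrable π₁ π₂ s F) :
    HasSum (G.levelSum π₁ π₂ s F) (G.trajExp π₁ π₂ s F) := by
  have := h.hasSum.sigma (fun n => hasSum_fintype _)
  exact this

theorem trajExp_eq_play {s : S} {F : Traj S A B → ℝ} (h : G.TrajIntegrable π₁ π₂ s F)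
    (h' : ∀ a b s', G.TrajIntegrable π₁ π₂ s' fun τ => F (Traj.cons (s, a, b) τ)) :
    G.trajExp π₁ π₂ s F = play π₁ π₂ s fun a b =>
      G.stopProb s a b * F (Traj.single (s, a, b)) +
        ∑ s', G.P s a b s' * G.trajExp π₁ π₂ s' (fun τ => F (Traj.cons (s, a, b) τ)) := by
  rw [← h.hasSum_levelSum.tsum_eq, h.hasSum_levelSum.summable.tsum_eq_zero_add, levelSum_zero,
    play_add]
  congr 1
  simp only [levelSum_succ]
  unfold play
  refine HasSum.tsum_eq ?_
  refine hasSum_sum fun a _ => hasSum_sum fun b _ => HasSum.mul_left _ ?_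
  exact hasSum_sum fun s' _ => (h' a b s').hasSum_levelSum.mul_left _

theorem TrajIntegrable.mono {s : S} {F F' : Traj S A B → ℝ} (h : G.TrajIntegrable π₁ π₂ s F')
    (hF : ∀ τ, |F τ| ≤ F' τ) : G.TrajIntegrable π₁ π₂ s F :=
  Summable.of_norm_bounded h fun τ => by
    rw [Real.norm_eq_abs, abs_mul, abs_of_nonneg (G.trajProb_nonneg _ _ _ τ)]
    exact mul_le_mul_of_nonneg_left (hF τ) (G.trajProb_nonneg _ _ _ τ)

theorem TrajIntegrable.add {s : S} {F F' : Traj S A B → ℝ} (h : G.TrajIntegrable π₁ π₂ s F)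
    (h' : G.TrajIntegrable π₁ π₂ s F') : G.TrajIntegrable π₁ π₂ s fun τ => F τ + F' τ :=
  (Summable.add h h').congr fun τ => by ring

theorem TrajIntegrable.const_mul {s : S} {F : Traj S A B → ℝ} (h : G.TrajIntegrable π₁ π₂ s F)
    (c : ℝ) : G.TrajIntegrable π₁ π₂ s fun τ => c * F τ :=
  (Summable.mul_left c h).congr fun τ => by ring

theorem trajExp_add {s : S} {F F' : Traj S A B → ℝ} (h : G.TrajIntegrable π₁ π₂ s F)
    (h' : G.TrajIntegrable π₁ π₂ s F') :
    G.trajExp π₁ π₂ s (fun τ => F τ + F' τ) = G.trajExp π₁ π₂ s F + G.trajExp π₁ π₂ s F' := by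
  unfold trajExp
  rw [← Summable.tsum_add h h']
  exact tsum_congr fun τ => by ring

theorem trajExp_const_mul {s : S} (F : Traj S A B → ℝ) (c : ℝ) :
    G.trajExp π₁ π₂ s (fun τ => c * F τ) = c * G.trajExp π₁ π₂ s F := by
  unfold trajExp
  rw [← tsum_mul_left]
  exact tsum_congr fun τ => by ring

theorem hasSum_trajProb_real (μ : stdSimplex ℝ S) :
    HasSum (fun τ : Traj S A B => G.trajProb μ π₁ π₂ τ) 1 := by
  have h := G.hasSum_trajProb μ π₁ π₂
  have h1 : Summable (fun τ : Traj S A B => G.trajProb μ π₁ π₂ τ) := by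
    have := ENNReal.summable_toReal (f := fun τ : Traj S A B =>
      ENNReal.ofReal (G.trajProb μ π₁ π₂ τ)) (by rw [h.tsum_eq]; simp)
    simpa [ENNReal.toReal_ofReal (G.trajProb_nonneg μ π₁ π₂ _)] using this
  have h2 := h.tsum_eq
  rw [← ENNReal.ofReal_tsum_of_nonneg (G.trajProb_nonneg μ π₁ π₂) h1] at h2
  rw [ENNReal.ofReal_eq_one] at h2
  rw [← h2]
  exact h1.hasSum

theorem trajIntegrable_const (s : S) (c : ℝ) : G.TrajIntegrable π₁ π₂ s fun _ => c :=
  (hasSum_trajProb_real (dirac s)).summable.mul_right c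

theorem trajExp_const (s : S) (c : ℝ) : G.trajExp π₁ π₂ s (fun _ => c) = c := by
  unfold trajExp
  rw [tsum_mul_right, (hasSum_trajProb_real (dirac s)).tsum_eq, one_mul]

theorem trajLaw_apply_toReal (μ : stdSimplex ℝ S) (τ : Traj S A B) :
    (G.trajLaw μ π₁ π₂ τ).toReal = G.trajProb μ π₁ π₂ τ :=
  ENNReal.toReal_ofReal (G.trajProb_nonneg μ π₁ π₂ τ)

theorem trajLaw_dirac_expect (s : S) (F : Traj S A B → ℝ) :
    (G.trajLaw (dirac s) π₁ π₂).expect F = G.trajExp π₁ π₂ s F :=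
  tsum_congr fun τ => by rw [trajLaw_apply_toReal]

theorem trajProb_eq_sum (μ : stdSimplex ℝ S) (τ : Traj S A B) :
    G.trajProb μ π₁ π₂ τ = ∑ s, μ s * G.trajProb (dirac s) π₁ π₂ τ := by
  simp only [trajProb]
  rw [pathProb_eq_sum]
  simp only [Finset.sum_mul, mul_assoc]

theorem hasSum_trajLaw (μ : stdSimplex ℝ S) {F : Traj S A B → ℝ}
    (h : ∀ s, G.TrajIntegrable π₁ π₂ s F) :
    HasSum (fun τ => G.trajProb μ π₁ π₂ τ * F τ) (∑ s, μ s * G.trajExp π₁ π₂ s F) := by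
  have := hasSum_sum (s := Finset.univ) fun s _ => (h s).hasSum.mul_left (μ s)
  refine this.congr_fun fun τ => ?_
  rw [trajProb_eq_sum, Finset.sum_mul]
  simp only [mul_assoc]

end StochasticGame

/-! ### Moment bounds and the policy gradient theorem -/

namespace StochasticGame

set_option linter.unusedSectionVars false

variable {S : Type u} {A : Type v} {B : Type w} [Fintype S] [Fintype A] [Fintype B]

/-- Sum of `c` along a trajectory. -/
def pathSum (c : S → A → B → ℝ) (τ : Traj S A B) : ℝ := ∑ t, c (τ.2 t).1 (τ.2 t).2.1 (τ.2 t).2.2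

theorem pathSum_single (c : S → A → B → ℝ) (q : S × A × B) :
    pathSum c (Traj.single q) = c q.1 q.2.1 q.2.2 := by
  change ∑ t : Fin 1, c q.1 q.2.1 q.2.2 = _
  simp

theorem pathSum_cons (c : S → A → B → ℝ) (q : S × A × B) (τ : Traj S A B) :
    pathSum c (Traj.cons q τ) = c q.1 q.2.1 q.2.2 + pathSum c τ := by
  change ∑ t : Fin (τ.1 + 1 + 1), c ((Fin.cons q τ.2 : Fin (τ.1 + 1 + 1) → S × A × B) t).1 _ _ = _
  rw [Fin.sum_univ_succ]
  rfl

theorem abs_pathSum_le {c : S → A → B → ℝ} {d : ℝ} (h : ∀ s a b, |c s a b| ≤ d)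
    (τ : Traj S A B) : |pathSum c τ| ≤ d * (τ.1 + 1) := by
  refine (Finset.abs_sum_le_sum_abs _ _).trans ((Finset.sum_le_sum fun t _ => h _ _ _).trans ?_)
  simp
  linarith

theorem pathSum_nonneg {c : S → A → B → ℝ} (h : ∀ s a b, 0 ≤ c s a b) (τ : Traj S A B) :
    0 ≤ pathSum c τ := Finset.sum_nonneg fun _ _ => h _ _ _

/-- Exponential weight of a trajectory, with a rate at which it is still integrable. -/
noncomputable def expWeight (ζ : ℝ) (τ : Traj S A B) : ℝ := ((1 + ζ / 9) ^ 3) ^ (τ.1 + 1)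

theorem expWeight_nonneg {ζ : ℝ} (hζ : 0 < ζ) (τ : Traj S A B) : 0 ≤ expWeight ζ τ := by
  unfold expWeight; positivity

theorem expWeight_single (ζ : ℝ) (q : S × A × B) :
    expWeight ζ (Traj.single q) = (1 + ζ / 9) ^ 3 := by
  change ((1 + ζ / 9) ^ 3) ^ (0 + 1) = _
  simp

theorem expWeight_cons (ζ : ℝ) (q : S × A × B) (τ : Traj S A B) :
    expWeight ζ (Traj.cons q τ) = (1 + ζ / 9) ^ 3 * expWeight ζ τ := by
  change ((1 + ζ / 9) ^ 3) ^ (τ.1 + 1 + 1) = _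
  rw [pow_succ', expWeight]

/-- Bernoulli's inequality for (1 + ζ/9)^(T+1), cubed. The cube is the power of the length that
appears in the second moment of the gradient estimate. -/
theorem cube_length_le {ζ : ℝ} (hζ : 0 < ζ) (τ : Traj S A B) :
    ((τ.1 : ℝ) + 1) ^ 3 ≤ (9 / ζ) ^ 3 * expWeight ζ τ := by
  have h := one_add_mul_le_pow (a := ζ / 9) (by linarith) (τ.1 + 1)
  push_cast at h
  have h1 : ((τ.1 : ℝ) + 1) ≤ 9 / ζ * (1 + ζ / 9) ^ (τ.1 + 1) := by
    calc ((τ.1 : ℝ) + 1) = 9 / ζ * ((τ.1 + 1) * (ζ / 9)) := by field_simp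
      _ ≤ _ := by gcongr; linarith
  calc ((τ.1 : ℝ) + 1) ^ 3 ≤ (9 / ζ * (1 + ζ / 9) ^ (τ.1 + 1)) ^ 3 := by gcongr
    _ = _ := by rw [mul_pow, expWeight, ← pow_mul, ← pow_mul, mul_comm 3]

theorem growth_le {ζ : ℝ} (hζ : 0 < ζ) (hζ1 : ζ ≤ 1) : (1 + ζ / 9) ^ 3 ≤ 1 + ζ / 2 := by
  have : 0 ≤ ζ * (1 - ζ) := mul_nonneg hζ.le (by linarith)
  nlinarith [mul_nonneg hζ.le this]

variable {G : StochasticGame S A B} {π₁ : Policy S A} {π₂ : Policy S B} {ζ : ℝ}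

theorem sum_P_eq (s : S) (a : A) (b : B) : ∑ s', G.P s a b s' = 1 - G.stopProb s a b := by
  unfold stopProb; ring

theorem stopProb_le_one (s : S) (a : A) (b : B) : G.stopProb s a b ≤ 1 := by
  unfold stopProb
  linarith [Finset.sum_nonneg fun s' (_ : s' ∈ Finset.univ) => G.P_nonneg s a b s']

theorem sum_P_mul_le {u : S → ℝ} {c : ℝ} (h : ∀ s, u s ≤ c) (s : S) (a : A) (b : B) :
    ∑ s', G.P s a b s' * u s' ≤ (1 - G.stopProb s a b) * c := by
  rw [← sum_P_eq, Finset.sum_mul]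
  exact Finset.sum_le_sum fun s' _ => mul_le_mul_of_nonneg_left (h s') (G.P_nonneg _ _ _ _)

/-- With growth factor q ≤ 1 + ζ/2 and stopping probability p ≥ ζ, the bound 3 reproduces itself: pq
+ (1 - p)·3q = q(3 - 2p) ≤ (1 + ζ/2)(3 - 2ζ) ≤ 3. -/
theorem partialExp_expWeight_le (hζ : 0 < ζ) (hζ1 : ζ ≤ 1) (hG : ∀ s a b, ζ ≤ G.stopProb s a b)
    (s : S) (n : ℕ) : G.partialExp π₁ π₂ s (expWeight ζ) n ≤ 3 := by
  induction n generalizing s with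
  | zero => rw [partialExp_zero]; norm_num
  | succ n ih =>
    rw [partialExp_succ, ← play_const π₁ π₂ s 3]
    refine play_mono π₁ π₂ s fun a b => ?_
    simp only [expWeight_single, expWeight_cons, partialExp_const_mul]
    have hq := growth_le hζ hζ1
    have hq0 : 0 ≤ (1 + ζ / 9) ^ 3 := by positivity
    have h1 := hG s a b
    calc G.stopProb s a b * (1 + ζ / 9) ^ 3 + ∑ s', G.P s a b s' *
          ((1 + ζ / 9) ^ 3 * G.partialExp π₁ π₂ s' (expWeight ζ) n)
        ≤ G.stopProb s a b * (1 + ζ / 9) ^ 3 + (1 - G.stopProb s a b) * ((1 + ζ / 9) ^ 3 * 3) := by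
          gcongr
          exact sum_P_mul_le (fun s' => mul_le_mul_of_nonneg_left (ih s') hq0) s a b
      _ = (1 + ζ / 9) ^ 3 * (3 - 2 * G.stopProb s a b) := by ring
      _ ≤ (1 + ζ / 2) * (3 - 2 * ζ) := by
          refine mul_le_mul hq (by linarith) ?_ (by linarith)
          have := G.stopProb_le_one s a b
          linarith
      _ ≤ 3 := by nlinarith

/-- Only the average of c under the current policies enters, not its supremum. For c = 1/π² this
gains a factor of the exploration rate, since the average of 1/π² is the sum of 1/π. -/
theorem partialExp_expWeight_mul_pathSum_le (hζ : 0 < ζ) (hζ1 : ζ ≤ 1)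
    (hG : ∀ s a b, ζ ≤ G.stopProb s a b) {c : S → A → B → ℝ} (hc : ∀ s a b, 0 ≤ c s a b) {d : ℝ}
    (hd : ∀ s, play π₁ π₂ s (c s) ≤ d) (hd0 : 0 ≤ d) (s : S) (n : ℕ) :
    G.partialExp π₁ π₂ s (fun τ => expWeight ζ τ * pathSum c τ) n ≤ 9 * d / ζ := by
  induction n generalizing s with
  | zero => rw [partialExp_zero]; positivity
  | succ n ih =>
    have hq := growth_le hζ hζ1
    have hq0 : 0 ≤ (1 + ζ / 9) ^ 3 := by positivity
    have hm := fun s => G.partialExp_expWeight_le (π₁ := π₁) (π₂ := π₂) hζ hζ1 hG s n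
    have hx0 : 0 ≤ 9 * d / ζ := by positivity
    have key : G.partialExp π₁ π₂ s (fun τ => expWeight ζ τ * pathSum c τ) (n + 1) ≤
        play π₁ π₂ s fun a b => 9 / 2 * c s a b + (1 - ζ / 2) * (9 * d / ζ) := by
      rw [partialExp_succ]
      refine play_mono π₁ π₂ s fun a b => ?_
      have hcons : (fun τ => expWeight ζ (Traj.cons (s, a, b) τ) *
          pathSum c (Traj.cons (s, a, b) τ)) = fun τ : Traj S A B =>
          (1 + ζ / 9) ^ 3 * c s a b * expWeight ζ τ +
            (1 + ζ / 9) ^ 3 * (expWeight ζ τ * pathSum c τ) := by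
        funext τ
        rw [expWeight_cons, pathSum_cons]
        ring
      rw [hcons]
      simp only [expWeight_single, pathSum_single, partialExp_add, partialExp_const_mul]
      have h0 := hc s a b
      have h1 := hG s a b
      have h2 := G.stopProb_le_one s a b
      have hle := G.sum_P_mul_le (u := fun s' => (1 + ζ / 9) ^ 3 * c s a b *
          G.partialExp π₁ π₂ s' (expWeight ζ) n + (1 + ζ / 9) ^ 3 *
          G.partialExp π₁ π₂ s' (fun τ => expWeight ζ τ * pathSum c τ) n)
        (fun s' => add_le_add (mul_le_mul_of_nonneg_left (hm s') (mul_nonneg hq0 h0))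
          (mul_le_mul_of_nonneg_left (ih s') hq0)) s a b
      have h3 : (1 + ζ / 9) ^ 3 * c s a b * (3 - 2 * G.stopProb s a b) ≤ 3 / 2 * c s a b * 3 :=
        mul_le_mul (mul_le_mul_of_nonneg_right (by linarith) h0) (by linarith) (by linarith)
          (by positivity)
      have h4 : (1 - G.stopProb s a b) * (1 + ζ / 9) ^ 3 ≤ 1 - ζ / 2 := by
        calc (1 - G.stopProb s a b) * (1 + ζ / 9) ^ 3 ≤ (1 - ζ) * (1 + ζ / 2) :=
              mul_le_mul (by linarith) hq hq0 (by linarith)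
          _ ≤ _ := by nlinarith
      have h5 := mul_le_mul_of_nonneg_right h4 hx0
      linarith
    refine key.trans ?_
    rw [play_add, play_const_mul, play_const]
    have := hd s
    have h6 : ζ / 2 * (9 * d / ζ) = 9 / 2 * d := by field_simp
    linarith

theorem trajIntegrable_of_abs_le_cube (hζ : 0 < ζ) (hζ1 : ζ ≤ 1)
    (hG : ∀ s a b, ζ ≤ G.stopProb s a b) {F : Traj S A B → ℝ} {c : ℝ} (hc : 0 ≤ c)
    (hF : ∀ τ, |F τ| ≤ c * ((τ.1 : ℝ) + 1) ^ 3) (s : S) : G.TrajIntegrable π₁ π₂ s F := by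
  have h := (trajIntegrable_of_partialExp_le (expWeight_nonneg hζ)
    (G.partialExp_expWeight_le (π₁ := π₁) (π₂ := π₂) hζ hζ1 hG s)).1
  refine (h.const_mul (c * (9 / ζ) ^ 3)).mono fun τ => (hF τ).trans ?_
  rw [mul_assoc]
  exact mul_le_mul_of_nonneg_left (cube_length_le hζ τ) hc

theorem one_le_length (τ : Traj S A B) : (1 : ℝ) ≤ (τ.1 : ℝ) + 1 := by
  have : (0 : ℝ) ≤ τ.1 := Nat.cast_nonneg _
  linarith

theorem abs_totalReward_le (τ : Traj S A B) : |G.totalReward τ| ≤ (τ.1 : ℝ) + 1 := by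
  have := abs_pathSum_le G.abs_R_le_one τ
  rw [one_mul] at this
  exact this

/-- The second moment of `totalReward * ∑ c` for weights `c` with `E[c²] ≤ d`. -/
theorem trajExp_sq_totalReward_mul_le (hζ : 0 < ζ) (hζ1 : ζ ≤ 1)
    (hG : ∀ s a b, ζ ≤ G.stopProb s a b) {c : S → A → B → ℝ} {d : ℝ}
    (hd : ∀ s, play π₁ π₂ s (fun a b => c s a b ^ 2) ≤ d) (hd0 : 0 ≤ d) {F : Traj S A B → ℝ}
    (hF0 : ∀ τ, 0 ≤ F τ) (hF : ∀ τ, F τ ≤ (G.totalReward τ * pathSum c τ) ^ 2) (s : S) :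
    G.TrajIntegrable π₁ π₂ s F ∧ G.trajExp π₁ π₂ s F ≤ 6561 * d / ζ ^ 4 := by
  set W : Traj S A B → ℝ := fun τ =>
    (9 / ζ) ^ 3 * (expWeight ζ τ * pathSum (fun s a b => c s a b ^ 2) τ) with hW
  have hsq : ∀ τ : Traj S A B, 0 ≤ pathSum (fun s a b => c s a b ^ 2) τ := fun τ =>
    pathSum_nonneg (fun s a b => sq_nonneg _) τ
  have hle : ∀ τ, F τ ≤ W τ := fun τ => by
    -- Cauchy–Schwarz costs one factor of the length and the squared total reward costs two;
    -- `cube_length_le` trades all three for the exponential weight. The constant 6561 is 9³ · 9.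
    have h1 : pathSum c τ ^ 2 ≤ ((τ.1 : ℝ) + 1) * pathSum (fun s a b => c s a b ^ 2) τ := by
      have := sq_sum_le_card_mul_sum_sq (s := (Finset.univ : Finset (Fin (τ.1 + 1))))
        (f := fun t => c (τ.2 t).1 (τ.2 t).2.1 (τ.2 t).2.2)
      simpa [pathSum] using this
    have h2 : G.totalReward τ ^ 2 ≤ ((τ.1 : ℝ) + 1) ^ 2 := by
      rw [sq_le_sq, abs_of_nonneg (a := (τ.1 : ℝ) + 1) (by positivity)]
      exact abs_totalReward_le τ
    calc F τ ≤ G.totalReward τ ^ 2 * pathSum c τ ^ 2 := by rw [← mul_pow]; exact hF τ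
      _ ≤ ((τ.1 : ℝ) + 1) ^ 2 * (((τ.1 : ℝ) + 1) * pathSum (fun s a b => c s a b ^ 2) τ) :=
          mul_le_mul h2 h1 (sq_nonneg _) (sq_nonneg _)
      _ = ((τ.1 : ℝ) + 1) ^ 3 * pathSum (fun s a b => c s a b ^ 2) τ := by ring
      _ ≤ (9 / ζ) ^ 3 * expWeight ζ τ * pathSum (fun s a b => c s a b ^ 2) τ :=
          mul_le_mul_of_nonneg_right (cube_length_le hζ τ) (hsq τ)
      _ = W τ := by rw [hW]; ring
  refine trajIntegrable_of_partialExp_le hF0 fun n => ?_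
  calc G.partialExp π₁ π₂ s F n ≤ G.partialExp π₁ π₂ s W n :=
        Finset.sum_le_sum fun k _ => Finset.sum_le_sum fun z _ =>
          mul_le_mul_of_nonneg_left (hle _) (G.trajProb_nonneg _ _ _ _)
    _ = (9 / ζ) ^ 3 * G.partialExp π₁ π₂ s
          (fun τ => expWeight ζ τ * pathSum (fun s a b => c s a b ^ 2) τ) n :=
        G.partialExp_const_mul π₁ π₂ s _ _ n
    _ ≤ (9 / ζ) ^ 3 * (9 * d / ζ) := by
        gcongr
        exact partialExp_expWeight_mul_pathSum_le hζ hζ1 hG (fun s a b => sq_nonneg _) hd hd0 s n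
    _ = 6561 * d / ζ ^ 4 := by field_simp; ring

theorem trajIntegrable_pathSum (hζ : 0 < ζ) (hζ1 : ζ ≤ 1)
    (hG : ∀ s a b, ζ ≤ G.stopProb s a b) (c : S → A → B → ℝ) (s : S) :
    G.TrajIntegrable π₁ π₂ s (pathSum c) := by
  obtain ⟨d, hd⟩ : ∃ d, ∀ q : S × A × B, |c q.1 q.2.1 q.2.2| ≤ d := by
    obtain ⟨d, hd⟩ := (Set.finite_range fun q : S × A × B => |c q.1 q.2.1 q.2.2|).bddAbove
    exact ⟨d, fun q => hd ⟨q, rfl⟩⟩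
  refine trajIntegrable_of_abs_le_cube hζ hζ1 hG (c := |d|) (abs_nonneg d) (fun τ => ?_) s
  refine (abs_pathSum_le (d := |d|) (fun s a b => (hd (s, a, b)).trans (le_abs_self d)) τ).trans ?_
  have h1 := one_le_length τ
  gcongr
  exact le_self_pow₀ h1 (by norm_num)

theorem trajExp_pathSum (hζ : 0 < ζ) (hζ1 : ζ ≤ 1) (hG : ∀ s a b, ζ ≤ G.stopProb s a b)
    (c : S → A → B → ℝ) (s : S) :
    G.trajExp π₁ π₂ s (pathSum c) = play π₁ π₂ s (c s) +
      ∑ s', G.kernel π₁ π₂ s s' * G.trajExp π₁ π₂ s' (pathSum c) := by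
  have hi := fun s => trajIntegrable_pathSum (π₁ := π₁) (π₂ := π₂) hζ hζ1 hG c s
  have hcons : ∀ a b, (fun τ => pathSum c (Traj.cons (s, a, b) τ)) =
      fun τ => c s a b + pathSum c τ := fun a b => funext fun τ => pathSum_cons c _ τ
  rw [trajExp_eq_play (hi s) fun a b s' => by
    rw [hcons]; exact (trajIntegrable_const s' _).add (hi s'), sum_kernel_mul, ← play_add]
  congr 1
  funext a b
  rw [hcons]
  simp only [trajExp_add (trajIntegrable_const _ _) (hi _), trajExp_const, mul_add,
    Finset.sum_add_distrib, ← Finset.sum_mul, sum_P_eq, pathSum_single]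
  ring

theorem stateValue_eq_trajExp (s : S) :
    G.stateValue π₁ π₂ s = G.trajExp π₁ π₂ s (pathSum G.R) := trajLaw_dirac_expect s _

variable (G π₁ π₂) in
/-- The action value function `Q^{π₁,π₂}`. -/
noncomputable def actionValue (s : S) (a : A) (b : B) : ℝ :=
  G.R s a b + ∑ s', G.P s a b s' * G.stateValue π₁ π₂ s'

theorem stateValue_eq_reward_add (hζ : 0 < ζ) (hζ1 : ζ ≤ 1) (hG : ∀ s a b, ζ ≤ G.stopProb s a b)
    (s : S) : G.stateValue π₁ π₂ s = play π₁ π₂ s (G.R s) +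
      ∑ s', G.kernel π₁ π₂ s s' * G.stateValue π₁ π₂ s' := by
  simp only [stateValue_eq_trajExp]
  exact trajExp_pathSum hζ hζ1 hG G.R s

theorem play_actionValue (hζ : 0 < ζ) (hζ1 : ζ ≤ 1) (hG : ∀ s a b, ζ ≤ G.stopProb s a b)
    (s : S) : play π₁ π₂ s (G.actionValue π₁ π₂ s) = G.stateValue π₁ π₂ s := by
  rw [stateValue_eq_reward_add hζ hζ1 hG, sum_kernel_mul, ← play_add]
  rfl

theorem abs_stateValue_le (hζ : 0 < ζ) (hζ1 : ζ ≤ 1) (hG : ∀ s a b, ζ ≤ G.stopProb s a b)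
    (s : S) : |G.stateValue π₁ π₂ s| ≤ 1 / ζ :=
  (G.isSubstochastic_kernel hG π₁ π₂).abs_le_of_eq hζ hζ1
    (stateValue_eq_reward_add hζ hζ1 hG) (fun s => abs_play_le π₁ π₂ s (G.abs_R_le_one s)) s

/-- The expectation solves the linear equation with zero source term, whose only solution is zero.
-/
theorem trajExp_pathSum_eq_zero (hζ : 0 < ζ) (hζ1 : ζ ≤ 1) (hG : ∀ s a b, ζ ≤ G.stopProb s a b)
    {w : S → A → B → ℝ} (hw : ∀ s, play π₁ π₂ s (w s) = 0) (s : S) :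
    G.trajExp π₁ π₂ s (pathSum w) = 0 := by
  have h := (G.isSubstochastic_kernel hG π₁ π₂).abs_le_of_eq hζ hζ1
    (trajExp_pathSum (π₁ := π₁) (π₂ := π₂) hζ hζ1 hG w) (c := 0) (fun s => by simp [hw s]) s
  simpa using h

theorem trajIntegrable_totalReward_mul_pathSum (hζ : 0 < ζ) (hζ1 : ζ ≤ 1)
    (hG : ∀ s a b, ζ ≤ G.stopProb s a b) (w : S → A → B → ℝ) (s : S) :
    G.TrajIntegrable π₁ π₂ s fun τ => pathSum G.R τ * pathSum w τ := by
  obtain ⟨d, hd⟩ : ∃ d, ∀ q : S × A × B, |w q.1 q.2.1 q.2.2| ≤ d := by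
    obtain ⟨d, hd⟩ := (Set.finite_range fun q : S × A × B => |w q.1 q.2.1 q.2.2|).bddAbove
    exact ⟨d, fun q => hd ⟨q, rfl⟩⟩
  refine trajIntegrable_of_abs_le_cube hζ hζ1 hG (c := |d|) (abs_nonneg d) (fun τ => ?_) s
  have h2 := abs_pathSum_le (d := |d|) (fun s a b => (hd (s, a, b)).trans (le_abs_self d)) τ
  have h1 := one_le_length τ
  rw [abs_mul]
  calc |pathSum G.R τ| * |pathSum w τ| ≤ ((τ.1 : ℝ) + 1) * (|d| * ((τ.1 : ℝ) + 1)) :=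
        mul_le_mul (abs_totalReward_le τ) h2 (abs_nonneg _) (by linarith)
    _ = |d| * ((τ.1 : ℝ) + 1) ^ 2 := by ring
    _ ≤ |d| * ((τ.1 : ℝ) + 1) ^ 3 := by
        gcongr
        norm_num

/-- The policy gradient theorem for centered weights. -/
theorem trajExp_totalReward_mul_pathSum (hζ : 0 < ζ) (hζ1 : ζ ≤ 1)
    (hG : ∀ s a b, ζ ≤ G.stopProb s a b) {w : S → A → B → ℝ}
    (hw : ∀ s, play π₁ π₂ s (w s) = 0) (s : S) :
    G.trajExp π₁ π₂ s (fun τ => G.totalReward τ * pathSum w τ) =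
      ∑ s', greenKernel (G.kernel π₁ π₂) s s' *
        play π₁ π₂ s' (fun a b => w s' a b * G.actionValue π₁ π₂ s' a b) := by
  refine (G.isSubstochastic_kernel hG π₁ π₂).eq_sum_greenKernel hζ hζ1
    (u := fun s => G.trajExp π₁ π₂ s fun τ => pathSum G.R τ * pathSum w τ) (fun s => ?_) s
  have hR := fun s => trajIntegrable_pathSum (π₁ := π₁) (π₂ := π₂) hζ hζ1 hG G.R s
  have hW := fun s => trajIntegrable_pathSum (π₁ := π₁) (π₂ := π₂) hζ hζ1 hG w s
  have hi := fun s =>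
    trajIntegrable_totalReward_mul_pathSum (π₁ := π₁) (π₂ := π₂) hζ hζ1 hG w s
  -- Expand the product of the two sums after one step. Future weights have mean zero, so R times
  -- the future sum of w drops out. The remaining source term is w(R + PV) = wQ, and the product of
  -- the two future sums gives the recursion solved by the Green kernel.
  have hcons : ∀ a b, (fun τ => pathSum G.R (Traj.cons (s, a, b) τ) *
      pathSum w (Traj.cons (s, a, b) τ)) =
      fun τ => (G.R s a b * w s a b + (G.R s a b * pathSum w τ + w s a b * pathSum G.R τ)) +
        pathSum G.R τ * pathSum w τ := fun a b => funext fun τ => by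
    rw [pathSum_cons, pathSum_cons]
    ring
  have h1 := fun a b s' => (trajIntegrable_const (G := G) (π₁ := π₁) (π₂ := π₂) s'
    (G.R s a b * w s a b))
  have h2 := fun a b s' => ((hW s').const_mul (G.R s a b)).add ((hR s').const_mul (w s a b))
  rw [trajExp_eq_play (hi s) fun a b s' => by
    rw [hcons]; exact ((h1 a b s').add (h2 a b s')).add (hi s'), sum_kernel_mul, ← play_add]
  congr 1
  funext a b
  rw [hcons]
  have h3 : ∀ s', G.trajExp π₁ π₂ s' (fun τ => (G.R s a b * w s a b +
      (G.R s a b * pathSum w τ + w s a b * pathSum G.R τ)) + pathSum G.R τ * pathSum w τ) =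
      G.R s a b * w s a b + w s a b * G.stateValue π₁ π₂ s' +
        G.trajExp π₁ π₂ s' (fun τ => pathSum G.R τ * pathSum w τ) := fun s' => by
    rw [trajExp_add ((h1 a b s').add (h2 a b s')) (hi s'), trajExp_add (h1 a b s') (h2 a b s'),
      trajExp_add ((hW s').const_mul _) ((hR s').const_mul _), trajExp_const,
      trajExp_const_mul, trajExp_const_mul, trajExp_pathSum_eq_zero hζ hζ1 hG hw,
      stateValue_eq_trajExp]
    ring
  simp only [h3, mul_add, Finset.sum_add_distrib, ← Finset.sum_mul, sum_P_eq, pathSum_single,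
    actionValue]
  rw [Finset.mul_sum]
  have h4 : ∀ s', G.P s a b s' * (w s a b * G.stateValue π₁ π₂ s') =
    w s a b * (G.P s a b s' * G.stateValue π₁ π₂ s') := fun s' => by ring
  simp only [h4]
  ring

end StochasticGame

/-! ### Occupancy measures, performance differences, and smoothness of the value -/

theorem IsSubstochastic.sum_greenKernel_mul_eq {S : Type*} [Fintype S] {K : S → S → ℝ} {ζ : ℝ}
    (hK : IsSubstochastic K ζ) (hζ : 0 < ζ) (hζ1 : ζ ≤ 1) (h : S → ℝ) (s : S) :
    ∑ r, greenKernel K s r * h r =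
      h s + ∑ s', K s s' * ∑ r, greenKernel K s' r * h r := by
  classical
  have hs := fun s s' => hK.summable_kernelPow hζ hζ1 s s'
  -- Here the first step is split off; `greenKernel_eq` splits off the last one.
  have h1 : ∀ r, greenKernel K s r = kernelPow K s 0 r + ∑ s', K s s' * greenKernel K s' r := by
    intro r
    unfold greenKernel
    rw [(hs s r).tsum_eq_zero_add]
    simp only [← tsum_mul_left]
    rw [← Summable.tsum_finsetSum fun s' _ => (hs s' r).mul_left _]
    simp only [kernelPow_succ']
  simp only [h1, add_mul, Finset.sum_add_distrib]
  congr 1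
  · simp [kernelPow]
  · simp only [Finset.sum_mul, Finset.mul_sum]
    rw [Finset.sum_comm]
    simp only [mul_assoc]

namespace StochasticGame

set_option linter.unusedSectionVars false

variable {S : Type u} {A : Type v} {B : Type w} [Fintype S] [Fintype A] [Fintype B]
variable {G : StochasticGame S A B} {π₁ π₁' : Policy S A} {π₂ π₂' : Policy S B} {ζ : ℝ}

variable (G π₁ π₂) in
/-- Expected number of visits of `s` when `s₀ ∼ ρ`. -/
noncomputable def occupancy (s : S) : ℝ :=
  ∑ s₀, G.rho s₀ * greenKernel (G.kernel π₁ π₂) s₀ s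

theorem rho_nonneg (s : S) : 0 ≤ G.rho s := G.rho.2.1 s

theorem sum_rho : ∑ s, G.rho s = 1 := G.rho.2.2

theorem occupancy_nonneg (hG : ∀ s a b, ζ ≤ G.stopProb s a b) (s : S) :
    0 ≤ G.occupancy π₁ π₂ s :=
  Finset.sum_nonneg fun s₀ _ => mul_nonneg (G.rho_nonneg s₀)
    ((G.isSubstochastic_kernel hG π₁ π₂).greenKernel_nonneg _ _)

theorem rho_le_occupancy (hζ : 0 < ζ) (hζ1 : ζ ≤ 1) (hG : ∀ s a b, ζ ≤ G.stopProb s a b) (s : S) :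
    G.rho s ≤ G.occupancy π₁ π₂ s := by
  have hK := G.isSubstochastic_kernel hG π₁ π₂
  refine le_trans ?_ (Finset.single_le_sum (fun s₀ _ => mul_nonneg (G.rho_nonneg s₀)
    (hK.greenKernel_nonneg _ _)) (Finset.mem_univ s))
  exact le_mul_of_one_le_right (G.rho_nonneg s) (hK.one_le_greenKernel_self hζ hζ1 s)

theorem sum_occupancy_le (hζ : 0 < ζ) (hζ1 : ζ ≤ 1) (hG : ∀ s a b, ζ ≤ G.stopProb s a b) :
    ∑ s, G.occupancy π₁ π₂ s ≤ 1 / ζ := by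
  have hK := G.isSubstochastic_kernel hG π₁ π₂
  unfold occupancy
  rw [Finset.sum_comm]
  simp only [← Finset.mul_sum]
  calc ∑ s₀, G.rho s₀ * ∑ s, greenKernel (G.kernel π₁ π₂) s₀ s ≤ ∑ s₀, G.rho s₀ * (1 / ζ) :=
        Finset.sum_le_sum fun s₀ _ => mul_le_mul_of_nonneg_left (hK.sum_greenKernel_le hζ hζ1 s₀)
          (G.rho_nonneg s₀)
    _ = 1 / ζ := by rw [← Finset.sum_mul, sum_rho, one_mul]

/-- The normalizing constant of the visitation distribution is an expected game length, hence at
most 1/ζ. Together with `rho_le_occupancy` this makes occupancies comparable with ρ whenever the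
mismatch is bounded. -/
theorem occupancy_le_visitDist (hζ : 0 < ζ) (hζ1 : ζ ≤ 1) (hG : ∀ s a b, ζ ≤ G.stopProb s a b)
    (s : S) : G.occupancy π₁ π₂ s ≤ 1 / ζ * G.visitDist π₁ π₂ s := by
  have hK := G.isSubstochastic_kernel hG π₁ π₂
  unfold occupancy visitDist
  rw [Finset.mul_sum]
  simp only [visits_eq]
  refine Finset.sum_le_sum fun s₀ _ => ?_
  have h1 : 0 < ∑ s', greenKernel (G.kernel π₁ π₂) s₀ s' :=
    lt_of_lt_of_le one_pos ((hK.one_le_greenKernel_self hζ hζ1 s₀).trans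
      (Finset.single_le_sum (fun s' _ => hK.greenKernel_nonneg s₀ s') (Finset.mem_univ s₀)))
  have h2 := hK.sum_greenKernel_le hζ hζ1 s₀
  have h3 := hK.greenKernel_nonneg s₀ s
  rw [mul_left_comm]
  refine mul_le_mul_of_nonneg_left ?_ (G.rho_nonneg s₀)
  rw [← mul_div_assoc, le_div_iff₀ h1, mul_comm]
  exact mul_le_mul_of_nonneg_right h2 h3

theorem sum_occupancy_mul (h : S → ℝ) : ∑ s, G.occupancy π₁ π₂ s * h s =
    ∑ s₀, G.rho s₀ * ∑ s, greenKernel (G.kernel π₁ π₂) s₀ s * h s := by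
  simp only [occupancy, Finset.sum_mul, Finset.mul_sum]
  rw [Finset.sum_comm]
  simp only [mul_assoc]

/-- The flow equation of the occupancy measure. -/
theorem sum_occupancy_mul_sub (hζ : 0 < ζ) (hζ1 : ζ ≤ 1) (hG : ∀ s a b, ζ ≤ G.stopProb s a b)
    (u : S → ℝ) : ∑ s, G.occupancy π₁ π₂ s * (u s - ∑ s', G.kernel π₁ π₂ s s' * u s') =
      ∑ s, G.rho s * u s := by
  rw [sum_occupancy_mul]
  refine Finset.sum_congr rfl fun s _ => ?_
  rw [← (G.isSubstochastic_kernel hG π₁ π₂).eq_sum_greenKernel hζ hζ1 (u := u)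
    (fun s => by ring) s]

theorem value_eq_sum_occupancy (hζ : 0 < ζ) (hζ1 : ζ ≤ 1) (hG : ∀ s a b, ζ ≤ G.stopProb s a b) :
    G.value π₁ π₂ = ∑ s, G.occupancy π₁ π₂ s * play π₁ π₂ s (G.R s) := by
  rw [sum_occupancy_mul, value]
  refine Finset.sum_congr rfl fun s _ => ?_
  rw [← (G.isSubstochastic_kernel hG π₁ π₂).eq_sum_greenKernel hζ hζ1
    (stateValue_eq_reward_add hζ hζ1 hG) s]

/-- One-step lookahead from the continuation values `u`. -/
def lookahead (G : StochasticGame S A B) (u : S → ℝ) (s : S) (a : A) (b : B) : ℝ :=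
  G.R s a b + ∑ s', G.P s a b s' * u s'

theorem actionValue_eq_lookahead :
    G.actionValue π₁ π₂ = G.lookahead (G.stateValue π₁ π₂) := rfl

/-- The performance difference lemma. -/
theorem value_sub_eq (hζ : 0 < ζ) (hζ1 : ζ ≤ 1) (hG : ∀ s a b, ζ ≤ G.stopProb s a b)
    (u : S → ℝ) : G.value π₁ π₂ - ∑ s, G.rho s * u s =
      ∑ s, G.occupancy π₁ π₂ s * (play π₁ π₂ s (G.lookahead u s) - u s) := by
  rw [value_eq_sum_occupancy hζ hζ1 hG, ← sum_occupancy_mul_sub (π₁ := π₁) (π₂ := π₂) hζ hζ1 hG u,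
    ← Finset.sum_sub_distrib]
  refine Finset.sum_congr rfl fun s _ => ?_
  rw [sum_kernel_mul]
  unfold lookahead
  rw [play_add]
  ring

theorem abs_sum_P_mul_le {u : S → ℝ} {c : ℝ} (h : ∀ s, |u s| ≤ c) (s : S) (a : A) (b : B) :
    |∑ s', G.P s a b s' * u s'| ≤ (1 - G.stopProb s a b) * c := by
  rw [abs_le]
  constructor
  · have := sum_P_mul_le (G := G) (u := fun s => -u s) (fun s => (neg_le_abs _).trans (h s)) s a b
    simp only [mul_neg, Finset.sum_neg_distrib] at this
    linarith
  · exact sum_P_mul_le (fun s => (le_abs_self _).trans (h s)) s a b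

theorem abs_lookahead_le (hζ : 0 < ζ) (hG : ∀ s a b, ζ ≤ G.stopProb s a b)
    {u : S → ℝ} (hu : ∀ s, |u s| ≤ 1 / ζ) (s : S) (a : A) (b : B) :
    |G.lookahead u s a b| ≤ 1 / ζ := by
  have h1 := abs_sum_P_mul_le (G := G) hu s a b
  have h2 : (1 - G.stopProb s a b) * (1 / ζ) ≤ (1 - ζ) * (1 / ζ) :=
    mul_le_mul_of_nonneg_right (by linarith [hG s a b]) (by positivity)
  have h3 : (1 - ζ) * (1 / ζ) = 1 / ζ - 1 := by field_simp
  exact (abs_add_le _ _).trans (by linarith [G.abs_R_le_one s a b])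

theorem abs_value_le (hζ : 0 < ζ) (hζ1 : ζ ≤ 1) (hG : ∀ s a b, ζ ≤ G.stopProb s a b) :
    |G.value π₁ π₂| ≤ 1 / ζ := by
  refine (Finset.abs_sum_le_sum_abs _ _).trans ?_
  calc ∑ s, |G.rho s * G.stateValue π₁ π₂ s| ≤ ∑ s, G.rho s * (1 / ζ) :=
        Finset.sum_le_sum fun s _ => by
          rw [abs_mul, abs_of_nonneg (G.rho_nonneg s)]
          exact mul_le_mul_of_nonneg_left (abs_stateValue_le hζ hζ1 hG s) (G.rho_nonneg s)
    _ = 1 / ζ := by rw [← Finset.sum_mul, sum_rho, one_mul]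

/-- Weighted sums against the occupancy measure. -/
theorem abs_sum_occupancy_mul_le (hζ : 0 < ζ) (hζ1 : ζ ≤ 1) (hG : ∀ s a b, ζ ≤ G.stopProb s a b)
    {h : S → ℝ} {c : ℝ} (hc0 : 0 ≤ c) (hc : ∀ s, |h s| ≤ c) :
    |∑ s, G.occupancy π₁ π₂ s * h s| ≤ c / ζ := by
  calc |∑ s, G.occupancy π₁ π₂ s * h s| ≤ ∑ s, |G.occupancy π₁ π₂ s * h s| :=
        Finset.abs_sum_le_sum_abs _ _
    _ ≤ ∑ s, G.occupancy π₁ π₂ s * c := Finset.sum_le_sum fun s _ => by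
        rw [abs_mul, abs_of_nonneg (occupancy_nonneg hG s)]
        exact mul_le_mul_of_nonneg_left (hc s) (occupancy_nonneg hG s)
    _ = (∑ s, G.occupancy π₁ π₂ s) * c := (Finset.sum_mul _ _ _).symm
    _ ≤ 1 / ζ * c := mul_le_mul_of_nonneg_right (sum_occupancy_le hζ hζ1 hG) hc0
    _ = c / ζ := by ring

/-- The joint action distributions of two pairs of policies are `d`-close in total variation. -/
def PlayClose (π₁ : Policy S A) (π₂ : Policy S B) (π₁' : Policy S A) (π₂' : Policy S B)
    (d : ℝ) : Prop :=
  ∀ (s : S) (f : A → B → ℝ) (c : ℝ), (∀ a b, |f a b| ≤ c) →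
    |play π₁' π₂' s f - play π₁ π₂ s f| ≤ d * c

theorem abs_value_sub_le (hζ : 0 < ζ) (hζ1 : ζ ≤ 1) (hG : ∀ s a b, ζ ≤ G.stopProb s a b)
    {d : ℝ} (hd0 : 0 ≤ d) (hd : PlayClose π₁ π₂ π₁' π₂' d) :
    |G.value π₁' π₂' - G.value π₁ π₂| ≤ d / ζ ^ 2 := by
  have h := value_sub_eq (π₁ := π₁') (π₂ := π₂') hζ hζ1 hG (G.stateValue π₁ π₂)
  rw [← value] at h
  rw [h]
  refine (abs_sum_occupancy_mul_le hζ hζ1 hG (c := d * (1 / ζ)) (by positivity)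
    fun s => ?_).trans (le_of_eq (by field_simp))
  rw [← play_actionValue hζ hζ1 hG s]
  exact hd s _ _ (abs_lookahead_le hζ hG (abs_stateValue_le hζ hζ1 hG) s)

/-- The first order term of the value at `(π₁, π₂)` in the direction of `(π₁', π₂')`. -/
noncomputable def valueDeriv (G : StochasticGame S A B) (π₁ : Policy S A) (π₂ : Policy S B)
    (π₁' : Policy S A) (π₂' : Policy S B) : ℝ :=
  ∑ s, G.occupancy π₁ π₂ s *
    (play π₁' π₂' s (G.actionValue π₁ π₂ s) - play π₁ π₂ s (G.actionValue π₁ π₂ s))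

/-- The value difference integrates the advantage h against the new occupancy, the first order term
against the old one. With W solving W = h + KW, the flow equation turns the error into the new
occupancy integrated against (K' - K)W, which is quadratic in d because W is itself of order d. -/
theorem abs_value_sub_sub_le (hζ : 0 < ζ) (hζ1 : ζ ≤ 1) (hG : ∀ s a b, ζ ≤ G.stopProb s a b)
    {d : ℝ} (hd0 : 0 ≤ d) (hd : PlayClose π₁ π₂ π₁' π₂' d) :
    |G.value π₁' π₂' - G.value π₁ π₂ - G.valueDeriv π₁ π₂ π₁' π₂'| ≤ d ^ 2 / ζ ^ 3 := by
  have hK := G.isSubstochastic_kernel hG π₁ π₂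
  have hv := value_sub_eq (π₁ := π₁') (π₂ := π₂') hζ hζ1 hG (G.stateValue π₁ π₂)
  rw [← value] at hv
  set h : S → ℝ := fun s =>
    play π₁' π₂' s (G.actionValue π₁ π₂ s) - play π₁ π₂ s (G.actionValue π₁ π₂ s) with hh
  have hv' : G.value π₁' π₂' - G.value π₁ π₂ = ∑ s, G.occupancy π₁' π₂' s * h s := by
    rw [hv]
    refine Finset.sum_congr rfl fun s _ => ?_
    rw [hh, ← actionValue_eq_lookahead]
    simp only [play_actionValue hζ hζ1 hG s]
  have hb : ∀ s, |h s| ≤ d * (1 / ζ) := fun s =>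
    hd s _ _ (abs_lookahead_le hζ hG (abs_stateValue_le hζ hζ1 hG) s)
  set W : S → ℝ := fun s => ∑ r, greenKernel (G.kernel π₁ π₂) s r * h r with hW
  have hWeq : ∀ s, W s = h s + ∑ s', G.kernel π₁ π₂ s s' * W s' :=
    hK.sum_greenKernel_mul_eq hζ hζ1 h
  have hWb := hK.abs_le_of_eq hζ hζ1 hWeq hb
  have h1 : ∑ s, G.occupancy π₁ π₂ s * h s = ∑ s, G.rho s * W s := sum_occupancy_mul h
  have h2 := sum_occupancy_mul_sub (π₁ := π₁') (π₂ := π₂') hζ hζ1 hG W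
  have h3 : G.value π₁' π₂' - G.value π₁ π₂ - G.valueDeriv π₁ π₂ π₁' π₂' =
      ∑ s, G.occupancy π₁' π₂' s *
        (play π₁' π₂' s (fun a b => ∑ s', G.P s a b s' * W s') -
          play π₁ π₂ s (fun a b => ∑ s', G.P s a b s' * W s')) := by
    have h4 : G.valueDeriv π₁ π₂ π₁' π₂' = ∑ s, G.occupancy π₁ π₂ s * h s := rfl
    rw [hv', h4, h1, ← h2, ← Finset.sum_sub_distrib]
    refine Finset.sum_congr rfl fun s _ => ?_
    rw [← sum_kernel_mul, ← sum_kernel_mul, hWeq s]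
    ring
  rw [h3]
  refine (abs_sum_occupancy_mul_le hζ hζ1 hG (c := d * (d * (1 / ζ) / ζ)) (by positivity)
    fun s => ?_).trans (le_of_eq (by field_simp))
  refine hd s _ _ fun a b => (abs_sum_P_mul_le hWb s a b).trans ?_
  refine mul_le_of_le_one_left (by positivity) ?_
  linarith [hG s a b]

/-- The deterministic policy `σ`. -/
noncomputable def detPolicy (σ : S → B) : Policy S B := fun s => dirac (σ s)

theorem play_detPolicy (σ : S → B) (s : S) (f : A → B → ℝ) :
    play π₁ (detPolicy σ) s f = ∑ a, π₁ s a * f a (σ s) := by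
  rw [play_eq_sum_right]
  exact sum_dirac_mul (σ s) fun b => ∑ a, π₁ s a * f a b

theorem play_le_of_forall {s : S} {f : A → B → ℝ} {c : ℝ} (h : ∀ b, ∑ a, π₁ s a * f a b ≤ c) :
    play π₁ π₂ s f ≤ c := by
  rw [play_eq_sum_right]
  calc ∑ b, π₂ s b * ∑ a, π₁ s a * f a b ≤ ∑ b, π₂ s b * c :=
        Finset.sum_le_sum fun b _ => mul_le_mul_of_nonneg_left (h b) ((π₂ s).2.1 b)
    _ = c := by
        have h2 : ∑ b, π₂ s b = 1 := (π₂ s).2.2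
        rw [← Finset.sum_mul, h2, one_mul]

theorem exists_greedy [Nonempty B] (π₁ : Policy S A) (f : S → A → B → ℝ) :
    ∃ σ : S → B, ∀ s b, ∑ a, π₁ s a * f s a b ≤ ∑ a, π₁ s a * f s a (σ s) := by
  choose σ hσ using fun s => Finite.exists_max fun b => ∑ a, π₁ s a * f s a b
  exact ⟨σ, hσ⟩

theorem stateValue_sub_eq (hζ : 0 < ζ) (hζ1 : ζ ≤ 1) (hG : ∀ s a b, ζ ≤ G.stopProb s a b)
    (u : S → ℝ) (s : S) : G.stateValue π₁ π₂ s - u s =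
      ∑ s', greenKernel (G.kernel π₁ π₂) s s' * (play π₁ π₂ s' (G.lookahead u s') - u s') := by
  refine (G.isSubstochastic_kernel hG π₁ π₂).eq_sum_greenKernel hζ hζ1
    (u := fun s => G.stateValue π₁ π₂ s - u s) (fun s => ?_) s
  simp only [mul_sub, Finset.sum_sub_distrib]
  rw [stateValue_eq_reward_add hζ hζ1 hG s]
  unfold lookahead
  rw [play_add, ← sum_kernel_mul]
  ring

/-- A deterministic optimal response to `π₁`, with the Bellman optimality equation. -/
theorem exists_bellman_optimal [Nonempty B] (hζ : 0 < ζ) (hζ1 : ζ ≤ 1)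
    (hG : ∀ s a b, ζ ≤ G.stopProb s a b) (π₁ : Policy S A) :
    ∃ σ : S → B, ∀ s b, ∑ a, π₁ s a * G.actionValue π₁ (detPolicy σ) s a b ≤
      G.stateValue π₁ (detPolicy σ) s := by
  classical
  -- Maximizing the sum over all states, not the ρ-average, gives optimality also at states that ρ
  -- does not charge.
  obtain ⟨σ, hσ⟩ := Finite.exists_max fun σ : S → B => ∑ s, G.stateValue π₁ (detPolicy σ) s
  obtain ⟨σ', hσ'⟩ := exists_greedy π₁ (G.actionValue π₁ (detPolicy σ))
  refine ⟨σ, fun s b => (hσ' s b).trans ?_⟩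
  set u := G.stateValue π₁ (detPolicy σ) with hu
  have hadv : ∀ s, 0 ≤ play π₁ (detPolicy σ') s (G.lookahead u s) - u s := fun s => by
    have h1 := play_actionValue (π₁ := π₁) (π₂ := detPolicy σ) hζ hζ1 hG s
    rw [play_detPolicy] at h1 ⊢
    have h2 := hσ' s (σ s)
    rw [actionValue_eq_lookahead] at h1 h2
    linarith
  have hK := G.isSubstochastic_kernel hG π₁ (detPolicy σ')
  -- Policy improvement: all advantages of σ' are nonnegative, so each state value rises by at least
  -- its own advantage. Maximality of σ then forces every advantage to vanish.
  have hge : ∀ s, play π₁ (detPolicy σ') s (G.lookahead u s) - u s ≤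
      G.stateValue π₁ (detPolicy σ') s - u s := fun s => by
    rw [stateValue_sub_eq hζ hζ1 hG u s]
    refine le_trans ?_ (Finset.single_le_sum (fun s' _ =>
      mul_nonneg (hK.greenKernel_nonneg s s') (hadv s')) (Finset.mem_univ s))
    exact le_mul_of_one_le_left (hadv s) (hK.one_le_greenKernel_self hζ hζ1 s)
  have hsum : ∑ s, (play π₁ (detPolicy σ') s (G.lookahead u s) - u s) ≤ 0 := by
    refine (Finset.sum_le_sum fun s _ => hge s).trans ?_
    rw [Finset.sum_sub_distrib]
    linarith [hσ σ']
  have h0 := (Finset.sum_eq_zero_iff_of_nonneg fun s _ => hadv s).1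
    (le_antisymm hsum (Finset.sum_nonneg fun s _ => hadv s)) s (Finset.mem_univ s)
  rw [play_detPolicy] at h0
  rw [actionValue_eq_lookahead]
  linarith

end StochasticGame

/-! ### Matrix games and gradient dominance -/

/-- The minimax theorem for finite matrix games. -/
theorem exists_saddle_matrix {A B : Type*} [Fintype A] [Fintype B] [Nonempty A] [Nonempty B]
    (f : A → B → ℝ) : ∃ (x : stdSimplex ℝ A) (y : stdSimplex ℝ B),
      ∀ (x' : stdSimplex ℝ A) (y' : stdSimplex ℝ B),
        ∑ a, ∑ b, x a * y' b * f a b ≤ ∑ a, ∑ b, x' a * y b * f a b := by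
  have hneA : (stdSimplex ℝ A).Nonempty := ⟨_, (Classical.arbitrary (stdSimplex ℝ A)).2⟩
  have hneB : (stdSimplex ℝ B).Nonempty := ⟨_, (Classical.arbitrary (stdSimplex ℝ B)).2⟩
  have hlinx : ∀ y : B → ℝ, IsLinearMap ℝ fun x : A → ℝ => ∑ a, ∑ b, x a * y b * f a b := fun y =>
    { map_add := fun x x' => by
        simp only [← Finset.sum_add_distrib, Pi.add_apply]
        exact Finset.sum_congr rfl fun _ _ => Finset.sum_congr rfl fun _ _ => by ring
      map_smul := fun c x => by
        simp only [smul_eq_mul, Finset.mul_sum, Pi.smul_apply]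
        exact Finset.sum_congr rfl fun _ _ => Finset.sum_congr rfl fun _ _ => by ring }
  have hliny : ∀ x : A → ℝ, IsLinearMap ℝ fun y : B → ℝ => ∑ a, ∑ b, x a * y b * f a b := fun x =>
    { map_add := fun y y' => by
        simp only [← Finset.sum_add_distrib, Pi.add_apply]
        exact Finset.sum_congr rfl fun _ _ => Finset.sum_congr rfl fun _ _ => by ring
      map_smul := fun c y => by
        simp only [smul_eq_mul, Finset.mul_sum, Pi.smul_apply]
        exact Finset.sum_congr rfl fun _ _ => Finset.sum_congr rfl fun _ _ => by ring }
  obtain ⟨x, hx, y, hy, h⟩ := Sion.exists_isSaddlePointOn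
    (f := fun (x : A → ℝ) (y : B → ℝ) => ∑ a, ∑ b, x a * y b * f a b) hneA
    (convex_stdSimplex ℝ A) (isCompact_stdSimplex ℝ A)
    (fun y _ => (Continuous.continuousOn (by fun_prop)).lowerSemicontinuousOn)
    (fun y _ => (((hlinx y).mk' _).convexOn (convex_stdSimplex ℝ A)).quasiconvexOn)
    (convex_stdSimplex ℝ B) hneB (isCompact_stdSimplex ℝ B)
    (fun x _ => (Continuous.continuousOn (by fun_prop)).upperSemicontinuousOn)
    (fun x _ => (((hliny x).mk' _).concaveOn (convex_stdSimplex ℝ B)).quasiconcaveOn)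
  exact ⟨⟨x, hx⟩, ⟨y, hy⟩, fun x' y' => h x' x'.2 y' y'.2⟩

/-- This avoids showing that the infimum over best responses in the mismatch coefficient is
attained: best responses with ratio at most c exist for every c > C, and c decreases to C. -/
theorem le_mul_of_forall_gt {C F g : ℝ} (h : ∀ c, C < c → g ≤ c * F) : g ≤ C * F := by
  refine ge_of_tendsto (x := nhdsWithin C (Set.Ioi C)) (f := fun c => c * F) ?_ ?_
  · exact tendsto_nhdsWithin_of_tendsto_nhds ((continuous_id.mul continuous_const).tendsto C)
  · exact eventually_nhdsWithin_of_forall h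

namespace StochasticGame

set_option linter.unusedSectionVars false

variable {S : Type u} {A : Type v} {B : Type w} [Fintype S] [Fintype A] [Fintype B]
variable {G : StochasticGame S A B} {π₁ : Policy S A} {π₂ : Policy S B} {ζ : ℝ}

theorem visitDist_le_of_mismatchRatio_le {c : ℝ} (hc : 0 ≤ c)
    (h : G.mismatchRatio π₁ π₂ ≤ ENNReal.ofReal c) (s : S) :
    G.visitDist π₁ π₂ s ≤ c * G.rho s := by
  have h1 : ENNReal.ofReal (G.visitDist π₁ π₂ s) / ENNReal.ofReal (G.rho s) ≤ ENNReal.ofReal c :=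
    (le_iSup (fun s => ENNReal.ofReal (G.visitDist π₁ π₂ s) / ENNReal.ofReal (G.rho s)) s).trans h
  have h2 : ENNReal.ofReal (G.visitDist π₁ π₂ s) ≤ ENNReal.ofReal (c * G.rho s) := by
    rw [ENNReal.ofReal_mul hc]
    refine (ENNReal.div_le_iff_le_mul ?_ (Or.inl ENNReal.ofReal_ne_top)).1 h1
    right; exact ENNReal.ofReal_ne_top
  exact (ENNReal.ofReal_le_ofReal_iff (mul_nonneg hc (G.rho_nonneg s))).1 h2

theorem exists_minBestResponse {C c : ℝ} (hC : G.mismatch ≠ ⊤) (hCe : C = G.mismatch.toReal)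
    (hc : C < c) (π₂ : Policy S B) :
    ∃ π₁ ∈ G.minBestResponses π₂, ∀ s, G.visitDist π₁ π₂ s ≤ c * G.rho s := by
  have hc0 : 0 ≤ c := (ENNReal.toReal_nonneg.trans hCe.ge).trans hc.le
  have h1 : (⨅ π₁ ∈ G.minBestResponses π₂, G.mismatchRatio π₁ π₂) < ENNReal.ofReal c := by
    refine lt_of_le_of_lt ?_ ((ENNReal.lt_ofReal_iff_toReal_lt hC).2 (hCe ▸ hc))
    exact (le_iSup (fun π₂ : Policy S B => ⨅ π₁ ∈ G.minBestResponses π₂,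
      G.mismatchRatio π₁ π₂) π₂).trans (le_max_left _ _)
  obtain ⟨π₁, h⟩ := iInf_lt_iff.1 h1
  obtain ⟨hm, h⟩ := iInf_lt_iff.1 h
  exact ⟨π₁, hm, visitDist_le_of_mismatchRatio_le hc0 h.le⟩

theorem exists_maxBestResponse {C c : ℝ} (hC : G.mismatch ≠ ⊤) (hCe : C = G.mismatch.toReal)
    (hc : C < c) (π₁ : Policy S A) :
    ∃ π₂ ∈ G.maxBestResponses π₁, ∀ s, G.visitDist π₁ π₂ s ≤ c * G.rho s := by
  have hc0 : 0 ≤ c := (ENNReal.toReal_nonneg.trans hCe.ge).trans hc.le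
  have h1 : (⨅ π₂ ∈ G.maxBestResponses π₁, G.mismatchRatio π₁ π₂) < ENNReal.ofReal c := by
    refine lt_of_le_of_lt ?_ ((ENNReal.lt_ofReal_iff_toReal_lt hC).2 (hCe ▸ hc))
    exact (le_iSup (fun π₁ : Policy S A => ⨅ π₂ ∈ G.maxBestResponses π₁,
      G.mismatchRatio π₁ π₂) π₁).trans (le_max_right _ _)
  obtain ⟨π₂, h⟩ := iInf_lt_iff.1 h1
  obtain ⟨hm, h⟩ := iInf_lt_iff.1 h
  exact ⟨π₂, hm, visitDist_le_of_mismatchRatio_le hc0 h.le⟩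

theorem sum_visitDist (hζ : 0 < ζ) (hζ1 : ζ ≤ 1) (hG : ∀ s a b, ζ ≤ G.stopProb s a b) :
    ∑ s, G.visitDist π₁ π₂ s = 1 := by
  have hK := G.isSubstochastic_kernel hG π₁ π₂
  unfold visitDist
  rw [Finset.sum_comm, ← G.sum_rho]
  refine Finset.sum_congr rfl fun s₀ _ => ?_
  rw [← Finset.mul_sum, ← Finset.sum_div, div_self, mul_one]
  simp only [visits_eq]
  exact (lt_of_lt_of_le one_pos ((hK.one_le_greenKernel_self hζ hζ1 s₀).trans
      (Finset.single_le_sum (fun s' _ => hK.greenKernel_nonneg s₀ s') (Finset.mem_univ s₀)))).ne'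

theorem one_le_mismatch [Nonempty B] (hζ : 0 < ζ) (hζ1 : ζ ≤ 1)
    (hG : ∀ s a b, ζ ≤ G.stopProb s a b) {C : ℝ} (hC : G.mismatch ≠ ⊤)
    (hCe : C = G.mismatch.toReal) : 1 ≤ C := by
  refine le_of_forall_gt_imp_ge_of_dense fun c hc => ?_
  obtain ⟨π₁, -, h⟩ := exists_minBestResponse hC hCe hc
    (fun _ => Classical.arbitrary (stdSimplex ℝ B) : Policy S B)
  rw [← G.sum_visitDist (π₁ := π₁) (π₂ := fun _ => Classical.arbitrary (stdSimplex ℝ B)) hζ hζ1 hG]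
  refine (Finset.sum_le_sum fun s _ => h s).trans ?_
  rw [← Finset.mul_sum, G.sum_rho, mul_one]

theorem sum_occupancy_mul_le_of_visitDist_le (hζ : 0 < ζ) (hζ1 : ζ ≤ 1)
    (hG : ∀ s a b, ζ ≤ G.stopProb s a b) {c : ℝ}
    (h : ∀ s, G.visitDist π₁ π₂ s ≤ c * G.rho s) {f : S → ℝ} (hf : ∀ s, 0 ≤ f s) :
    ∑ s, G.occupancy π₁ π₂ s * f s ≤ c / ζ * ∑ s, G.rho s * f s := by
  rw [Finset.mul_sum]
  refine Finset.sum_le_sum fun s _ => ?_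
  rw [← mul_assoc]
  refine mul_le_mul_of_nonneg_right ?_ (hf s)
  calc G.occupancy π₁ π₂ s ≤ 1 / ζ * G.visitDist π₁ π₂ s := occupancy_le_visitDist hζ hζ1 hG s
    _ ≤ 1 / ζ * (c * G.rho s) := by gcongr; exact h s
    _ = c / ζ * G.rho s := by ring

theorem sum_rho_mul_le_sum_occupancy_mul (hζ : 0 < ζ) (hζ1 : ζ ≤ 1)
    (hG : ∀ s a b, ζ ≤ G.stopProb s a b) {f : S → ℝ} (hf : ∀ s, 0 ≤ f s) :
    ∑ s, G.rho s * f s ≤ ∑ s, G.occupancy π₁ π₂ s * f s :=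
  Finset.sum_le_sum fun s _ => mul_le_mul_of_nonneg_right (rho_le_occupancy hζ hζ1 hG s) (hf s)

/-- The best response value `max_{π₂} V_ρ(π₁, π₂)`. -/
noncomputable def maxValue (G : StochasticGame S A B) (π₁ : Policy S A) : ℝ :=
  ⨆ π₂ : Policy S B, G.value π₁ π₂

theorem bddAbove_value (hζ : 0 < ζ) (hζ1 : ζ ≤ 1) (hG : ∀ s a b, ζ ≤ G.stopProb s a b)
    (π₁ : Policy S A) : BddAbove (Set.range fun π₂ : Policy S B => G.value π₁ π₂) :=
  ⟨1 / ζ, by rintro _ ⟨π₂, rfl⟩; exact (abs_le.1 (abs_value_le hζ hζ1 hG)).2⟩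

theorem value_le_maxValue (hζ : 0 < ζ) (hζ1 : ζ ≤ 1) (hG : ∀ s a b, ζ ≤ G.stopProb s a b)
    (π₁ : Policy S A) (π₂ : Policy S B) : G.value π₁ π₂ ≤ G.maxValue π₁ :=
  le_ciSup (bddAbove_value hζ hζ1 hG π₁) π₂

theorem maxValue_le [Nonempty B] {c : ℝ} (h : ∀ π₂ : Policy S B, G.value π₁ π₂ ≤ c) :
    G.maxValue π₁ ≤ c := by
  have : Nonempty (Policy S B) := ⟨fun _ => Classical.arbitrary (stdSimplex ℝ B)⟩
  exact ciSup_le h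

theorem abs_maxValue_le [Nonempty B] (hζ : 0 < ζ) (hζ1 : ζ ≤ 1)
    (hG : ∀ s a b, ζ ≤ G.stopProb s a b) : |G.maxValue π₁| ≤ 1 / ζ := by
  rw [abs_le]
  exact ⟨(abs_le.1 (abs_value_le hζ hζ1 hG)).1.trans (value_le_maxValue hζ hζ1 hG π₁
    fun _ => Classical.arbitrary (stdSimplex ℝ B)),
    maxValue_le fun π₂ => (abs_le.1 (abs_value_le hζ hζ1 hG)).2⟩

theorem abs_sum_mul_le_of_mem_stdSimplex {ι : Type*} [Fintype ι] (p : stdSimplex ℝ ι) {f : ι → ℝ}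
    {c : ℝ} (h : ∀ i, |f i| ≤ c) : |∑ i, p i * f i| ≤ c := by
  have hp : ∑ i, p i = 1 := p.2.2
  calc |∑ i, p i * f i| ≤ ∑ i, |p i * f i| := Finset.abs_sum_le_sum_abs _ _
    _ ≤ ∑ i, p i * c := Finset.sum_le_sum fun i _ => by
        rw [abs_mul, abs_of_nonneg (show 0 ≤ p i from p.2.1 i)]
        exact mul_le_mul_of_nonneg_left (h i) (p.2.1 i)
    _ = c := by rw [← Finset.sum_mul, hp, one_mul]

theorem abs_sum_unif_mul_le {ι : Type*} [Fintype ι] [Nonempty ι] {f : ι → ℝ}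
    {c : ℝ} (h : ∀ i, |f i| ≤ c) : |∑ i, 1 / (Fintype.card ι : ℝ) * f i| ≤ c := by
  have hc : (0 : ℝ) < Fintype.card ι := Nat.cast_pos.2 Fintype.card_pos
  exact abs_sum_mul_le_of_mem_stdSimplex ⟨fun _ => 1 / (Fintype.card ι : ℝ), fun _ => by positivity,
    by simp⟩ h

/-- Moving the max-player's policy towards an `ε`-greedy improvement. -/
theorem exists_ascent_policy [Nonempty B] (hζ : 0 < ζ) (hζ1 : ζ ≤ 1)
    (hG : ∀ s a b, ζ ≤ G.stopProb s a b) {C : ℝ} (hC : G.mismatch ≠ ⊤)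
    (hCe : C = G.mismatch.toReal) (π₁ : Policy S A) (π₂ : Policy S B) :
    ∃ π' : Policy S B, ∀ t ε : ℝ, 0 ≤ t → t ≤ 1 → 0 ≤ ε → ε ≤ 1 → ∀ πt : Policy S B,
      (∀ s b, πt s b = (1 - t) * π₂ s b + t * ((1 - ε) * π' s b + ε / Fintype.card B)) →
      G.value π₁ π₂ + t * (ζ / C * (G.maxValue π₁ - G.value π₁ π₂) - 2 * ε / ζ ^ 2) ≤
        G.value π₁ πt := by
  have hC1 := one_le_mismatch hζ hζ1 hG hC hCe
  obtain ⟨σ, hσ⟩ := exists_greedy π₁ (G.actionValue π₁ π₂)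
  refine ⟨detPolicy σ, fun t ε ht0 ht1 hε0 hε1 πt hπt => ?_⟩
  set u := G.stateValue π₁ π₂ with hu
  set q : S → B → ℝ := fun s b => ∑ a, π₁ s a * G.lookahead u s a b with hq
  have hσ : ∀ s b, q s b ≤ q s (σ s) := hσ
  have hqb : ∀ s b, |q s b| ≤ 1 / ζ := fun s b => abs_sum_mul_le_of_mem_stdSimplex (π₁ s)
    fun a => abs_lookahead_le hζ hG (abs_stateValue_le hζ hζ1 hG) s a b
  have hplay : ∀ (π : Policy S B) s, play π₁ π s (G.lookahead u s) = ∑ b, π s b * q s b :=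
    fun π s => play_eq_sum_right π₁ π s _
  have hu' : ∀ s, ∑ b, π₂ s b * q s b = u s := fun s => by
    rw [← hplay, ← actionValue_eq_lookahead, play_actionValue hζ hζ1 hG]
  set f : S → ℝ := fun s => q s (σ s) - u s with hf
  have hf0 : ∀ s, 0 ≤ f s := fun s => by
    have : play π₁ π₂ s (G.lookahead u s) ≤ q s (σ s) := play_le_of_forall (hσ s)
    rw [hplay, hu'] at this
    exact sub_nonneg.2 this
  have hval : ∑ s, G.rho s * u s = G.value π₁ π₂ := rfl
  -- The advantage of any policy is at most the greedy advantage f. Apply the performance difference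
  -- to a best response with small mismatch, and replace its occupancy by ρ.
  have hgap : G.maxValue π₁ - G.value π₁ π₂ ≤ C / ζ * ∑ s, G.rho s * f s := by
    have key : ∀ c, C < c → G.maxValue π₁ - G.value π₁ π₂ ≤ c * ((∑ s, G.rho s * f s) / ζ) := by
      intro c hc
      obtain ⟨πo, hm, hv⟩ := exists_maxBestResponse hC hCe hc π₁
      have h1 : G.maxValue π₁ ≤ G.value π₁ πo := maxValue_le hm
      have h2 := value_sub_eq (π₁ := π₁) (π₂ := πo) hζ hζ1 hG u
      rw [hval] at h2
      have h3 : G.value π₁ πo - G.value π₁ π₂ ≤ ∑ s, G.occupancy π₁ πo s * f s := by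
        rw [h2]
        refine Finset.sum_le_sum fun s _ => mul_le_mul_of_nonneg_left ?_ (occupancy_nonneg hG s)
        exact sub_le_sub_right (play_le_of_forall (hσ s)) _
      have h4 := sum_occupancy_mul_le_of_visitDist_le hζ hζ1 hG hv hf0
      calc _ ≤ _ := by linarith
        _ ≤ c / ζ * ∑ s, G.rho s * f s := h4
        _ = _ := by ring
    calc _ ≤ _ := le_mul_of_forall_gt key
      _ = _ := by ring
  have hgap' : ζ / C * (G.maxValue π₁ - G.value π₁ π₂) ≤ ∑ s, G.rho s * f s := by
    calc _ ≤ ζ / C * (C / ζ * ∑ s, G.rho s * f s) := by gcongr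
      _ = _ := by field_simp
  have h1 := value_sub_eq (π₁ := π₁) (π₂ := πt) hζ hζ1 hG u
  rw [hval] at h1
  have h2 : ∀ s, t * (f s - 2 * ε / ζ) ≤ play π₁ πt s (G.lookahead u s) - u s := fun s => by
    have hun := abs_sum_unif_mul_le (hqb s)
    have h3 : play π₁ πt s (G.lookahead u s) =
        (1 - t) * u s + t * ((1 - ε) * q s (σ s) + ε * ∑ b, 1 / (Fintype.card B : ℝ) * q s b) := by
      rw [hplay, ← hu' s, ← sum_dirac_mul (σ s) (q s)]
      simp only [hπt, Finset.mul_sum, ← Finset.sum_add_distrib]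
      refine Finset.sum_congr rfl fun b _ => ?_
      simp only [detPolicy]
      ring
    rw [h3]
    have h4 : q s (σ s) - 2 * ε / ζ ≤
        (1 - ε) * q s (σ s) + ε * ∑ b, 1 / (Fintype.card B : ℝ) * q s b := by
      have h5 := mul_le_mul_of_nonneg_left (abs_le.1 (hqb s (σ s))).2 hε0
      have h6 := mul_le_mul_of_nonneg_left (abs_le.1 hun).1 hε0
      have h7 : 2 * ε / ζ = ε * (1 / ζ) + ε * (1 / ζ) := by ring
      rw [h7]
      linarith
    have h8 := mul_le_mul_of_nonneg_left h4 ht0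
    simp only [hf]
    linarith
  have h3 : ∑ s, G.occupancy π₁ πt s * (t * (f s - 2 * ε / ζ)) ≤ G.value π₁ πt - G.value π₁ π₂ := by
    rw [h1]
    exact Finset.sum_le_sum fun s _ => mul_le_mul_of_nonneg_left (h2 s) (occupancy_nonneg hG s)
  have h4 : ∑ s, G.occupancy π₁ πt s * (t * (f s - 2 * ε / ζ)) =
      t * (∑ s, G.occupancy π₁ πt s * f s - (∑ s, G.occupancy π₁ πt s) * (2 * ε / ζ)) := by
    rw [Finset.sum_mul, ← Finset.sum_sub_distrib, Finset.mul_sum]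
    exact Finset.sum_congr rfl fun s _ => by ring
  -- The performance difference is exact with the occupancy of the moved policy, and that occupancy
  -- dominates ρ. Hence the gain is linear in t with no second order loss.
  have h5 := sum_rho_mul_le_sum_occupancy_mul (π₁ := π₁) (π₂ := πt) hζ hζ1 hG hf0
  have h6 : (∑ s, G.occupancy π₁ πt s) * (2 * ε / ζ) ≤ 1 / ζ * (2 * ε / ζ) :=
    mul_le_mul_of_nonneg_right (sum_occupancy_le hζ hζ1 hG) (by positivity)
  have h7 : 1 / ζ * (2 * ε / ζ) = 2 * ε / ζ ^ 2 := by field_simp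
  have h8 := mul_le_mul_of_nonneg_left (show ζ / C * (G.maxValue π₁ - G.value π₁ π₂) -
    2 * ε / ζ ^ 2 ≤ ∑ s, G.occupancy π₁ πt s * f s - (∑ s, G.occupancy π₁ πt s) * (2 * ε / ζ) by
      linarith) ht0
  linarith

/-- Moving the min-player's policy towards a solution of the auxiliary matrix games decreases the
best response value. -/
theorem exists_descent_policy [Nonempty A] [Nonempty B] (hζ : 0 < ζ) (hζ1 : ζ ≤ 1)
    (hG : ∀ s a b, ζ ≤ G.stopProb s a b) {C : ℝ} (hC : G.mismatch ≠ ⊤)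
    (hCe : C = G.mismatch.toReal) (π₁ : Policy S A) :
    ∃ π' : Policy S A, ∀ t ε : ℝ, 0 ≤ t → t ≤ 1 → 0 ≤ ε → ε ≤ 1 → ∀ πt : Policy S A,
      (∀ s a, πt s a = (1 - t) * π₁ s a + t * ((1 - ε) * π' s a + ε / Fintype.card A)) →
      G.maxValue πt ≤ G.maxValue π₁ -
        t * (ζ / C * (G.maxValue π₁ - ⨅ π : Policy S A, G.maxValue π) - 2 * ε / ζ ^ 2) := by
  have hC1 := one_le_mismatch hζ hζ1 hG hC hCe
  obtain ⟨σ, hσ⟩ := exists_bellman_optimal hζ hζ1 hG π₁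
  set u := G.stateValue π₁ (detPolicy σ) with hu
  rw [actionValue_eq_lookahead, ← hu] at hσ
  -- The continuation values u are frozen at the optimal response to π₁. The strategies x serve as
  -- the descent direction, and y only certifies the gap bound.
  choose x y hxy using fun s => exists_saddle_matrix (G.lookahead u s)
  have hxy' : ∀ (π₁ : Policy S A) (π₂ : Policy S B) s,
      play x π₂ s (G.lookahead u s) ≤ play π₁ y s (G.lookahead u s) :=
    fun π₁ π₂ s => hxy s (π₁ s) (π₂ s)
  refine ⟨x, fun t ε ht0 ht1 hε0 hε1 πt hπt => ?_⟩
  set m : S → ℝ := fun s => play x y s (G.lookahead u s) with hm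
  have hlb : ∀ s a b, |G.lookahead u s a b| ≤ 1 / ζ :=
    abs_lookahead_le hζ hG (abs_stateValue_le hζ hζ1 hG)
  have hmb : ∀ s, |m s| ≤ 1 / ζ := fun s => abs_play_le x y s (hlb s)
  set f : S → ℝ := fun s => u s - m s with hf
  have hf0 : ∀ s, 0 ≤ f s := fun s =>
    sub_nonneg.2 ((hxy' π₁ y s).trans (play_le_of_forall (hσ s)))
  have hval : ∑ s, G.rho s * u s = G.value π₁ (detPolicy σ) := rfl
  have hmax : G.maxValue π₁ = ∑ s, G.rho s * u s := by
    refine le_antisymm (maxValue_le fun π₂ => ?_) (value_le_maxValue hζ hζ1 hG π₁ (detPolicy σ))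
    have h1 := value_sub_eq (π₁ := π₁) (π₂ := π₂) hζ hζ1 hG u
    have h2 : ∑ s, G.occupancy π₁ π₂ s * (play π₁ π₂ s (G.lookahead u s) - u s) ≤ 0 :=
      Finset.sum_nonpos fun s _ => mul_nonpos_of_nonneg_of_nonpos (occupancy_nonneg hG s)
        (sub_nonpos.2 (play_le_of_forall (hσ s)))
    linarith
  have hinf : ∀ c, (∀ π, c ≤ G.maxValue π) → c ≤ ⨅ π : Policy S A, G.maxValue π := fun c hc => by
    have : Nonempty (Policy S A) := ⟨x⟩
    exact le_ciInf hc
  -- A best response πo to y has V(πo, y) at most the minimax value. Against y every policy gets at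
  -- least the matrix value m, so the value falls below ρ·u by at most f = u - m integrated against
  -- the occupancy of (πo, y).
  have hgap : G.maxValue π₁ - (⨅ π : Policy S A, G.maxValue π) ≤ C / ζ * ∑ s, G.rho s * f s := by
    have key : ∀ c, C < c → G.maxValue π₁ - (⨅ π : Policy S A, G.maxValue π) ≤
        c * ((∑ s, G.rho s * f s) / ζ) := by
      intro c hc
      obtain ⟨πo, hm', hv⟩ := exists_minBestResponse hC hCe hc y
      have h1 : G.value πo y ≤ ⨅ π : Policy S A, G.maxValue π :=
        hinf _ fun π => (hm' π).trans (value_le_maxValue hζ hζ1 hG π y)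
      have h2 := value_sub_eq (π₁ := πo) (π₂ := y) hζ hζ1 hG u
      have h3 : ∑ s, G.rho s * u s - G.value πo y ≤ ∑ s, G.occupancy πo y s * f s := by
        rw [← neg_sub, h2, ← Finset.sum_neg_distrib]
        refine Finset.sum_le_sum fun s _ => ?_
        rw [← mul_neg]
        refine mul_le_mul_of_nonneg_left ?_ (occupancy_nonneg hG s)
        have := hxy' πo y s
        simp only [hf, hm]
        linarith
      have h4 := sum_occupancy_mul_le_of_visitDist_le hζ hζ1 hG hv hf0
      calc _ ≤ _ := by linarith
        _ ≤ c / ζ * ∑ s, G.rho s * f s := h4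
        _ = _ := by ring
    calc _ ≤ _ := le_mul_of_forall_gt key
      _ = _ := by ring
  have hgap' : ζ / C * (G.maxValue π₁ - (⨅ π : Policy S A, G.maxValue π)) ≤
      ∑ s, G.rho s * f s := by
    calc _ ≤ ζ / C * (C / ζ * ∑ s, G.rho s * f s) := by gcongr
      _ = _ := by field_simp
  -- The direction x does not depend on π₂, so one estimate against an arbitrary opponent bounds the
  -- maximum.
  refine maxValue_le fun π₂ => ?_
  have h1 := value_sub_eq (π₁ := πt) (π₂ := π₂) hζ hζ1 hG u
  rw [← hmax] at h1
  have h2 : ∀ s, play πt π₂ s (G.lookahead u s) - u s ≤ -(t * (f s - 2 * ε / ζ)) := fun s => by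
    set q : A → ℝ := fun a => ∑ b, π₂ s b * G.lookahead u s a b with hq
    have hqb : ∀ a, |q a| ≤ 1 / ζ := fun a => abs_sum_mul_le_of_mem_stdSimplex (π₂ s)
      fun b => hlb s a b
    have hun := abs_sum_unif_mul_le hqb
    have h3 : play πt π₂ s (G.lookahead u s) = (1 - t) * play π₁ π₂ s (G.lookahead u s) +
        t * ((1 - ε) * play x π₂ s (G.lookahead u s) +
          ε * ∑ a, 1 / (Fintype.card A : ℝ) * q a) := by
      have hp : ∀ π : Policy S A, play π π₂ s (G.lookahead u s) = ∑ a, π s a * q a :=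
        fun π => play_eq_sum_left π π₂ s _
      simp only [hp, hπt, Finset.mul_sum, ← Finset.sum_add_distrib]
      exact Finset.sum_congr rfl fun a _ => by ring
    have h4 : play π₁ π₂ s (G.lookahead u s) ≤ u s := play_le_of_forall (hσ s)
    have h5 : play x π₂ s (G.lookahead u s) ≤ m s := hxy' x π₂ s
    have h6 := mul_le_mul_of_nonneg_left (abs_le.1 (hmb s)).1 hε0
    have h7 := mul_le_mul_of_nonneg_left (abs_le.1 hun).2 hε0
    have h8 : 2 * ε / ζ = ε * (1 / ζ) + ε * (1 / ζ) := by ring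
    have h9 := mul_le_mul_of_nonneg_left h4 (sub_nonneg.2 ht1)
    have h10 := mul_le_mul_of_nonneg_left h5 (sub_nonneg.2 hε1)
    have h11 := mul_le_mul_of_nonneg_left (show (1 - ε) * play x π₂ s (G.lookahead u s) +
          ε * ∑ a, 1 / (Fintype.card A : ℝ) * q a ≤ m s + 2 * ε / ζ by rw [h8]; linarith) ht0
    rw [h3]
    simp only [hf]
    linarith
  have h3 : G.value πt π₂ - G.maxValue π₁ ≤
      ∑ s, G.occupancy πt π₂ s * -(t * (f s - 2 * ε / ζ)) := by
    rw [h1]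
    exact Finset.sum_le_sum fun s _ => mul_le_mul_of_nonneg_left (h2 s) (occupancy_nonneg hG s)
  have h4 : ∑ s, G.occupancy πt π₂ s * -(t * (f s - 2 * ε / ζ)) =
      -(t * (∑ s, G.occupancy πt π₂ s * f s - (∑ s, G.occupancy πt π₂ s) * (2 * ε / ζ))) := by
    rw [Finset.sum_mul, ← Finset.sum_sub_distrib, Finset.mul_sum, ← Finset.sum_neg_distrib]
    exact Finset.sum_congr rfl fun s _ => by ring
  have h5 := sum_rho_mul_le_sum_occupancy_mul (π₁ := πt) (π₂ := π₂) hζ hζ1 hG hf0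
  have h6 : (∑ s, G.occupancy πt π₂ s) * (2 * ε / ζ) ≤ 1 / ζ * (2 * ε / ζ) :=
    mul_le_mul_of_nonneg_right (sum_occupancy_le hζ hζ1 hG) (by positivity)
  have h7 : 1 / ζ * (2 * ε / ζ) = 2 * ε / ζ ^ 2 := by field_simp
  have h8 := mul_le_mul_of_nonneg_left (show ζ / C * (G.maxValue π₁ -
    (⨅ π : Policy S A, G.maxValue π)) - 2 * ε / ζ ^ 2 ≤
      ∑ s, G.occupancy πt π₂ s * f s - (∑ s, G.occupancy πt π₂ s) * (2 * ε / ζ) by linarith) ht0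
  linarith

end StochasticGame

/-! ### Geometry of the parameter set and the score function -/

section Param

variable {S : Type u} {A : Type v} [Fintype S] [Fintype A]

theorem convex_paramSet : Convex ℝ (paramSet S A) := by
  intro x hx y hy a b ha hb hab s
  exact convex_stdSimplex ℝ A (hx s) (hy s) ha hb hab

theorem norm_sub_sq_le_of_mem_paramSet {x x' : EuclideanSpace ℝ (S × A)} (hx : x ∈ paramSet S A)
    (hx' : x' ∈ paramSet S A) : ‖x - x'‖ ^ 2 ≤ 2 * Fintype.card S := by
  rw [EuclideanSpace.norm_sq_eq, Fintype.sum_prod_type]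
  have h : ∀ {x : EuclideanSpace ℝ (S × A)}, x ∈ paramSet S A → ∀ s a, x (s, a) ≤ 1 :=
    fun {x} hx s a => (Finset.single_le_sum (fun a _ => (hx s).1 a) (Finset.mem_univ a)).trans
      (hx s).2.le
  calc ∑ s, ∑ a, ‖(x - x') (s, a)‖ ^ 2 ≤ ∑ s, ∑ a, (x (s, a) + x' (s, a)) :=
        Finset.sum_le_sum fun s _ => Finset.sum_le_sum fun a _ => by
          have h1 := h hx s a
          have h2 := h hx' s a
          have h3 : 0 ≤ x (s, a) := (hx s).1 a
          have h4 : 0 ≤ x' (s, a) := (hx' s).1 a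
          rw [Real.norm_eq_abs, sq_abs]
          simp only [PiLp.sub_apply]
          nlinarith [mul_nonneg h3 h4, mul_nonneg h3 (sub_nonneg.2 h1),
            mul_nonneg h4 (sub_nonneg.2 h2)]
    _ = ∑ s : S, 2 := Finset.sum_congr rfl fun s _ => by
        have h1 : ∑ a, x (s, a) = 1 := (hx s).2
        have h2 : ∑ a, x' (s, a) = 1 := (hx' s).2
        rw [Finset.sum_add_distrib, h1, h2]
        norm_num
    _ = 2 * Fintype.card S := by simp [mul_comm]

theorem norm_sub_le_of_mem_paramSet {x x' : EuclideanSpace ℝ (S × A)} (hx : x ∈ paramSet S A)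
    (hx' : x' ∈ paramSet S A) : ‖x - x'‖ ≤ 3 / 2 * √(Fintype.card S) := by
  refine abs_le_of_sq_le_sq' ?_ (by positivity) |>.2
  rw [mul_pow, Real.sq_sqrt (Nat.cast_nonneg _)]
  have h := norm_sub_sq_le_of_mem_paramSet hx hx'
  have : (0 : ℝ) ≤ Fintype.card S := Nat.cast_nonneg _
  linarith

theorem isCompact_paramSet [Nonempty A] : IsCompact (paramSet S A) := by
  obtain ⟨x, hx⟩ := paramSet_nonempty S A
  refine Metric.isCompact_of_isClosed_isBounded (isClosed_paramSet S A)
    ((Metric.isBounded_iff_subset_closedBall x).2 ⟨3 / 2 * √(Fintype.card S), fun y hy => ?_⟩)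
  rw [mem_closedBall_iff_norm]
  exact norm_sub_le_of_mem_paramSet hy hx

/-- The variational inequality of the projection makes the angle at the projected point at least a
right angle, so projecting brings no point of the set further away. -/
theorem norm_projParam_sub_le [Nonempty A] (z : EuclideanSpace ℝ (S × A))
    {y : EuclideanSpace ℝ (S × A)} (hy : y ∈ paramSet S A) :
    ‖(projParam z : EuclideanSpace ℝ (S × A)) - y‖ ≤ ‖z - y‖ := by
  set p : EuclideanSpace ℝ (S × A) := (projParam z : EuclideanSpace ℝ (S × A)) with hp
  have hpm : p ∈ paramSet S A := (projParam z).2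
  have hd : Metric.infDist z (paramSet S A) = dist z p :=
    ((isClosed_paramSet S A).exists_infDist_eq_dist (paramSet_nonempty S A) z).choose_spec.2
  have hinf : ‖z - p‖ = ⨅ w : paramSet S A, ‖z - w‖ := by
    rw [← dist_eq_norm, ← hd, Metric.infDist_eq_iInf]
    simp only [dist_eq_norm]
  have hin := (norm_eq_iInf_iff_real_inner_le_zero convex_paramSet hpm).1 hinf y hy
  have h1 : ‖z - y‖ ^ 2 = ‖z - p‖ ^ 2 - 2 * inner ℝ (z - p) (y - p) + ‖y - p‖ ^ 2 := by
    rw [← norm_sub_sq_real]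
    congr 2
    abel
  rw [norm_sub_rev p y]
  refine abs_le_of_sq_le_sq' ?_ (norm_nonneg _) |>.2
  nlinarith [sq_nonneg ‖z - p‖]

theorem norm_greedyProb_sub_le (ε : unitInterval) (x x' : EuclideanSpace ℝ (S × A)) (s : S) :
    ∑ a, |greedyProb ε x' s a - greedyProb ε x s a| ≤ √(Fintype.card A) * ‖x' - x‖ := by
  have h1 : ∀ a, |greedyProb ε x' s a - greedyProb ε x s a| ≤ |(x' - x) (s, a)| := fun a => by
    have : greedyProb ε x' s a - greedyProb ε x s a = (1 - (ε : ℝ)) * (x' - x) (s, a) := by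
      simp only [greedyProb, PiLp.sub_apply]
      ring
    rw [this, abs_mul, abs_of_nonneg (sub_nonneg.2 ε.2.2)]
    exact mul_le_of_le_one_left (abs_nonneg _) (by linarith [ε.2.1])
  refine (Finset.sum_le_sum fun a _ => h1 a).trans ?_
  refine abs_le_of_sq_le_sq' ?_ (by positivity) |>.2
  rw [mul_pow, Real.sq_sqrt (Nat.cast_nonneg _), EuclideanSpace.norm_sq_eq, Fintype.sum_prod_type]
  refine sq_sum_le_card_mul_sum_sq.trans ?_
  rw [Finset.card_univ]
  refine mul_le_mul_of_nonneg_left ?_ (Nat.cast_nonneg _)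
  refine le_trans (le_of_eq ?_) (Finset.single_le_sum
    (fun s _ => Finset.sum_nonneg fun a _ => sq_nonneg _) (Finset.mem_univ s))
  simp only [Real.norm_eq_abs]

theorem hasGradientAt_log_greedyProb [DecidableEq (S × A)] (ε : unitInterval)
    (x : EuclideanSpace ℝ (S × A)) {s : S} {a : A} (h : greedyProb ε x s a ≠ 0) :
    HasGradientAt (fun x' : EuclideanSpace ℝ (S × A) => Real.log (greedyProb ε x' s a))
      (((1 - (ε : ℝ)) / greedyProb ε x s a) • EuclideanSpace.single (s, a) (1 : ℝ)) x := by
  rw [hasGradientAt_iff_hasFDerivAt]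
  have h1 : HasFDerivAt (fun x' : EuclideanSpace ℝ (S × A) => greedyProb ε x' s a)
      ((1 - (ε : ℝ)) • (EuclideanSpace.proj (s, a) : EuclideanSpace ℝ (S × A) →L[ℝ] ℝ)) x := by
    have := ((EuclideanSpace.proj (s, a) : EuclideanSpace ℝ (S × A) →L[ℝ] ℝ).hasFDerivAt
      (x := x)).const_smul (1 - (ε : ℝ))
    exact this.add_const _
  convert! h1.log h using 1
  ext d
  simp [EuclideanSpace.inner_single_left]
  ring

theorem greedyProb_pos {ε : unitInterval} (hε : 0 < (ε : ℝ)) [Nonempty A] (x : paramSet S A)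
    (s : S) (a : A) :
    (ε : ℝ) / Fintype.card A ≤ greedyProb ε (x : EuclideanSpace ℝ (S × A)) s a ∧
      0 < greedyProb ε (x : EuclideanSpace ℝ (S × A)) s a := by
  have h1 : (ε : ℝ) / Fintype.card A ≤ greedyProb ε (x : EuclideanSpace ℝ (S × A)) s a :=
    le_add_of_nonneg_left (mul_nonneg (sub_nonneg.2 ε.2.2) ((x.2 s).1 a))
  have hc : (0 : ℝ) < Fintype.card A := Nat.cast_pos.2 Fintype.card_pos
  exact ⟨h1, (div_pos hε hc).trans_le h1⟩

theorem inner_reinforce {ε : unitInterval} (hε : 0 < (ε : ℝ)) [Nonempty A] (x : paramSet S A)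
    (r : ℝ) {n : ℕ} (z : Fin n → S × A) (d : EuclideanSpace ℝ (S × A)) :
    inner ℝ (reinforce ε (x : EuclideanSpace ℝ (S × A)) r z) d =
      r * ∑ t, (1 - (ε : ℝ)) * d (z t) /
        greedyProb ε (x : EuclideanSpace ℝ (S × A)) (z t).1 (z t).2 := by
  classical
  rw [reinforce, real_inner_smul_left, sum_inner]
  congr 1
  refine Finset.sum_congr rfl fun t _ => ?_
  rw [(hasGradientAt_log_greedyProb ε _ (greedyProb_pos hε x _ _).2.ne').gradient,
    real_inner_smul_left, EuclideanSpace.inner_single_left]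
  simp
  ring

theorem norm_reinforce_le {ε : unitInterval} (hε : 0 < (ε : ℝ)) [Nonempty A] (x : paramSet S A)
    (r : ℝ) {n : ℕ} (z : Fin n → S × A) :
    ‖reinforce ε (x : EuclideanSpace ℝ (S × A)) r z‖ ≤
      |r| * ∑ t, 1 / greedyProb ε (x : EuclideanSpace ℝ (S × A)) (z t).1 (z t).2 := by
  classical
  rw [reinforce, norm_smul, Real.norm_eq_abs]
  refine mul_le_mul_of_nonneg_left ((norm_sum_le _ _).trans (Finset.sum_le_sum fun t _ => ?_))
    (abs_nonneg r)
  have hp := (greedyProb_pos hε x (z t).1 (z t).2).2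
  rw [(hasGradientAt_log_greedyProb ε _ hp.ne').gradient, norm_smul, PiLp.norm_single,
    Real.norm_eq_abs, abs_of_nonneg (div_nonneg (sub_nonneg.2 ε.2.2) hp.le)]
  simp only [norm_one, mul_one]
  gcongr
  linarith

end Param

/-! ### Mean and second moment of the gradient estimates -/

namespace StochasticGame

set_option linter.unusedSectionVars false

variable {S : Type u} {A : Type v} {B : Type w} [Fintype S] [Fintype A] [Fintype B]
  [Nonempty A] [Nonempty B]
variable {G : StochasticGame S A B} {ζ : ℝ}

theorem playClose_left {π₁ π₁' : Policy S A} (π₂ : Policy S B) {d : ℝ}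
    (h : ∀ s, ∑ a, |π₁' s a - π₁ s a| ≤ d) : PlayClose π₁ π₂ π₁' π₂ d := by
  intro s f c hc
  obtain ⟨a₀⟩ := ‹Nonempty A›
  obtain ⟨b₀⟩ := ‹Nonempty B›
  have hc0 : 0 ≤ c := (abs_nonneg _).trans (hc a₀ b₀)
  rw [play_eq_sum_left, play_eq_sum_left, ← Finset.sum_sub_distrib]
  simp only [← sub_mul]
  refine (Finset.abs_sum_le_sum_abs _ _).trans ?_
  refine le_trans (Finset.sum_le_sum fun a _ => ?_)
    ((Finset.sum_mul _ _ c).symm.le.trans (mul_le_mul_of_nonneg_right (h s) hc0))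
  rw [abs_mul]
  exact mul_le_mul_of_nonneg_left (abs_sum_mul_le_of_mem_stdSimplex (π₂ s) fun b => hc a b)
    (abs_nonneg _)

theorem playClose_right (π₁ : Policy S A) {π₂ π₂' : Policy S B} {d : ℝ}
    (h : ∀ s, ∑ b, |π₂' s b - π₂ s b| ≤ d) : PlayClose π₁ π₂ π₁ π₂' d := by
  intro s f c hc
  obtain ⟨a₀⟩ := ‹Nonempty A›
  obtain ⟨b₀⟩ := ‹Nonempty B›
  have hc0 : 0 ≤ c := (abs_nonneg _).trans (hc a₀ b₀)
  rw [play_eq_sum_right, play_eq_sum_right, ← Finset.sum_sub_distrib]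
  simp only [← sub_mul]
  refine (Finset.abs_sum_le_sum_abs _ _).trans ?_
  refine le_trans (Finset.sum_le_sum fun b _ => ?_)
    ((Finset.sum_mul _ _ c).symm.le.trans (mul_le_mul_of_nonneg_right (h s) hc0))
  rw [abs_mul]
  exact mul_le_mul_of_nonneg_left (abs_sum_mul_le_of_mem_stdSimplex (π₁ s) fun a => hc a b)
    (abs_nonneg _)

/-- One factor of π cancels, and each of the |A| remaining terms 1/π is at most |A|/ε because of the
uniform exploration. -/
theorem sum_mul_inv_sq_greedyPolicy_le {ε : unitInterval} (hε : 0 < (ε : ℝ)) (x : paramSet S A)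
    (s : S) : ∑ a, greedyPolicy ε x s a * (1 / greedyProb ε (x : EuclideanSpace ℝ (S × A)) s a) ^ 2 ≤
      (Fintype.card A : ℝ) ^ 2 / ε := by
  have hc : (0 : ℝ) < Fintype.card A := Nat.cast_pos.2 Fintype.card_pos
  calc _ ≤ ∑ a : A, (Fintype.card A : ℝ) / ε := Finset.sum_le_sum fun a _ => by
        obtain ⟨h1, h2⟩ := greedyProb_pos hε x s a
        change greedyProb ε (x : EuclideanSpace ℝ (S × A)) s a * _ ≤ _
        have : greedyProb ε (x : EuclideanSpace ℝ (S × A)) s a *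
            (1 / greedyProb ε (x : EuclideanSpace ℝ (S × A)) s a) ^ 2 =
            1 / greedyProb ε (x : EuclideanSpace ℝ (S × A)) s a := by field_simp
        rw [this, ← one_div_div (ε : ℝ)]
        exact one_div_le_one_div_of_le (by positivity) h1
    _ = _ := by
        simp only [Finset.sum_const, Finset.card_univ, nsmul_eq_mul]
        ring

/-- The parameterization is affine, so weighting by the score in the direction x' - x yields the
exact difference of the two policies, not merely a linearization. -/
theorem sum_greedyPolicy_mul_div {ε : unitInterval} (hε : 0 < (ε : ℝ)) (x x' : paramSet S A)
    (s : S) (f : A → ℝ) :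
    ∑ a, greedyPolicy ε x s a * ((1 - (ε : ℝ)) *
      ((x' : EuclideanSpace ℝ (S × A)) - (x : EuclideanSpace ℝ (S × A))) (s, a) /
        greedyProb ε (x : EuclideanSpace ℝ (S × A)) s a * f a) =
      ∑ a, greedyPolicy ε x' s a * f a - ∑ a, greedyPolicy ε x s a * f a := by
  rw [← Finset.sum_sub_distrib]
  refine Finset.sum_congr rfl fun a _ => ?_
  have h2 := (greedyProb_pos hε x s a).2.ne'
  change greedyProb ε (x : EuclideanSpace ℝ (S × A)) s a * _ =
    greedyProb ε (x' : EuclideanSpace ℝ (S × A)) s a * f a -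
      greedyProb ε (x : EuclideanSpace ℝ (S × A)) s a * f a
  rw [← mul_assoc, mul_div_cancel₀ _ h2]
  simp only [greedyProb, PiLp.sub_apply]
  ring

/-- The min-player's gradient estimate. -/
noncomputable def gradMin (G : StochasticGame S A B) (ε : unitInterval) (x : paramSet S A)
    (τ : Traj S A B) : EuclideanSpace ℝ (S × A) :=
  reinforce ε x (G.totalReward τ) fun t => ((τ.2 t).1, (τ.2 t).2.1)

/-- The max-player's gradient estimate. -/
noncomputable def gradMax (G : StochasticGame S A B) (ε : unitInterval) (y : paramSet S B)
    (τ : Traj S A B) : EuclideanSpace ℝ (S × B) :=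
  reinforce ε y (G.totalReward τ) fun t => ((τ.2 t).1, (τ.2 t).2.2)

/-- The policy gradient theorem in a form that serves both players: the hypothesis on w, tested with
f = 1, also shows that w is centered. -/
theorem hasSum_inner_of_eq_pathSum (hζ : 0 < ζ) (hζ1 : ζ ≤ 1)
    (hG : ∀ s a b, ζ ≤ G.stopProb s a b) {π₁ π₁' : Policy S A} {π₂ π₂' : Policy S B}
    {w : S → A → B → ℝ}
    (hw : ∀ s f, play π₁ π₂ s (fun a b => w s a b * f a b) = play π₁' π₂' s f - play π₁ π₂ s f) :
    HasSum (fun τ => G.trajProb G.rho π₁ π₂ τ * (G.totalReward τ * pathSum w τ))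
      (G.valueDeriv π₁ π₂ π₁' π₂') := by
  have hw0 : ∀ s, play π₁ π₂ s (w s) = 0 := fun s => by
    have := hw s fun _ _ => 1
    simpa [play_const] using this
  have h := hasSum_trajLaw (G := G) (π₁ := π₁) (π₂ := π₂) G.rho
    (fun s => trajIntegrable_totalReward_mul_pathSum hζ hζ1 hG w s)
  convert! h using 1
  unfold valueDeriv
  rw [sum_occupancy_mul]
  refine Finset.sum_congr rfl fun s _ => ?_
  have h1 := trajExp_totalReward_mul_pathSum (π₁ := π₁) (π₂ := π₂) hζ hζ1 hG hw0 s
  have h2 : ∀ s', play π₁ π₂ s' (fun a b => w s' a b * G.actionValue π₁ π₂ s' a b) = _ :=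
    fun s' => hw s' (G.actionValue π₁ π₂ s')
  simp only [h2] at h1
  rw [← h1]
  rfl

theorem hasSum_inner_gradMin (hζ : 0 < ζ) (hζ1 : ζ ≤ 1) (hG : ∀ s a b, ζ ≤ G.stopProb s a b)
    {ε : unitInterval} (hε : 0 < (ε : ℝ)) (x x' : paramSet S A) (π₂ : Policy S B) :
    HasSum (fun τ => G.trajProb G.rho (greedyPolicy ε x) π₂ τ * inner ℝ (G.gradMin ε x τ)
      ((x' : EuclideanSpace ℝ (S × A)) - (x : EuclideanSpace ℝ (S × A))))
      (G.valueDeriv (greedyPolicy ε x) π₂ (greedyPolicy ε x') π₂) := by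
  have h := hasSum_inner_of_eq_pathSum hζ hζ1 hG (π₁ := greedyPolicy ε x)
    (π₁' := greedyPolicy ε x') (π₂ := π₂) (π₂' := π₂) (w := fun s a _ => (1 - (ε : ℝ)) *
      ((x' : EuclideanSpace ℝ (S × A)) - (x : EuclideanSpace ℝ (S × A))) (s, a) /
        greedyProb ε (x : EuclideanSpace ℝ (S × A)) s a) fun s f => by
      simp only [play_eq_sum_left, mul_left_comm (π₂ s _), ← Finset.mul_sum]
      exact sum_greedyPolicy_mul_div hε x x' s _
  convert! h using 3 with τ
  exact inner_reinforce hε x _ _ _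

theorem hasSum_inner_gradMax (hζ : 0 < ζ) (hζ1 : ζ ≤ 1) (hG : ∀ s a b, ζ ≤ G.stopProb s a b)
    {ε : unitInterval} (hε : 0 < (ε : ℝ)) (π₁ : Policy S A) (y y' : paramSet S B) :
    HasSum (fun τ => G.trajProb G.rho π₁ (greedyPolicy ε y) τ * inner ℝ (G.gradMax ε y τ)
      ((y' : EuclideanSpace ℝ (S × B)) - (y : EuclideanSpace ℝ (S × B))))
      (G.valueDeriv π₁ (greedyPolicy ε y) π₁ (greedyPolicy ε y')) := by
  have h := hasSum_inner_of_eq_pathSum hζ hζ1 hG (π₁ := π₁)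
    (π₁' := π₁) (π₂ := greedyPolicy ε y) (π₂' := greedyPolicy ε y')
    (w := fun s _ b => (1 - (ε : ℝ)) *
      ((y' : EuclideanSpace ℝ (S × B)) - (y : EuclideanSpace ℝ (S × B))) (s, b) /
        greedyProb ε (y : EuclideanSpace ℝ (S × B)) s b) fun s f => by
      simp only [play_eq_sum_right, mul_left_comm (π₁ s _), ← Finset.mul_sum]
      exact sum_greedyPolicy_mul_div hε y y' s _
  convert! h using 3 with τ
  exact inner_reinforce hε y _ _ _

theorem hasSum_sq_of_le (hζ : 0 < ζ) (hζ1 : ζ ≤ 1) (hG : ∀ s a b, ζ ≤ G.stopProb s a b)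
    {π₁ : Policy S A} {π₂ : Policy S B} {c : S → A → B → ℝ} {d : ℝ}
    (hd : ∀ s, play π₁ π₂ s (fun a b => c s a b ^ 2) ≤ d) (hd0 : 0 ≤ d) {F : Traj S A B → ℝ}
    (hF0 : ∀ τ, 0 ≤ F τ) (hF : ∀ τ, F τ ≤ (G.totalReward τ * pathSum c τ) ^ 2) :
    ∃ v ≤ 6561 * d / ζ ^ 4, HasSum (fun τ => G.trajProb G.rho π₁ π₂ τ * F τ) v := by
  have h := fun s => trajExp_sq_totalReward_mul_le hζ hζ1 hG hd hd0 hF0 hF s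
  refine ⟨_, ?_, hasSum_trajLaw G.rho fun s => (h s).1⟩
  calc ∑ s, G.rho s * G.trajExp π₁ π₂ s F ≤ ∑ s, G.rho s * (6561 * d / ζ ^ 4) :=
        Finset.sum_le_sum fun s _ => mul_le_mul_of_nonneg_left (h s).2 (G.rho_nonneg s)
    _ = _ := by rw [← Finset.sum_mul, sum_rho, one_mul]

theorem hasSum_sq_gradMin (hζ : 0 < ζ) (hζ1 : ζ ≤ 1) (hG : ∀ s a b, ζ ≤ G.stopProb s a b)
    {ε : unitInterval} (hε : 0 < (ε : ℝ)) (x : paramSet S A) (π₂ : Policy S B) :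
    ∃ v ≤ 6561 * ((Fintype.card A : ℝ) ^ 2 / ε) / ζ ^ 4,
      HasSum (fun τ => G.trajProb G.rho (greedyPolicy ε x) π₂ τ * ‖G.gradMin ε x τ‖ ^ 2) v := by
  refine hasSum_sq_of_le hζ hζ1 hG
    (c := fun s a _ => 1 / greedyProb ε (x : EuclideanSpace ℝ (S × A)) s a) (fun s => ?_)
    (by positivity) (fun τ => sq_nonneg _) fun τ => ?_
  · have h2 : ∑ b, π₂ s b = 1 := (π₂ s).2.2
    simp only [play_eq_sum_left, ← Finset.sum_mul, h2, one_mul]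
    exact sum_mul_inv_sq_greedyPolicy_le hε x s
  · rw [← sq_abs (G.totalReward τ * _), abs_mul]
    gcongr
    exact (norm_reinforce_le hε x _ _).trans
      (mul_le_mul_of_nonneg_left (le_abs_self _) (abs_nonneg _))

theorem hasSum_sq_gradMax (hζ : 0 < ζ) (hζ1 : ζ ≤ 1) (hG : ∀ s a b, ζ ≤ G.stopProb s a b)
    {ε : unitInterval} (hε : 0 < (ε : ℝ)) (π₁ : Policy S A) (y : paramSet S B) :
    ∃ v ≤ 6561 * ((Fintype.card B : ℝ) ^ 2 / ε) / ζ ^ 4,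
      HasSum (fun τ => G.trajProb G.rho π₁ (greedyPolicy ε y) τ * ‖G.gradMax ε y τ‖ ^ 2) v := by
  refine hasSum_sq_of_le hζ hζ1 hG
    (c := fun s _ b => 1 / greedyProb ε (y : EuclideanSpace ℝ (S × B)) s b) (fun s => ?_)
    (by positivity) (fun τ => sq_nonneg _) fun τ => ?_
  · have h2 : ∑ a, π₁ s a = 1 := (π₁ s).2.2
    simp only [play_eq_sum_right, ← Finset.sum_mul, h2, one_mul]
    exact sum_mul_inv_sq_greedyPolicy_le hε y s
  · rw [← sq_abs (G.totalReward τ * _), abs_mul]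
    gcongr
    exact (norm_reinforce_le hε y _ _).trans
      (mul_le_mul_of_nonneg_left (le_abs_self _) (abs_nonneg _))

end StochasticGame

/-! ### Moreau envelopes on the parameter set -/

section Moreau

set_option linter.unusedSectionVars false

variable {S : Type u} {A : Type v} [Fintype S] [Fintype A] [Nonempty A]

/-- The Moreau envelope of a function on `Δ(A)^S`. -/
noncomputable def moreau (h : paramSet S A → ℝ) (l : ℝ) (x : paramSet S A) : ℝ :=
  ⨅ z : paramSet S A, h z + l * ‖(z : EuclideanSpace ℝ (S × A)) - x‖ ^ 2

/-- `z` is a proximal point of `x`. -/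
structure IsProx (h : paramSet S A → ℝ) (l : ℝ) (x z : paramSet S A) : Prop where
  moreau_eq : moreau h l x = h z + l * ‖(z : EuclideanSpace ℝ (S × A)) - x‖ ^ 2
  moreau_le : ∀ x' z', moreau h l x' ≤ h z' + l * ‖(z' : EuclideanSpace ℝ (S × A)) - x'‖ ^ 2

/-- Compactness and continuity suffice; convexity is not needed since proximal points need not be
unique. Existence of minimizers also bounds the infima from below, so that the real-valued infimum
defining the envelope is meaningful at every point. -/
theorem exists_isProx {h : paramSet S A → ℝ} {L : ℝ}
    (hL : ∀ x x', |h x' - h x| ≤ L * ‖(x' : EuclideanSpace ℝ (S × A)) - x‖) (l : ℝ)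
    (x : paramSet S A) : ∃ z, IsProx h l x z := by
  have : CompactSpace (paramSet S A) := isCompact_iff_compactSpace.1 isCompact_paramSet
  have : Nonempty (paramSet S A) := (paramSet_nonempty S A).to_subtype
  have hcont : Continuous h := by
    refine (LipschitzWith.of_dist_le_mul (K := ⟨|L|, abs_nonneg L⟩) fun x x' => ?_).continuous
    rw [Real.dist_eq, abs_sub_comm]
    refine (hL x x').trans ?_
    rw [Subtype.dist_eq, dist_eq_norm, norm_sub_rev]
    exact mul_le_mul_of_nonneg_right (le_abs_self L) (norm_nonneg _)
  have hF : ∀ x : paramSet S A, Continuous fun z : paramSet S A =>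
      h z + l * ‖(z : EuclideanSpace ℝ (S × A)) - x‖ ^ 2 := fun x => by fun_prop
  have hmin : ∀ x : paramSet S A, ∃ z : paramSet S A, ∀ z', h z + l *
      ‖(z : EuclideanSpace ℝ (S × A)) - x‖ ^ 2 ≤ h z' + l *
      ‖(z' : EuclideanSpace ℝ (S × A)) - x‖ ^ 2 := fun x => by
    obtain ⟨z, -, hz⟩ := isCompact_univ.exists_isMinOn Set.univ_nonempty (hF x).continuousOn
    exact ⟨z, fun z' => hz (Set.mem_univ z')⟩
  have hle : ∀ x' z', moreau h l x' ≤
      h z' + l * ‖(z' : EuclideanSpace ℝ (S × A)) - x'‖ ^ 2 := fun x' z' => by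
    obtain ⟨w, hw⟩ := hmin x'
    exact ciInf_le ⟨_, by rintro _ ⟨w', rfl⟩; exact hw w'⟩ z'
  obtain ⟨z, hz⟩ := hmin x
  exact ⟨z, le_antisymm (hle x z) (le_ciInf hz), hle⟩

theorem IsProx.le {h : paramSet S A → ℝ} {l : ℝ} {x z : paramSet S A} (hz : IsProx h l x z) :
    h z + l * ‖(z : EuclideanSpace ℝ (S × A)) - x‖ ^ 2 ≤ h x := by
  have := hz.moreau_le x x
  rw [hz.moreau_eq] at this
  simpa using this

/-- The segment from `x` to `z` in `Δ(A)^S`. -/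
def segParam (x z : paramSet S A) (t : ℝ) (ht0 : 0 ≤ t) (ht1 : t ≤ 1) : paramSet S A :=
  ⟨(1 - t) • (x : EuclideanSpace ℝ (S × A)) + t • (z : EuclideanSpace ℝ (S × A)),
    convex_paramSet x.2 z.2 (by linarith) ht0 (by ring)⟩

/-- At a minimizer z of h + l‖· - x‖², any linear decrease of h along a segment must be paid by the
derivative of the quadratic term, at most 2l‖z - x‖ times the diameter bound (3/2)√S. Smoothness of
h is not used, which matters because Φ is a maximum. -/
theorem IsProx.le_of_descent {h : paramSet S A → ℝ} {l : ℝ} (hl : 0 ≤ l) {x z : paramSet S A}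
    (hz : IsProx h l x z) {g : ℝ} (x' : paramSet S A)
    (hd : ∀ t (ht0 : 0 ≤ t) (ht1 : t ≤ 1), h (segParam z x' t ht0 ht1) ≤ h z - t * g) :
    g ≤ 3 * l * √(Fintype.card S) * ‖(z : EuclideanSpace ℝ (S × A)) - x‖ := by
  set a : EuclideanSpace ℝ (S × A) := (z : EuclideanSpace ℝ (S × A)) - x with ha
  set d : EuclideanSpace ℝ (S × A) := (x' : EuclideanSpace ℝ (S × A)) - z with hd'
  have key : ∀ t, 0 < t → t ≤ 1 → g ≤ 2 * l * inner ℝ a d + t * (l * ‖d‖ ^ 2) := by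
    intro t ht0 ht1
    have h1 := hz.moreau_le x (segParam z x' t ht0.le ht1)
    rw [hz.moreau_eq] at h1
    have h2 := hd t ht0.le ht1
    have h3 : ((segParam z x' t ht0.le ht1 : paramSet S A) : EuclideanSpace ℝ (S × A)) - x =
        a + t • d := by
      simp only [segParam, ha, hd', smul_sub, sub_smul, one_smul]
      abel
    rw [h3, norm_add_sq_real, inner_smul_right, norm_smul, mul_pow, Real.norm_eq_abs, sq_abs] at h1
    have h4 : t * g ≤ t * (2 * l * inner ℝ a d + t * (l * ‖d‖ ^ 2)) := by linarith
    exact le_of_mul_le_mul_left h4 ht0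
  have hlim : g ≤ 2 * l * inner ℝ a d := by
    refine ge_of_tendsto (x := nhdsWithin (0 : ℝ) (Set.Ioi 0))
      (f := fun t => 2 * l * inner ℝ a d + t * (l * ‖d‖ ^ 2)) ?_ ?_
    · have : Continuous fun t : ℝ => 2 * l * inner ℝ a d + t * (l * ‖d‖ ^ 2) := by fun_prop
      simpa using tendsto_nhdsWithin_of_tendsto_nhds (this.tendsto 0)
    · filter_upwards [Ioc_mem_nhdsGT (zero_lt_one' ℝ)] with t ht
      exact key t ht.1 ht.2
  have h5 := real_inner_le_norm a d
  have h6 : ‖d‖ ≤ 3 / 2 * √(Fintype.card S) := norm_sub_le_of_mem_paramSet x'.2 z.2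
  calc g ≤ 2 * l * inner ℝ a d := hlim
    _ ≤ 2 * l * (‖a‖ * (3 / 2 * √(Fintype.card S))) := by gcongr; exact h5.trans (by gcongr)
    _ = _ := by ring

/-- One projected gradient step on the Moreau envelope. -/
theorem IsProx.moreau_projParam_le {h : paramSet S A → ℝ} {l : ℝ} (hl : 0 ≤ l)
    {x z : paramSet S A} (hz : IsProx h l x z) (η : ℝ) (g : EuclideanSpace ℝ (S × A)) :
    moreau h l (projParam ((x : EuclideanSpace ℝ (S × A)) - η • g)) ≤
      moreau h l x + 2 * l * η * inner ℝ g ((z : EuclideanSpace ℝ (S × A)) - x) +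
        l * η ^ 2 * ‖g‖ ^ 2 := by
  set a : EuclideanSpace ℝ (S × A) := (z : EuclideanSpace ℝ (S × A)) - x with ha
  -- The old proximal point serves as competitor in the envelope at the new point; projecting does
  -- not increase the distance to it.
  have h1 := hz.moreau_le (projParam ((x : EuclideanSpace ℝ (S × A)) - η • g)) z
  have h2 := norm_projParam_sub_le ((x : EuclideanSpace ℝ (S × A)) - η • g) z.2
  rw [norm_sub_rev] at h2
  have h3 : (x : EuclideanSpace ℝ (S × A)) - η • g - z = -(a + η • g) := by
    simp only [ha]
    abel
  rw [h3, norm_neg] at h2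
  have h4 : ‖a + η • g‖ ^ 2 = ‖a‖ ^ 2 + 2 * η * inner ℝ g a + η ^ 2 * ‖g‖ ^ 2 := by
    rw [norm_add_sq_real, inner_smul_right, norm_smul, mul_pow, Real.norm_eq_abs, sq_abs,
      real_inner_comm]
    ring
  rw [hz.moreau_eq]
  have h5 := mul_le_mul_of_nonneg_left (pow_le_pow_left₀ (norm_nonneg _) h2 2) hl
  rw [h4] at h5
  linarith

theorem norm_projParam_step_le (x : paramSet S A) {η : ℝ} (hη : 0 ≤ η)
    (g : EuclideanSpace ℝ (S × A)) :
    ‖(projParam ((x : EuclideanSpace ℝ (S × A)) - η • g) : EuclideanSpace ℝ (S × A)) - x‖ ≤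
      η * ‖g‖ := by
  refine (norm_projParam_sub_le _ x.2).trans (le_of_eq ?_)
  rw [sub_sub_cancel_left, norm_neg, norm_smul, Real.norm_eq_abs, abs_of_nonneg hη]

theorem abs_moreau_le {h : paramSet S A → ℝ} {l c : ℝ} (hl : 0 ≤ l) {x z : paramSet S A}
    (hz : IsProx h l x z) (hc : ∀ x, |h x| ≤ c) : |moreau h l x| ≤ c := by
  rw [abs_le]
  constructor
  · rw [hz.moreau_eq]
    have := (abs_le.1 (hc z)).1
    have : 0 ≤ l * ‖(z : EuclideanSpace ℝ (S × A)) - x‖ ^ 2 := by positivity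
    linarith
  · rw [hz.moreau_eq]
    exact hz.le.trans (abs_le.1 (hc x)).2

theorem moreau_le_moreau_add {h h' : paramSet S A → ℝ} {l c : ℝ} {x z w : paramSet S A}
    (hz : IsProx h l x z) (hw : IsProx h' l x w) (hc : ∀ z, h' z ≤ h z + c) :
    moreau h' l x ≤ moreau h l x + c := by
  rw [hz.moreau_eq]
  linarith [hw.moreau_le x z, hc z]

end Moreau

/-! ### Optimality gaps in terms of distances to proximal points -/

namespace StochasticGame

set_option linter.unusedSectionVars false

variable {S : Type u} {A : Type v} {B : Type w} [Fintype S] [Fintype A] [Fintype B]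
  [Nonempty A] [Nonempty B]
variable {G : StochasticGame S A B} {ζ M : ℝ}

theorem abs_value_greedy_left_sub_le (hζ : 0 < ζ) (hζ1 : ζ ≤ 1)
    (hG : ∀ s a b, ζ ≤ G.stopProb s a b) (hA : (Fintype.card A : ℝ) ≤ M) (ε : unitInterval)
    (x x' : paramSet S A) (π₂ : Policy S B) :
    |G.value (greedyPolicy ε x') π₂ - G.value (greedyPolicy ε x) π₂| ≤
      √M / ζ ^ 2 * ‖(x' : EuclideanSpace ℝ (S × A)) - x‖ := by
  refine (abs_value_sub_le hζ hζ1 hG (by positivity)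
    (playClose_left π₂ (norm_greedyProb_sub_le ε (x : EuclideanSpace ℝ (S × A)) x'))).trans ?_
  rw [mul_div_right_comm]
  gcongr

theorem abs_value_greedy_right_sub_le (hζ : 0 < ζ) (hζ1 : ζ ≤ 1)
    (hG : ∀ s a b, ζ ≤ G.stopProb s a b) (hB : (Fintype.card B : ℝ) ≤ M) (ε : unitInterval)
    (π₁ : Policy S A) (y y' : paramSet S B) :
    |G.value π₁ (greedyPolicy ε y') - G.value π₁ (greedyPolicy ε y)| ≤
      √M / ζ ^ 2 * ‖(y' : EuclideanSpace ℝ (S × B)) - y‖ := by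
  refine (abs_value_sub_le hζ hζ1 hG (by positivity)
    (playClose_right π₁ (norm_greedyProb_sub_le ε (y : EuclideanSpace ℝ (S × B)) y'))).trans ?_
  rw [mul_div_right_comm]
  gcongr

theorem abs_value_greedy_left_sub_sub_le (hζ : 0 < ζ) (hζ1 : ζ ≤ 1)
    (hG : ∀ s a b, ζ ≤ G.stopProb s a b) (hA : (Fintype.card A : ℝ) ≤ M) (ε : unitInterval)
    (x x' : paramSet S A) (π₂ : Policy S B) :
    |G.value (greedyPolicy ε x') π₂ - G.value (greedyPolicy ε x) π₂ -
      G.valueDeriv (greedyPolicy ε x) π₂ (greedyPolicy ε x') π₂| ≤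
      M / ζ ^ 3 * ‖(x' : EuclideanSpace ℝ (S × A)) - x‖ ^ 2 := by
  refine (abs_value_sub_sub_le hζ hζ1 hG (by positivity)
    (playClose_left π₂ (norm_greedyProb_sub_le ε (x : EuclideanSpace ℝ (S × A)) x'))).trans ?_
  rw [mul_pow, Real.sq_sqrt (Nat.cast_nonneg _), mul_div_right_comm]
  gcongr

theorem abs_value_greedy_right_sub_sub_le (hζ : 0 < ζ) (hζ1 : ζ ≤ 1)
    (hG : ∀ s a b, ζ ≤ G.stopProb s a b) (hB : (Fintype.card B : ℝ) ≤ M) (ε : unitInterval)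
    (π₁ : Policy S A) (y y' : paramSet S B) :
    |G.value π₁ (greedyPolicy ε y') - G.value π₁ (greedyPolicy ε y) -
      G.valueDeriv π₁ (greedyPolicy ε y) π₁ (greedyPolicy ε y')| ≤
      M / ζ ^ 3 * ‖(y' : EuclideanSpace ℝ (S × B)) - y‖ ^ 2 := by
  refine (abs_value_sub_sub_le hζ hζ1 hG (by positivity)
    (playClose_right π₁ (norm_greedyProb_sub_le ε (y : EuclideanSpace ℝ (S × B)) y'))).trans ?_
  rw [mul_pow, Real.sq_sqrt (Nat.cast_nonneg _), mul_div_right_comm]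
  gcongr

theorem abs_maxValue_greedy_sub_le (hζ : 0 < ζ) (hζ1 : ζ ≤ 1)
    (hG : ∀ s a b, ζ ≤ G.stopProb s a b) (hA : (Fintype.card A : ℝ) ≤ M) (ε : unitInterval)
    (x x' : paramSet S A) :
    |G.maxValue (greedyPolicy ε x') - G.maxValue (greedyPolicy ε x)| ≤
      √M / ζ ^ 2 * ‖(x' : EuclideanSpace ℝ (S × A)) - x‖ := by
  have key : ∀ x x' : paramSet S A, G.maxValue (greedyPolicy ε x') ≤
      G.maxValue (greedyPolicy ε x) +
        √M / ζ ^ 2 * ‖(x' : EuclideanSpace ℝ (S × A)) - x‖ := fun x x' =>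
    maxValue_le fun π₂ => by
      have h1 := (abs_le.1 (abs_value_greedy_left_sub_le hζ hζ1 hG hA ε x x' π₂)).2
      have h2 := value_le_maxValue hζ hζ1 hG (greedyPolicy ε x) π₂
      linarith
  rw [abs_le]
  constructor
  · have := key x' x
    rw [norm_sub_rev] at this
    linarith
  · linarith [key x x']

/-- A policy as a parameter. -/
def paramOf (π : Policy S A) : paramSet S A :=
  ⟨WithLp.toLp 2 fun q => π q.1 q.2, fun s => (π s).2⟩

theorem greedyPolicy_segParam (ε : unitInterval) (x : paramSet S A) (π : Policy S A) {t : ℝ}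
    (ht0 : 0 ≤ t) (ht1 : t ≤ 1) (s : S) (a : A) :
    greedyPolicy ε (segParam x (paramOf π) t ht0 ht1) s a =
      (1 - t) * greedyPolicy ε x s a + t * ((1 - (ε : ℝ)) * π s a + (ε : ℝ) / Fintype.card A) := by
  change greedyProb ε ((1 - t) • (x : EuclideanSpace ℝ (S × A)) +
    t • (paramOf π : EuclideanSpace ℝ (S × A))) s a =
      (1 - t) * greedyProb ε (x : EuclideanSpace ℝ (S × A)) s a + _
  simp only [greedyProb, PiLp.add_apply, PiLp.smul_apply, smul_eq_mul, paramOf]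
  ring

theorem one_le_sqrt_card_state (G : StochasticGame S A B) : (1 : ℝ) ≤ √(Fintype.card S) := by
  rw [Real.one_le_sqrt, Nat.one_le_cast]
  have : Nonempty S := by
    by_contra h
    rw [not_nonempty_iff] at h
    have := G.sum_rho
    simp at this
  exact Fintype.card_pos

/-- Absorbs the cost of moving from the proximal point back to the original point, which turns the
constant 3 of `IsProx.le_of_descent` into 4. -/
theorem lipschitz_const_le (hζ : 0 < ζ) (hζ1 : ζ ≤ 1) (hM : 1 ≤ M) {l r C : ℝ}
    (hl : l = 2 * M / ζ ^ 3) (hr : 1 ≤ r) (hC : 1 ≤ C) : √M / ζ ^ 2 ≤ l * r * C / ζ := by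
  have h5 : √M ≤ M := Real.sqrt_le_iff.2 ⟨by linarith, by nlinarith⟩
  have h6 : 1 ≤ r * C / ζ := (one_le_div hζ).2 (hζ1.trans (one_le_mul_of_one_le_of_one_le hr hC))
  have hl0 : 0 ≤ l := by rw [hl]; positivity
  calc √M / ζ ^ 2 ≤ (2 * M) / ζ ^ 3 := by
        refine div_le_div₀ (by positivity) (by linarith) (by positivity) ?_
        exact pow_le_pow_of_le_one hζ.le hζ1 (by norm_num)
    _ = l := hl.symm
    _ ≤ l * (r * C / ζ) := le_mul_of_one_le_right hl0 h6
    _ = _ := by ring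

/-- The gap to the minimax value at a point with a given proximal point. -/
theorem maxValue_sub_le_of_isProx (hζ : 0 < ζ) (hζ1 : ζ ≤ 1) (hG : ∀ s a b, ζ ≤ G.stopProb s a b)
    {C : ℝ} (hC : G.mismatch ≠ ⊤) (hCe : C = G.mismatch.toReal)
    (hA : (Fintype.card A : ℝ) ≤ M) (ε : unitInterval) {l : ℝ} (hl : l = 2 * M / ζ ^ 3)
    {x z : paramSet S A} (hz : IsProx (fun x => G.maxValue (greedyPolicy ε x)) l x z) :
    G.maxValue (greedyPolicy ε x) - ⨅ π : Policy S A, G.maxValue π ≤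
      4 * l * √(Fintype.card S) * C / ζ * ‖(z : EuclideanSpace ℝ (S × A)) - x‖ +
        2 * C * ε / ζ ^ 3 := by
  have hC1 := one_le_mismatch hζ hζ1 hG hC hCe
  have hA1 : (1 : ℝ) ≤ Fintype.card A := Nat.one_le_cast.2 Fintype.card_pos
  have hM1 : 1 ≤ M := hA1.trans hA
  have hl0 : 0 ≤ l := by rw [hl]; positivity
  -- Gradient dominance is applied at the proximal point z, where the descent rate is controlled,
  -- and the gap is then transferred to x by the Lipschitz bound.
  obtain ⟨π', h⟩ := exists_descent_policy hζ hζ1 hG hC hCe (greedyPolicy ε z)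
  have h1 := hz.le_of_descent hl0 (paramOf π') fun t ht0 ht1 =>
    h t ε ht0 ht1 ε.2.1 ε.2.2 _ (greedyPolicy_segParam ε z π' ht0 ht1)
  have h2 := (abs_le.1 (abs_maxValue_greedy_sub_le hζ hζ1 hG hA ε z x)).2
  rw [norm_sub_rev] at h2
  set d := ‖(z : EuclideanSpace ℝ (S × A)) - x‖ with hd
  have hd0 : 0 ≤ d := norm_nonneg _
  set v := ⨅ π : Policy S A, G.maxValue π
  have h3 : G.maxValue (greedyPolicy ε z) - v ≤
      C / ζ * (3 * l * √(Fintype.card S) * d + 2 * ε / ζ ^ 2) := by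
    calc _ = C / ζ * (ζ / C * (G.maxValue (greedyPolicy ε z) - v)) := by field_simp
      _ ≤ _ := by gcongr; linarith
  have h4 := lipschitz_const_le hζ hζ1 hM1 hl G.one_le_sqrt_card_state hC1
  have h6 := mul_le_mul_of_nonneg_right h4 hd0
  have h7 : C / ζ * (3 * l * √(Fintype.card S) * d + 2 * ε / ζ ^ 2) =
    3 * (l * √(Fintype.card S) * C / ζ * d) + 2 * C * ε / ζ ^ 3 := by field_simp
  have h8 : 4 * l * √(Fintype.card S) * C / ζ * d = 4 * (l * √(Fintype.card S) * C / ζ * d) := by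
    ring
  linarith

/-- The gap to the best response value at a point with a given proximal point. -/
theorem maxValue_sub_value_le_of_isProx (hζ : 0 < ζ) (hζ1 : ζ ≤ 1)
    (hG : ∀ s a b, ζ ≤ G.stopProb s a b)
    {C : ℝ} (hC : G.mismatch ≠ ⊤) (hCe : C = G.mismatch.toReal)
    (hB : (Fintype.card B : ℝ) ≤ M) (ε : unitInterval) {l : ℝ} (hl : l = 2 * M / ζ ^ 3)
    (π₁ : Policy S A) {y z : paramSet S B}
    (hz : IsProx (fun y => -G.value π₁ (greedyPolicy ε y)) l y z) :
    G.maxValue π₁ - G.value π₁ (greedyPolicy ε y) ≤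
      4 * l * √(Fintype.card S) * C / ζ * ‖(z : EuclideanSpace ℝ (S × B)) - y‖ +
        2 * C * ε / ζ ^ 3 := by
  have hC1 := one_le_mismatch hζ hζ1 hG hC hCe
  have hB1 : (1 : ℝ) ≤ Fintype.card B := Nat.one_le_cast.2 Fintype.card_pos
  have hM1 : 1 ≤ M := hB1.trans hB
  have hl0 : 0 ≤ l := by rw [hl]; positivity
  obtain ⟨π', h⟩ := exists_ascent_policy hζ hζ1 hG hC hCe π₁ (greedyPolicy ε z)
  have h1 := hz.le_of_descent hl0 (g := ζ / C * (G.maxValue π₁ - G.value π₁ (greedyPolicy ε z)) -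
    2 * ε / ζ ^ 2) (paramOf π') fun t ht0 ht1 => by
    have := h t ε ht0 ht1 ε.2.1 ε.2.2 _ (greedyPolicy_segParam ε z π' ht0 ht1)
    linarith
  have h2 := (abs_le.1 (abs_value_greedy_right_sub_le hζ hζ1 hG hB ε π₁ y z)).2
  set d := ‖(z : EuclideanSpace ℝ (S × B)) - y‖ with hd
  have hd0 : 0 ≤ d := norm_nonneg _
  have h3 : G.maxValue π₁ - G.value π₁ (greedyPolicy ε z) ≤
      C / ζ * (3 * l * √(Fintype.card S) * d + 2 * ε / ζ ^ 2) := by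
    calc _ = C / ζ * (ζ / C * (G.maxValue π₁ - G.value π₁ (greedyPolicy ε z))) := by field_simp
      _ ≤ _ := by gcongr; linarith
  have h4 := lipschitz_const_le hζ hζ1 hM1 hl G.one_le_sqrt_card_state hC1
  have h6 := mul_le_mul_of_nonneg_right h4 hd0
  have h7 : C / ζ * (3 * l * √(Fintype.card S) * d + 2 * ε / ζ ^ 2) =
    3 * (l * √(Fintype.card S) * C / ζ * d) + 2 * C * ε / ζ ^ 3 := by field_simp
  have h8 : 4 * l * √(Fintype.card S) * C / ζ * d = 4 * (l * √(Fintype.card S) * C / ζ * d) := by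
    ring
  linarith

end StochasticGame

/-! ### Expectations of bounded functions under discrete laws -/

theorem summable_mul_of_tsum_eq_one {α β : Type*} {P : α → ℝ} {Q : α → β → ℝ}
    (hP0 : ∀ a, 0 ≤ P a) (hP : Summable P) (hQ0 : ∀ a b, 0 ≤ Q a b) (hQ : ∀ a, Summable (Q a))
    (hQ1 : ∀ a, ∑' b, Q a b = 1) : Summable fun z : α × β => P z.1 * Q z.1 z.2 := by
  have h0 : 0 ≤ fun z : α × β => P z.1 * Q z.1 z.2 := fun z => mul_nonneg (hP0 _) (hQ0 _ _)
  have h1 : ∀ a, Summable fun b => P a * Q a b := fun a => (hQ a).mul_left _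
  have h2 : ∀ a, ∑' b, P a * Q a b = P a := fun a => by rw [tsum_mul_left, hQ1, mul_one]
  have h3 : Summable fun a => ∑' b, P a * Q a b := by simpa only [h2] using hP
  exact (summable_prod_of_nonneg h0).2 ⟨h1, h3⟩

namespace PMF

variable {α β : Type*}

theorem summable_toReal (p : PMF α) : Summable fun a => (p a).toReal :=
  ENNReal.summable_toReal p.tsum_coe_ne_top

theorem tsum_toReal (p : PMF α) : ∑' a, (p a).toReal = 1 := by
  rw [← ENNReal.tsum_toReal_eq p.apply_ne_top, p.tsum_coe, ENNReal.toReal_one]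

theorem summable_toReal_mul (p : PMF α) {f : α → ℝ} {c : ℝ} (hf : ∀ a, |f a| ≤ c) :
    Summable fun a => (p a).toReal * f a :=
  Summable.of_norm_bounded (p.summable_toReal.mul_right c) fun a => by
    rw [Real.norm_eq_abs, abs_mul, abs_of_nonneg ENNReal.toReal_nonneg]
    exact mul_le_mul_of_nonneg_left (hf a) ENNReal.toReal_nonneg

theorem expect_mono (p : PMF α) {f g : α → ℝ} {c d : ℝ} (hf : ∀ a, |f a| ≤ c)
    (hg : ∀ a, |g a| ≤ d) (h : ∀ a, f a ≤ g a) : p.expect f ≤ p.expect g :=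
  (p.summable_toReal_mul hf).tsum_le_tsum
    (fun a => mul_le_mul_of_nonneg_left (h a) ENNReal.toReal_nonneg) (p.summable_toReal_mul hg)

theorem expect_const (p : PMF α) (c : ℝ) : p.expect (fun _ => c) = c := by
  rw [expect, tsum_mul_right, p.tsum_toReal, one_mul]

theorem expect_add_const (p : PMF α) {f : α → ℝ} {c : ℝ} (hf : ∀ a, |f a| ≤ c) (d : ℝ) :
    p.expect (fun a => f a + d) = p.expect f + d := by
  have h := (p.summable_toReal_mul hf).tsum_add (p.summable_toReal.mul_right d)
  rw [tsum_mul_right, p.tsum_toReal, one_mul] at h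
  rw [expect, expect, ← h]
  simp only [mul_add]

theorem expect_const_mul (p : PMF α) (f : α → ℝ) (d : ℝ) :
    p.expect (fun a => d * f a) = d * p.expect f := by
  rw [expect, expect, ← tsum_mul_left]
  exact tsum_congr fun a => by ring

theorem abs_expect_le (p : PMF α) {f : α → ℝ} {c : ℝ} (hf : ∀ a, |f a| ≤ c) :
    |p.expect f| ≤ c := by
  obtain ⟨a₀, -⟩ := p.support_nonempty
  have hc : 0 ≤ c := (abs_nonneg _).trans (hf a₀)
  have hb : ∀ d : ℝ, |d| ≤ c → ∀ _ : α, |d| ≤ c := fun d hd _ => hd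
  rw [abs_le]
  constructor
  · rw [← p.expect_const (-c)]
    exact p.expect_mono (hb _ (by rw [abs_neg, abs_of_nonneg hc])) hf fun a => (abs_le.1 (hf a)).1
  · rw [← p.expect_const c]
    exact p.expect_mono hf (hb _ (abs_of_nonneg hc).le) fun a => (abs_le.1 (hf a)).2

theorem expect_pure (a : α) (f : α → ℝ) : (PMF.pure a).expect f = f a := by
  classical
  rw [expect, tsum_eq_single a fun b hb => by simp [PMF.pure_apply, hb]]
  simp

theorem expect_bind (p : PMF α) (q : α → PMF β) {f : β → ℝ} {c : ℝ} (hf : ∀ b, |f b| ≤ c) :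
    (p.bind q).expect f = p.expect fun a => (q a).expect f := by
  have h1 : ∀ b, (p.bind q b).toReal = ∑' a, (p a).toReal * (q a b).toReal := fun b => by
    rw [PMF.bind_apply, ENNReal.tsum_toReal_eq fun a =>
      ENNReal.mul_ne_top (p.apply_ne_top a) ((q a).apply_ne_top b)]
    simp only [ENNReal.toReal_mul]
  have h2 : Summable fun z : α × β => (p z.1).toReal * (q z.1 z.2).toReal :=
    summable_mul_of_tsum_eq_one (P := fun a => (p a).toReal)
      (Q := fun a b => (q a b).toReal) (fun _ => ENNReal.toReal_nonneg) p.summable_toReal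
      (fun _ _ => ENNReal.toReal_nonneg) (fun a => (q a).summable_toReal) fun a => (q a).tsum_toReal
  have h3 : Summable fun z : α × β => (p z.1).toReal * (q z.1 z.2).toReal * f z.2 :=
    Summable.of_norm_bounded (h2.mul_right c) fun z => by
      have h0 : 0 ≤ (p z.1).toReal * (q z.1 z.2).toReal :=
        mul_nonneg ENNReal.toReal_nonneg ENNReal.toReal_nonneg
      rw [Real.norm_eq_abs, abs_mul, abs_of_nonneg h0]
      exact mul_le_mul_of_nonneg_left (hf z.2) h0
  simp only [expect, h1, ← tsum_mul_right, ← tsum_mul_left]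
  rw [Summable.tsum_comm (f := fun a b => (p a).toReal * (q a b).toReal * f b) h3]
  simp only [mul_assoc]

theorem expect_map (p : PMF α) (g : α → β) {f : β → ℝ} {c : ℝ} (hf : ∀ b, |f b| ≤ c) :
    (p.map g).expect f = p.expect fun a => f (g a) := by
  have := p.expect_bind (fun a => PMF.pure (g a)) hf
  simp only [expect_pure] at this
  exact this

end PMF

/-! ### Telescoping a drift inequality -/

namespace StochasticGame

set_option linter.unusedSectionVars false

variable {S : Type u} {A : Type v} {B : Type w} [Fintype S] [Fintype A] [Fintype B]
  [Nonempty A] [Nonempty B]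
variable {G : StochasticGame S A B}

/-- Expected value of `H` after one step of the algorithm. -/
noncomputable def stepExp (G : StochasticGame S A B) (εx εy : unitInterval) (ηx ηy : ℝ)
    (H : paramSet S A × paramSet S B → ℝ) (p : paramSet S A × paramSet S B) : ℝ :=
  (G.trajLaw G.rho (greedyPolicy εx p.1) (greedyPolicy εy p.2)).expect fun τ =>
    H (G.pgStep εx εy ηx ηy p τ)

/-- Telescoping a drift inequality along the iterates. -/
theorem expect_iterateLaw_le (εx εy : unitInterval) (ηx ηy : ℝ) (p₀ : paramSet S A × paramSet S B)
    {u H : paramSet S A × paramSet S B → ℝ} {ub Hb c : ℝ} (hu : ∀ p, |u p| ≤ ub)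
    (hH : ∀ p, |H p| ≤ Hb) (h : ∀ p, u p ≤ H p - G.stepExp εx εy ηx ηy H p + c) (n : ℕ) :
    (G.iterateLaw εx εy ηx ηy p₀ n).expect
      (fun z => ∑ i : Fin n, u (z i.succ) + G.stepExp εx εy ηx ηy H (z (Fin.last n))) ≤
        Hb + n * c := by
  have hT : ∀ p, |G.stepExp εx εy ηx ηy H p| ≤ Hb := fun p => PMF.abs_expect_le _ fun τ => hH _
  have hsum : ∀ (n : ℕ) (z : Fin (n + 1) → paramSet S A × paramSet S B),
      |∑ i : Fin n, u (z i.succ)| ≤ n * ub := fun n z =>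
    (Finset.abs_sum_le_sum_abs _ _).trans ((Finset.sum_le_sum fun i _ => hu _).trans (by simp))
  have hb : ∀ (n : ℕ) (z : Fin (n + 1) → paramSet S A × paramSet S B),
      |∑ i : Fin n, u (z i.succ) + G.stepExp εx εy ηx ηy H (z (Fin.last n))| ≤ n * ub + Hb :=
    fun n z => (abs_add_le _ _).trans (add_le_add (hsum n z) (hT _))
  -- The sum starts at iterate 1 while the chain starts at iterate 0. Keeping the one-step
  -- expectation of H at the last iterate, instead of H itself, aligns the telescoping.
  induction n with
  | zero =>
    change (PMF.pure fun _ => p₀).expect _ ≤ _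
    rw [PMF.expect_pure]
    simpa using (abs_le.1 (hT p₀)).2
  | succ n ih =>
    change (((G.iterateLaw εx εy ηx ηy p₀ n).bind fun h => (G.trajLaw G.rho
      (greedyPolicy εx (h (Fin.last n)).1) (greedyPolicy εy (h (Fin.last n)).2)).map
          fun τ => (Fin.snoc h (G.pgStep εx εy ηx ηy (h (Fin.last n)) τ) :
            Fin (n + 1 + 1) → paramSet S A × paramSet S B))).expect _ ≤ _
    rw [PMF.expect_bind _ _ (hb (n + 1))]
    simp only [PMF.expect_map _ _ (hb (n + 1))]
    have hsnoc : ∀ (z : Fin (n + 1) → paramSet S A × paramSet S B)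
        (q : paramSet S A × paramSet S B),
        ∑ i : Fin (n + 1), u ((Fin.snoc z q : Fin (n + 1 + 1) → _) i.succ) +
          G.stepExp εx εy ηx ηy H ((Fin.snoc z q : Fin (n + 1 + 1) → _) (Fin.last (n + 1))) =
        ∑ i : Fin n, u (z i.succ) + u q + G.stepExp εx εy ηx ηy H q := fun z q => by
      have hl : (Fin.snoc z q : Fin (n + 1 + 1) → paramSet S A × paramSet S B)
          (Fin.last (n + 1)) = q := Fin.snoc_last (α := fun _ => paramSet S A × paramSet S B) q z
      have hc : ∀ i : Fin n, (Fin.snoc z q : Fin (n + 1 + 1) → paramSet S A × paramSet S B)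
          i.castSucc.succ = z i.succ := fun i =>
        Fin.snoc_castSucc (α := fun _ => paramSet S A × paramSet S B) q z i.succ
      have hl' : (Fin.snoc z q : Fin (n + 1 + 1) → paramSet S A × paramSet S B)
          (Fin.last n).succ = q := hl
      rw [Fin.sum_univ_castSucc, hl, hl']
      simp only [hc]
    simp only [hsnoc]
    have hstep : ∀ z : Fin (n + 1) → paramSet S A × paramSet S B,
        (G.trajLaw G.rho (greedyPolicy εx (z (Fin.last n)).1)
          (greedyPolicy εy (z (Fin.last n)).2)).expect (fun τ => ∑ i : Fin n, u (z i.succ) +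
            u (G.pgStep εx εy ηx ηy (z (Fin.last n)) τ) +
            G.stepExp εx εy ηx ηy H (G.pgStep εx εy ηx ηy (z (Fin.last n)) τ)) ≤
        ∑ i : Fin n, u (z i.succ) + G.stepExp εx εy ηx ηy H (z (Fin.last n)) + c := fun z => by
      rw [show ∑ i : Fin n, u (z i.succ) + G.stepExp εx εy ηx ηy H (z (Fin.last n)) + c =
        G.stepExp εx εy ηx ηy H (z (Fin.last n)) + (∑ i : Fin n, u (z i.succ) + c) by ring,
        stepExp, ← PMF.expect_add_const _ (fun τ => hH _)]
      refine PMF.expect_mono _ (c := n * ub + ub + Hb)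
        (d := Hb + |∑ i : Fin n, u (z i.succ) + c|) (fun τ => ?_) (fun τ => ?_) fun τ => ?_
      · exact (abs_add_le _ _).trans (add_le_add ((abs_add_le _ _).trans
          (add_le_add (hsum n z) (hu _))) (hT _))
      · exact (abs_add_le _ _).trans (add_le_add (hH _) le_rfl)
      · linarith [h (G.pgStep εx εy ηx ηy (z (Fin.last n)) τ)]
    refine (PMF.expect_mono _ (c := n * ub + ub + Hb) (d := n * ub + Hb + |c|) (fun z =>
      PMF.abs_expect_le _ fun τ => ?_) (fun z => (abs_add_le _ _).trans
        (add_le_add (hb n z) le_rfl)) hstep).trans ?_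
    · exact (abs_add_le _ _).trans (add_le_add ((abs_add_le _ _).trans
          (add_le_add (hsum n z) (hu _))) (hT _))
    · rw [PMF.expect_add_const _ (hb n)]
      push_cast
      linarith

/-- The averaged gap from a drift inequality. -/
theorem avgGap_le (εx εy : unitInterval) (ηx ηy : ℝ) (p₀ : paramSet S A × paramSet S B)
    {H : paramSet S A × paramSet S B → ℝ} {ub Hb c : ℝ}
    (hu : ∀ x : paramSet S A, |G.maxValue (greedyPolicy εx x)| ≤ ub)
    (hH : ∀ p, |H p| ≤ Hb)
    (h : ∀ p, G.maxValue (greedyPolicy εx p.1) - (⨅ π : Policy S A, G.maxValue π) ≤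
      H p - G.stepExp εx εy ηx ηy H p + c) {N : ℕ} (hN : 0 < N) :
    G.avgGap εx εy ηx ηy p₀ N ≤ 2 * Hb / N + c := by
  set v := ⨅ π : Policy S A, G.maxValue π with hv
  have hT : ∀ p, |G.stepExp εx εy ηx ηy H p| ≤ Hb := fun p => PMF.abs_expect_le _ fun τ => hH _
  -- The minimax value is moved into the error constant. Both ends of the telescope are bounded by
  -- `Hb`, hence the factor 2.
  have h1 := expect_iterateLaw_le (G := G) εx εy ηx ηy p₀ (u := fun p =>
    G.maxValue (greedyPolicy εx p.1)) (c := c + v) (fun p => hu p.1) hH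
    (fun p => by linarith [h p]) N
  have hsum : ∀ (z : Fin (N + 1) → paramSet S A × paramSet S B),
      |∑ i : Fin N, G.maxValue (greedyPolicy εx (z i.succ).1)| ≤ N * ub := fun z =>
    (Finset.abs_sum_le_sum_abs _ _).trans ((Finset.sum_le_sum fun i _ => hu _).trans (by simp))
  have hN' : (0 : ℝ) < N := Nat.cast_pos.2 hN
  have h2 : (G.iterateLaw εx εy ηx ηy p₀ N).expect
      (fun z => ∑ i : Fin N, G.maxValue (greedyPolicy εx (z i.succ).1) + -Hb) ≤
      Hb + N * (c + v) := by
    refine (PMF.expect_mono _ (c := N * ub + |Hb|) (d := N * ub + Hb) (fun z => ?_) (fun z => ?_)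
      fun z => ?_).trans h1
    · exact (abs_add_le _ _).trans (add_le_add (hsum z) (abs_neg _).le)
    · exact (abs_add_le _ _).trans (add_le_add (hsum z) (hT _))
    · linarith [(abs_le.1 (hT (z (Fin.last N)))).1]
  rw [PMF.expect_add_const _ hsum] at h2
  have h3 : G.avgGap εx εy ηx ηy p₀ N = 1 / (N : ℝ) * (G.iterateLaw εx εy ηx ηy p₀ N).expect
      (fun z => ∑ i : Fin N, G.maxValue (greedyPolicy εx (z i.succ).1)) - v := by
    rw [← PMF.expect_const_mul]
    rfl
  rw [h3]
  have h4 : 1 / (N : ℝ) * (G.iterateLaw εx εy ηx ηy p₀ N).expect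
      (fun z => ∑ i : Fin N, G.maxValue (greedyPolicy εx (z i.succ).1)) ≤
      1 / (N : ℝ) * (2 * Hb + N * (c + v)) := by
    gcongr
    linarith
  have h5 : 1 / (N : ℝ) * (2 * Hb + N * (c + v)) = 2 * Hb / N + (c + v) := by field_simp
  linarith

end StochasticGame

/-- The discriminant of the quadratic kz² - az + e is nonpositive. -/
theorem mul_le_mul_sq_add {a k e z : ℝ} (hk : 0 < k) (h : a ^ 2 ≤ 4 * e * k) :
    a * z ≤ k * z ^ 2 + e := by
  have h1 : 0 ≤ 4 * k * (k * z ^ 2 + e - a * z) := by nlinarith [sq_nonneg (2 * k * z - a)]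
  have := nonneg_of_mul_nonneg_right h1 (by positivity)
  linarith

/-! ### The potential and its drift -/

namespace StochasticGame

set_option linter.unusedSectionVars false

variable {S : Type u} {A : Type v} {B : Type w} [Fintype S] [Fintype A] [Fintype B]
  [Nonempty A] [Nonempty B]
variable {G : StochasticGame S A B} {ζ M : ℝ}

/-- The potential function of the two-timescale analysis. -/
noncomputable def potential (G : StochasticGame S A B) (εx εy : unitInterval) (l cT cP : ℝ)
    (p : paramSet S A × paramSet S B) : ℝ :=
  cT * moreau (fun x => G.maxValue (greedyPolicy εx x)) l p.1 +
    cP * moreau (fun y => -G.value (greedyPolicy εx p.1) (greedyPolicy εy y)) l p.2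

theorem exists_isProx_maxValue (hζ : 0 < ζ) (hζ1 : ζ ≤ 1) (hG : ∀ s a b, ζ ≤ G.stopProb s a b)
    (ε : unitInterval) (l : ℝ) (x : paramSet S A) :
    ∃ z, IsProx (fun x => G.maxValue (greedyPolicy ε x)) l x z :=
  exists_isProx (abs_maxValue_greedy_sub_le hζ hζ1 hG le_rfl ε) l x

theorem exists_isProx_neg_value (hζ : 0 < ζ) (hζ1 : ζ ≤ 1) (hG : ∀ s a b, ζ ≤ G.stopProb s a b)
    (ε : unitInterval) (l : ℝ) (π₁ : Policy S A) (y : paramSet S B) :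
    ∃ z, IsProx (fun y => -G.value π₁ (greedyPolicy ε y)) l y z :=
  exists_isProx (fun y y' => by
    rw [neg_sub_neg, abs_sub_comm]
    exact abs_value_greedy_right_sub_le hζ hζ1 hG le_rfl ε π₁ y y') l y

theorem abs_potential_le (hζ : 0 < ζ) (hζ1 : ζ ≤ 1) (hG : ∀ s a b, ζ ≤ G.stopProb s a b)
    (εx εy : unitInterval) {l cT cP : ℝ} (hl : 0 ≤ l) (hT : 0 ≤ cT) (hP : 0 ≤ cP)
    (p : paramSet S A × paramSet S B) : |G.potential εx εy l cT cP p| ≤ (cT + cP) / ζ := by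
  obtain ⟨z, hz⟩ := exists_isProx_maxValue hζ hζ1 hG εx l p.1
  obtain ⟨w, hw⟩ := exists_isProx_neg_value hζ hζ1 hG εy l (greedyPolicy εx p.1) p.2
  have h1 := abs_moreau_le hl hz fun x => abs_maxValue_le hζ hζ1 hG
  have h2 := abs_moreau_le hl hw fun y => by rw [abs_neg]; exact abs_value_le hζ hζ1 hG
  refine (abs_add_le _ _).trans ?_
  rw [abs_mul, abs_mul, abs_of_nonneg hT, abs_of_nonneg hP]
  have h3 := mul_le_mul_of_nonneg_left h1 hT
  have h4 := mul_le_mul_of_nonneg_left h2 hP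
  calc _ ≤ _ := add_le_add h3 h4
    _ = _ := by ring

/-- Pathwise change of the potential in one step. -/
theorem potential_pgStep_le (hζ : 0 < ζ) (hζ1 : ζ ≤ 1) (hG : ∀ s a b, ζ ≤ G.stopProb s a b)
    (hA : (Fintype.card A : ℝ) ≤ M) (εx εy : unitInterval) {ηx ηy : ℝ}
    (hηx : 0 ≤ ηx) {l cT cP σ : ℝ} (hl : 0 ≤ l) (hT : 0 ≤ cT) (hP : 0 ≤ cP)
    (hσ : 0 < σ) (x : paramSet S A) (y : paramSet S B) {z : paramSet S A} {w : paramSet S B}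
    (hz : IsProx (fun x => G.maxValue (greedyPolicy εx x)) l x z)
    (hw : IsProx (fun y => -G.value (greedyPolicy εx x) (greedyPolicy εy y)) l y w)
    (τ : Traj S A B) :
    G.potential εx εy l cT cP (G.pgStep εx εy ηx ηy (x, y) τ) ≤
      (G.potential εx εy l cT cP (x, y) + cP * (√M / ζ ^ 2 * ηx * (σ / 2))) +
        (cT * (2 * l * ηx) * inner ℝ (G.gradMin εx x τ)
          ((z : EuclideanSpace ℝ (S × A)) - x) +
        ((cT * (l * ηx ^ 2) + cP * (√M / ζ ^ 2 * ηx / (2 * σ))) * ‖G.gradMin εx x τ‖ ^ 2 +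
        (-(cP * (2 * l * ηy)) * inner ℝ (G.gradMax εy y τ) ((w : EuclideanSpace ℝ (S × B)) - y) +
        cP * (l * ηy ^ 2) * ‖G.gradMax εy y τ‖ ^ 2))) := by
  set g := G.gradMin εx x τ with hg
  set k := G.gradMax εy y τ with hk
  set x' : paramSet S A := projParam ((x : EuclideanSpace ℝ (S × A)) - ηx • g) with hx'
  set y' : paramSet S B := projParam ((y : EuclideanSpace ℝ (S × B)) - ηy • (-k)) with hy'
  have hstep : G.pgStep εx εy ηx ηy (x, y) τ = (x', y') := by
    rw [hx', hy', smul_neg, sub_neg_eq_add]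
    rfl
  have h1 := hz.moreau_projParam_le hl ηx g
  have h2 := hw.moreau_projParam_le hl ηy (-k)
  rw [inner_neg_left, norm_neg] at h2
  obtain ⟨w₁, hw₁⟩ := exists_isProx_neg_value hζ hζ1 hG εy l (greedyPolicy εx x) y'
  obtain ⟨w₂, hw₂⟩ := exists_isProx_neg_value hζ hζ1 hG εy l (greedyPolicy εx x') y'
  have hL0 : 0 ≤ √M / ζ ^ 2 := by positivity
  have h3 : ‖(x' : EuclideanSpace ℝ (S × A)) - x‖ ≤ ηx * ‖g‖ := norm_projParam_step_le x hηx g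
  -- The step of x also changes the function whose envelope is taken in y. This coupling is first
  -- order in ηx, which is why ηx must be small compared with ηy.
  have h4 := moreau_le_moreau_add hw₁ hw₂ (c := √M / ζ ^ 2 * (ηx * ‖g‖)) fun q => by
    have h5 := (abs_le.1 (abs_value_greedy_left_sub_le hζ hζ1 hG hA εx x x' (greedyPolicy εy q))).1
    have h6 := mul_le_mul_of_nonneg_left h3 hL0
    linarith
  -- Trades the norm for its square, since only second moments are available; in expectation this
  -- costs at most σ.
  have h7 : ‖g‖ ≤ ‖g‖ ^ 2 / (2 * σ) + σ / 2 := by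
    have := mul_le_mul_sq_add (a := 1) (k := 1 / (2 * σ)) (e := σ / 2) (z := ‖g‖) (by positivity)
      (le_of_eq (by field_simp; norm_num))
    linarith [show 1 / (2 * σ) * ‖g‖ ^ 2 = ‖g‖ ^ 2 / (2 * σ) by ring]
  have h8 : √M / ζ ^ 2 * (ηx * ‖g‖) ≤ √M / ζ ^ 2 * (ηx * (‖g‖ ^ 2 / (2 * σ) + σ / 2)) := by
    gcongr
  rw [hstep]
  simp only [potential]
  have h9 := mul_le_mul_of_nonneg_left h1 hT
  have h10 := mul_le_mul_of_nonneg_left (h4.trans (add_le_add h2 h8)) hP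
  refine (add_le_add h9 h10).trans (le_of_eq ?_)
  ring

/-- The drift inequality of the two-timescale analysis. -/
theorem maxValue_sub_le_potential_drift (hζ : 0 < ζ) (hζ1 : ζ ≤ 1)
    (hG : ∀ s a b, ζ ≤ G.stopProb s a b) {C : ℝ} (hC : G.mismatch ≠ ⊤)
    (hCe : C = G.mismatch.toReal) (hA : (Fintype.card A : ℝ) ≤ M) (hB : (Fintype.card B : ℝ) ≤ M)
    {εx εy : unitInterval} (hεx : 0 < (εx : ℝ)) (hεy : 0 < (εy : ℝ)) {ηx ηy : ℝ} (hηx : 0 < ηx)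
    (hηy : 0 < ηy) {l cT cP σ vy α e μ : ℝ} (hl : l = 2 * M / ζ ^ 3) (hT : 0 < cT) (hP : 0 < cP)
    (hσ : 0 < σ) (hσx : 6561 * ((Fintype.card A : ℝ) ^ 2 / εx) / ζ ^ 4 ≤ σ ^ 2)
    (hvy : 6561 * ((Fintype.card B : ℝ) ^ 2 / εy) / ζ ^ 4 ≤ vy)
    (hα : α = 4 * l * √(Fintype.card S) * C / ζ) (he : α ^ 2 ≤ 4 * e * (cT * l ^ 2 * ηx))
    (hμ : (2 * cT * l * ηx * α) ^ 2 ≤ 4 * μ * (cP * l ^ 2 * ηy))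
    (p : paramSet S A × paramSet S B) :
    G.maxValue (greedyPolicy εx p.1) - (⨅ π : Policy S A, G.maxValue π) ≤
      G.potential εx εy l cT cP p - G.stepExp εx εy ηx ηy (G.potential εx εy l cT cP) p +
        (2 * C * εx / ζ ^ 3 + e + 2 * cT * l * ηx * (2 * C * εy / ζ ^ 3) + μ +
          cT * l * ηx ^ 2 * σ ^ 2 + cP * (l * ηy ^ 2 * vy + √M / ζ ^ 2 * ηx * σ)) := by
  obtain ⟨x, y⟩ := p
  have hA1 : (1 : ℝ) ≤ Fintype.card A := Nat.one_le_cast.2 Fintype.card_pos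
  have hM1 : 1 ≤ M := hA1.trans hA
  have hl0 : 0 < l := by rw [hl]; positivity
  have hl2 : M / ζ ^ 3 = l / 2 := by rw [hl]; ring
  have hL0 : 0 ≤ √M / ζ ^ 2 := by positivity
  obtain ⟨z, hz⟩ := exists_isProx_maxValue hζ hζ1 hG εx l x
  obtain ⟨w, hw⟩ := exists_isProx_neg_value hζ hζ1 hG εy l (greedyPolicy εx x) y
  set π₁ := greedyPolicy εx x with hπ₁
  set π₂ := greedyPolicy εy y with hπ₂
  obtain ⟨v₁, hv₁, hs₁⟩ := hasSum_sq_gradMin hζ hζ1 hG hεx x π₂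
  obtain ⟨v₂, hv₂, hs₂⟩ := hasSum_sq_gradMax hζ hζ1 hG hεy π₁ y
  have hi₁ := hasSum_inner_gradMin hζ hζ1 hG hεx x z π₂
  have hi₂ := hasSum_inner_gradMax hζ hζ1 hG hεy π₁ y w
  set d₁ := G.valueDeriv π₁ π₂ (greedyPolicy εx z) π₂ with hd₁
  set d₂ := G.valueDeriv π₁ π₂ π₁ (greedyPolicy εy w) with hd₂
  have hp := G.hasSum_trajProb_real (π₁ := π₁) (π₂ := π₂) G.rho
  set zx := ‖(z : EuclideanSpace ℝ (S × A)) - x‖ with hzx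
  set zy := ‖(w : EuclideanSpace ℝ (S × B)) - y‖ with hzy
  have hexp : G.stepExp εx εy ηx ηy (G.potential εx εy l cT cP) (x, y) ≤
      (G.potential εx εy l cT cP (x, y) + cP * (√M / ζ ^ 2 * ηx * (σ / 2))) +
        (cT * (2 * l * ηx) * d₁ +
        ((cT * (l * ηx ^ 2) + cP * (√M / ζ ^ 2 * ηx / (2 * σ))) * v₁ +
        (-(cP * (2 * l * ηy)) * d₂ + cP * (l * ηy ^ 2) * v₂))) := by
    have hsum := (hp.mul_right
      (G.potential εx εy l cT cP (x, y) + cP * (√M / ζ ^ 2 * ηx * (σ / 2)))).add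
      ((hi₁.mul_left (cT * (2 * l * ηx))).add
        ((hs₁.mul_left (cT * (l * ηx ^ 2) + cP * (√M / ζ ^ 2 * ηx / (2 * σ)))).add
          ((hi₂.mul_left (-(cP * (2 * l * ηy)))).add (hs₂.mul_left (cP * (l * ηy ^ 2))))))
    rw [one_mul] at hsum
    have hH := (G.trajLaw G.rho π₁ π₂).summable_toReal_mul
      (f := fun τ => G.potential εx εy l cT cP (G.pgStep εx εy ηx ηy (x, y) τ))
      (fun τ => abs_potential_le hζ hζ1 hG εx εy hl0.le hT.le hP.le _)
    refine hasSum_le (fun τ => ?_) hH.hasSum hsum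
    rw [trajLaw_apply_toReal]
    refine (mul_le_mul_of_nonneg_left (potential_pgStep_le hζ hζ1 hG hA εx εy hηx.le hl0.le
      hT.le hP.le hσ x y hz hw τ) (G.trajProb_nonneg _ _ _ τ)).trans (le_of_eq ?_)
    ring
  have e1 := (abs_le.1 (abs_value_greedy_left_sub_sub_le hζ hζ1 hG hA εx x z π₂)).1
  have e2 := (abs_le.1 (abs_value_greedy_right_sub_sub_le hζ hζ1 hG hB εy π₁ y w)).2
  rw [hl2] at e1 e2
  have e3 := hz.le
  have e4 := hw.le
  have e5 := value_le_maxValue hζ hζ1 hG (greedyPolicy εx z) π₂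
  have hgap := maxValue_sub_le_of_isProx hζ hζ1 hG hC hCe hA εx hl hz
  have hdel := maxValue_sub_value_le_of_isProx hζ hζ1 hG hC hCe hB εy hl π₁ hw
  rw [← hα] at hgap hdel
  -- Smoothness gives d₁ ≤ V(z, y) - V(x, y) + (l/2)zx². Then V(z, y) ≤ Φ(z) ≤ Φ(x) - l zx² since z
  -- is proximal, and Φ(x) - V(x, y), the tracking error of the max-player, is bounded by `hdel`.
  have i1 : d₁ ≤ α * zy + 2 * C * εy / ζ ^ 3 - l / 2 * zx ^ 2 := by linarith
  -- The proximal point w gains at least l zy² in value, and smoothness loses only half of it; this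
  -- is why l is twice the smoothness constant.
  have i2 : l / 2 * zy ^ 2 ≤ d₂ := by linarith
  have i3 : v₁ ≤ σ ^ 2 := hv₁.trans hσx
  have i4 : v₂ ≤ vy := hv₂.trans hvy
  -- The negative zx² term in the drift of the first envelope pays for the gap α zx. The negative
  -- zy² term of the second envelope pays for the tracking error α zy that the first one incurs.
  have a1 := mul_le_mul_sq_add (z := zx) (by positivity) he
  have a2 := mul_le_mul_sq_add (z := zy) (by positivity) hμ
  have j1 := mul_le_mul_of_nonneg_left i1 (show 0 ≤ cT * (2 * l * ηx) by positivity)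
  have j2 := mul_le_mul_of_nonneg_left i2 (show 0 ≤ cP * (2 * l * ηy) by positivity)
  have j3 := mul_le_mul_of_nonneg_left i3 (show 0 ≤ cT * (l * ηx ^ 2) +
    cP * (√M / ζ ^ 2 * ηx / (2 * σ)) by positivity)
  have j4 := mul_le_mul_of_nonneg_left i4 (show 0 ≤ cP * (l * ηy ^ 2) by positivity)
  have j5 : cP * (√M / ζ ^ 2 * ηx / (2 * σ)) * σ ^ 2 = cP * (√M / ζ ^ 2 * ηx * (σ / 2)) := by
    field_simp
  linarith

end StochasticGame

/-! ### Error budget for the parameters -/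

/-- All exponents in the theorem are multiples of 1/4, so in terms of fourth roots every bound
becomes an inequality between monomials with natural exponents. -/
theorem pow_four_rpow {c : ℝ} (hc : 0 ≤ c) {r : ℝ} {j : ℕ} (h : 4 * r = j) :
    (c ^ 4) ^ r = c ^ j := by
  rw [← Real.rpow_natCast c 4, ← Real.rpow_mul hc, ← Real.rpow_natCast c j]
  push_cast
  rw [h]

theorem exists_pow_four {x : ℝ} (hx : 0 < x) : ∃ y, 0 < y ∧ x = y ^ 4 :=
  ⟨x ^ (1 / 4 : ℝ), Real.rpow_pos_of_pos hx _, by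
    rw [← Real.rpow_natCast, ← Real.rpow_mul hx.le]; norm_num⟩

section Budget

/-! The summands of the drift bound, in terms of the fourth roots `c, m, k, z, w` of the parameters
`C, A ∨ B, S, ζ, ε`. -/

variable {c m k z w : ℝ}

theorem exploration_min_le (hc : 1 ≤ c) (hm : 1 ≤ m) (hk : 1 ≤ k) (hz : 0 < z)
    (hw : 0 < w) {εx : ℝ} (h : εx ≤ 1 / 32 * (z ^ 12 * w ^ 4 / (k ^ 2 * m ^ 2 * c ^ 4))) :
    2 * c ^ 4 * εx / z ^ 12 ≤ w ^ 4 / 16 := by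
  have hc0 := one_pos.trans_le hc
  have hm0 := one_pos.trans_le hm
  have hk0 := one_pos.trans_le hk
  calc 2 * c ^ 4 * εx / z ^ 12 ≤
        2 * c ^ 4 * (1 / 32 * (z ^ 12 * w ^ 4 / (k ^ 2 * m ^ 2 * c ^ 4))) / z ^ 12 := by gcongr
    _ = w ^ 4 / 16 / (k ^ 2 * m ^ 2) := by field_simp; norm_num
    _ ≤ w ^ 4 / 16 := div_le_self (by positivity)
        (one_le_mul_of_one_le_of_one_le (one_le_pow₀ hk) (one_le_pow₀ hm))

/-- Tight at the largest admissible ε_y: this term dictates its order. -/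
theorem exploration_max_le (hc : 1 ≤ c) (hm : 1 ≤ m) (hk : 1 ≤ k) (hz : 0 < z)
    (hw : 0 < w) {εy ηx : ℝ} (hηx : 0 < ηx)
    (h : εy ≤ 1 / 2 ^ 11 * (z ^ 32 * w ^ 8 / (c ^ 12 * m ^ 4 * k ^ 4))) :
    2 * (16 * k ^ 4 * c ^ 8 / (z ^ 8 * w ^ 4 * ηx)) * (2 * m ^ 4 / z ^ 12) * ηx *
      (2 * c ^ 4 * εy / z ^ 12) ≤ w ^ 4 / 16 := by
  have hc0 := one_pos.trans_le hc
  have hm0 := one_pos.trans_le hm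
  have hk0 := one_pos.trans_le hk
  calc _ ≤ 2 * (16 * k ^ 4 * c ^ 8 / (z ^ 8 * w ^ 4 * ηx)) * (2 * m ^ 4 / z ^ 12) * ηx *
      (2 * c ^ 4 * (1 / 2 ^ 11 * (z ^ 32 * w ^ 8 / (c ^ 12 * m ^ 4 * k ^ 4))) / z ^ 12) := by gcongr
    _ = w ^ 4 / 16 := by field_simp; norm_num

theorem variance_min_le (hc : 1 ≤ c) (hm : 1 ≤ m) (hk : 1 ≤ k) (hz : 0 < z)
    (hw : 0 < w) (hz1 : z ≤ 1) (hwz : w ^ 4 * z ^ 4 ≤ 2) {ηx : ℝ} (hηx : 0 < ηx)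
    (h : ηx ≤ 1 / 2 ^ 81 * (w ^ 42 * z ^ 178 / (c ^ 62 * m ^ 39 * k ^ 29))) :
    (16 * k ^ 4 * c ^ 8 / (z ^ 8 * w ^ 4 * ηx)) * (2 * m ^ 4 / z ^ 12) * ηx ^ 2 *
      (2 ^ 10 * m ^ 5 * k * c ^ 2 / (z ^ 14 * w ^ 2)) ^ 2 ≤ w ^ 4 / 16 := by
  have hc0 := one_pos.trans_le hc
  have hm0 := one_pos.trans_le hm
  have hk0 := one_pos.trans_le hk
  have h1 : (w * z) ^ 30 ≤ 2 ^ 8 := by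
    have h2 : (w * z) ^ 4 ≤ 2 := by rw [mul_pow]; exact hwz
    have h3 : ((w * z) ^ 30) ^ 4 ≤ (2 ^ 8) ^ 4 := by
      calc ((w * z) ^ 30) ^ 4 = ((w * z) ^ 4) ^ 30 := by ring
        _ ≤ 2 ^ 30 := by gcongr
        _ ≤ (2 ^ 8) ^ 4 := by norm_num
    exact le_of_pow_le_pow_left₀ (by norm_num) (by positivity) h3
  calc _ = 2 ^ 25 * k ^ 6 * m ^ 14 * c ^ 12 / (z ^ 48 * w ^ 8) * ηx := by field_simp; norm_num
    _ ≤ 2 ^ 25 * k ^ 6 * m ^ 14 * c ^ 12 / (z ^ 48 * w ^ 8) *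
        (1 / 2 ^ 81 * (w ^ 42 * z ^ 178 / (c ^ 62 * m ^ 39 * k ^ 29))) := by gcongr
    _ = 1 / 2 ^ 56 * (w ^ 4 * (w * z) ^ 30 * z ^ 100) / (c ^ 50 * m ^ 25 * k ^ 23) := by
        field_simp
    _ ≤ 1 / 2 ^ 56 * (w ^ 4 * (w * z) ^ 30 * z ^ 100) := div_le_self (by positivity)
        (one_le_mul_of_one_le_of_one_le (one_le_mul_of_one_le_of_one_le (one_le_pow₀ hc)
          (one_le_pow₀ hm)) (one_le_pow₀ hk))
    _ ≤ 1 / 2 ^ 56 * (w ^ 4 * 2 ^ 8 * 1) := by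
        gcongr
        exact pow_le_one₀ hz.le hz1
    _ ≤ w ^ 4 / 16 := by
        have : 0 < w ^ 4 := by positivity
        norm_num
        linarith

/-- Tight at the largest admissible η_y: this term dictates its order. -/
theorem variance_max_le (hc : 1 ≤ c) (hm : 1 ≤ m) (hk : 1 ≤ k) (hz : 0 < z)
    (hw : 0 < w) {ηy : ℝ} (hηy : 0 < ηy)
    (h : ηy ≤ 1 / 2 ^ 48 * (w ^ 24 * z ^ 108 / (c ^ 36 * m ^ 24 * k ^ 16))) :
    (2 ^ 18 * m ^ 8 * k ^ 12 * c ^ 24 / (z ^ 48 * w ^ 12 * ηy)) * ((2 * m ^ 4 / z ^ 12) * ηy ^ 2 *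
      (2 ^ 25 * m ^ 12 * k ^ 4 * c ^ 12 / (z ^ 48 * w ^ 8))) ≤ w ^ 4 / 16 := by
  have hc0 := one_pos.trans_le hc
  have hm0 := one_pos.trans_le hm
  have hk0 := one_pos.trans_le hk
  calc _ = 2 ^ 44 * m ^ 24 * k ^ 16 * c ^ 36 / (z ^ 108 * w ^ 20) * ηy := by field_simp
    _ ≤ 2 ^ 44 * m ^ 24 * k ^ 16 * c ^ 36 / (z ^ 108 * w ^ 20) *
      (1 / 2 ^ 48 * (w ^ 24 * z ^ 108 / (c ^ 36 * m ^ 24 * k ^ 16))) := by gcongr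
    _ = w ^ 4 / 16 := by field_simp; norm_num

/-- The cost of the moving target of the max-player. It is tight at the largest η_x and smallest
η_y, and so fixes the order of η_x relative to η_y. -/
theorem drift_min_le (hc : 1 ≤ c) (hm : 1 ≤ m) (hk : 1 ≤ k) (hz : 0 < z)
    (hw : 0 < w) {ηx ηy : ℝ}
    (hηx : 0 < ηx) (hx : ηx ≤ 1 / 2 ^ 81 * (w ^ 42 * z ^ 178 / (c ^ 62 * m ^ 39 * k ^ 29)))
    (hy : 1 / 2 ^ 49 * (w ^ 24 * z ^ 108 / (c ^ 36 * m ^ 24 * k ^ 16)) ≤ ηy) :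
    (2 ^ 18 * m ^ 8 * k ^ 12 * c ^ 24 / (z ^ 48 * w ^ 12 * ηy)) * (m ^ 2 / z ^ 8 * ηx *
      (2 ^ 10 * m ^ 5 * k * c ^ 2 / (z ^ 14 * w ^ 2))) ≤ w ^ 4 / 16 := by
  have hc0 := one_pos.trans_le hc
  have hm0 := one_pos.trans_le hm
  have hk0 := one_pos.trans_le hk
  calc _ ≤ (2 ^ 18 * m ^ 8 * k ^ 12 * c ^ 24 / (z ^ 48 * w ^ 12 *
        (1 / 2 ^ 49 * (w ^ 24 * z ^ 108 / (c ^ 36 * m ^ 24 * k ^ 16))))) * (m ^ 2 / z ^ 8 *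
        (1 / 2 ^ 81 * (w ^ 42 * z ^ 178 / (c ^ 62 * m ^ 39 * k ^ 29))) *
        (2 ^ 10 * m ^ 5 * k * c ^ 2 / (z ^ 14 * w ^ 2))) := by gcongr
    _ = w ^ 4 / 16 := by field_simp; norm_num

/-- The initial potential divided by N. The stated number of episodes leaves slack here: a factor
ζ/((A ∨ B)√S), besides constants. -/
theorem initial_min_le (hc : 1 ≤ c) (hm : 1 ≤ m) (hk : 1 ≤ k) (hz : 0 < z)
    (hw : 0 < w) (hz1 : z ≤ 1) {ηx N : ℝ}
    (hx : 1 / 2 ^ 82 * (w ^ 42 * z ^ 178 / (c ^ 62 * m ^ 39 * k ^ 29)) ≤ ηx)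
    (hN : 2 ^ 100 * (m ^ 43 * k ^ 35 * c ^ 70 / (w ^ 50 * z ^ 194)) ≤ N) :
    2 * (16 * k ^ 4 * c ^ 8 / (z ^ 8 * w ^ 4 * ηx)) / z ^ 4 / N ≤ w ^ 4 / 16 := by
  have hc0 := one_pos.trans_le hc
  have hm0 := one_pos.trans_le hm
  have hk0 := one_pos.trans_le hk
  calc _ ≤ 2 * (16 * k ^ 4 * c ^ 8 / (z ^ 8 * w ^ 4 *
        (1 / 2 ^ 82 * (w ^ 42 * z ^ 178 / (c ^ 62 * m ^ 39 * k ^ 29))))) / z ^ 4 /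
        (2 ^ 100 * (m ^ 43 * k ^ 35 * c ^ 70 / (w ^ 50 * z ^ 194))) := by gcongr
    _ = 1 / 2 ^ 13 * (w ^ 4 * z ^ 4) / (m ^ 4 * k ^ 2) := by field_simp; norm_num
    _ ≤ 1 / 2 ^ 13 * (w ^ 4 * z ^ 4) := div_le_self (by positivity)
        (one_le_mul_of_one_le_of_one_le (one_le_pow₀ hm) (one_le_pow₀ hk))
    _ ≤ 1 / 2 ^ 13 * (w ^ 4 * 1) := by
        gcongr
        exact pow_le_one₀ hz.le hz1
    _ ≤ w ^ 4 / 16 := by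
        have : 0 < w ^ 4 := by positivity
        norm_num
        linarith

theorem initial_max_le (hc : 1 ≤ c) (hm : 1 ≤ m) (hk : 1 ≤ k) (hz : 0 < z)
    (hw : 0 < w) (hz1 : z ≤ 1) (hwz : w ^ 4 * z ^ 4 ≤ 2) {ηy N : ℝ}
    (hy : 1 / 2 ^ 49 * (w ^ 24 * z ^ 108 / (c ^ 36 * m ^ 24 * k ^ 16)) ≤ ηy)
    (hN : 2 ^ 100 * (m ^ 43 * k ^ 35 * c ^ 70 / (w ^ 50 * z ^ 194)) ≤ N) :
    2 * (2 ^ 18 * m ^ 8 * k ^ 12 * c ^ 24 / (z ^ 48 * w ^ 12 * ηy)) / z ^ 4 / N ≤ w ^ 4 / 16 := by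
  have hc0 := one_pos.trans_le hc
  have hm0 := one_pos.trans_le hm
  have hk0 := one_pos.trans_le hk
  have h1 : (w * z) ^ 10 ≤ 2 ^ 3 := by
    have h2 : (w * z) ^ 4 ≤ 2 := by rw [mul_pow]; exact hwz
    have h3 : ((w * z) ^ 10) ^ 4 ≤ (2 ^ 3) ^ 4 := by
      calc ((w * z) ^ 10) ^ 4 = ((w * z) ^ 4) ^ 10 := by ring
        _ ≤ 2 ^ 10 := by gcongr
        _ ≤ (2 ^ 3) ^ 4 := by norm_num
    exact le_of_pow_le_pow_left₀ (by norm_num) (by positivity) h3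
  calc _ ≤ 2 * (2 ^ 18 * m ^ 8 * k ^ 12 * c ^ 24 / (z ^ 48 * w ^ 12 *
        (1 / 2 ^ 49 * (w ^ 24 * z ^ 108 / (c ^ 36 * m ^ 24 * k ^ 16))))) / z ^ 4 /
        (2 ^ 100 * (m ^ 43 * k ^ 35 * c ^ 70 / (w ^ 50 * z ^ 194))) := by gcongr
    _ = 1 / 2 ^ 32 * (w ^ 4 * (w * z) ^ 10 * z ^ 24) / (m ^ 11 * k ^ 7 * c ^ 10) := by
        field_simp
    _ ≤ 1 / 2 ^ 32 * (w ^ 4 * (w * z) ^ 10 * z ^ 24) := div_le_self (by positivity)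
        (one_le_mul_of_one_le_of_one_le (one_le_mul_of_one_le_of_one_le (one_le_pow₀ hm)
          (one_le_pow₀ hk)) (one_le_pow₀ hc))
    _ ≤ 1 / 2 ^ 32 * (w ^ 4 * 2 ^ 3 * 1) := by
        gcongr
        exact pow_le_one₀ hz.le hz1
    _ ≤ w ^ 4 / 16 := by
        have : 0 < w ^ 4 := by positivity
        norm_num
        linarith

theorem second_moment_min_le (hc : 1 ≤ c) (hm : 1 ≤ m) (hk : 1 ≤ k) (hz : 0 < z)
    (hw : 0 < w) {a εx : ℝ} (ha : 0 ≤ a) (ham : a ≤ m ^ 4)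
    (h : 1 / 64 * (z ^ 12 * w ^ 4 / (k ^ 2 * m ^ 2 * c ^ 4)) ≤ εx) :
    6561 * (a ^ 2 / εx) / z ^ 16 ≤ (2 ^ 10 * m ^ 5 * k * c ^ 2 / (z ^ 14 * w ^ 2)) ^ 2 := by
  have hc0 := one_pos.trans_le hc
  have hm0 := one_pos.trans_le hm
  have hk0 := one_pos.trans_le hk
  calc _ ≤ 6561 * ((m ^ 4) ^ 2 / (1 / 64 * (z ^ 12 * w ^ 4 / (k ^ 2 * m ^ 2 * c ^ 4)))) / z ^ 16 := by
        gcongr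
    _ = 419904 * (m ^ 10 * k ^ 2 * c ^ 4 / (z ^ 28 * w ^ 4)) := by field_simp; norm_num
    _ ≤ 2 ^ 20 * (m ^ 10 * k ^ 2 * c ^ 4 / (z ^ 28 * w ^ 4)) := by gcongr; norm_num
    _ = _ := by field_simp

theorem second_moment_max_le (hc : 1 ≤ c) (hm : 1 ≤ m) (hk : 1 ≤ k) (hz : 0 < z)
    (hw : 0 < w) {a εy : ℝ} (ha : 0 ≤ a) (ham : a ≤ m ^ 4)
    (h : 1 / 2 ^ 12 * (z ^ 32 * w ^ 8 / (c ^ 12 * m ^ 4 * k ^ 4)) ≤ εy) :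
    6561 * (a ^ 2 / εy) / z ^ 16 ≤ 2 ^ 25 * m ^ 12 * k ^ 4 * c ^ 12 / (z ^ 48 * w ^ 8) := by
  have hc0 := one_pos.trans_le hc
  have hm0 := one_pos.trans_le hm
  have hk0 := one_pos.trans_le hk
  calc _ ≤ 6561 * ((m ^ 4) ^ 2 / (1 / 2 ^ 12 * (z ^ 32 * w ^ 8 / (c ^ 12 * m ^ 4 * k ^ 4)))) /
        z ^ 16 := by gcongr
    _ = 26873856 * (m ^ 12 * k ^ 4 * c ^ 12 / (z ^ 48 * w ^ 8)) := by field_simp; norm_num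
    _ ≤ 2 ^ 25 * (m ^ 12 * k ^ 4 * c ^ 12 / (z ^ 48 * w ^ 8)) := by gcongr; norm_num
    _ = _ := by field_simp

end Budget

/-! ### Assembling the bound -/

namespace StochasticGame

set_option linter.unusedSectionVars false

variable {S : Type u} {A : Type v} {B : Type w} [Fintype S] [Fintype A] [Fintype B]
  [Nonempty A] [Nonempty B]
variable {G : StochasticGame S A B}

/-- The trivial bound on the averaged gap. -/
theorem avgGap_le_two_div {ζ : ℝ} (hζ : 0 < ζ) (hζ1 : ζ ≤ 1) (hG : ∀ s a b, ζ ≤ G.stopProb s a b)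
    (εx εy : unitInterval) (ηx ηy : ℝ) (p₀ : paramSet S A × paramSet S B) {N : ℕ} (hN : 0 < N) :
    G.avgGap εx εy ηx ηy p₀ N ≤ 2 / ζ := by
  have hm : ∀ π₁ : Policy S A, |G.maxValue π₁| ≤ 1 / ζ := fun π₁ => abs_maxValue_le hζ hζ1 hG
  have : Nonempty (Policy S A) := ⟨greedyPolicy εx p₀.1⟩
  have h1 : -(1 / ζ) ≤ ⨅ π : Policy S A, G.maxValue π := le_ciInf fun π => (abs_le.1 (hm π)).1
  -- With zero potential the drift inequality is the pointwise bound of the gap by twice the maximal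
  -- absolute value.
  have h := avgGap_le (G := G) εx εy ηx ηy p₀ (H := fun _ => 0) (Hb := 0) (c := 2 / ζ)
    (fun x => hm _) (fun _ => abs_zero.le) (fun p => by
      rw [stepExp, PMF.expect_const]
      have h2 := (abs_le.1 (hm (greedyPolicy εx p.1))).2
      have h3 : 2 / ζ = 1 / ζ + 1 / ζ := by ring
      linarith) hN
  simpa using h

/-- The averaged gap for the parameters of the theorem, in terms of the fourth roots `c, m, k, z, w`
of `C, A ∨ B, S, ζ, ε`. -/
theorem avgGap_le_of_pow_four {c m k z w : ℝ} (hc : 1 ≤ c) (hm : 1 ≤ m) (hk : 1 ≤ k) (hz : 0 < z)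
    (hw : 0 < w) (hz1 : z ≤ 1) (hwz : w ^ 4 * z ^ 4 ≤ 2)
    (hG : ∀ s a b, z ^ 4 ≤ G.stopProb s a b) (hC : G.mismatch ≠ ⊤)
    (hCe : c ^ 4 = G.mismatch.toReal) (hA : (Fintype.card A : ℝ) ≤ m ^ 4)
    (hB : (Fintype.card B : ℝ) ≤ m ^ 4) (hS : √(Fintype.card S) = k ^ 2)
    {εx εy : unitInterval} {ηx ηy : ℝ}
    (hεx : 1 / 64 * (z ^ 12 * w ^ 4 / (k ^ 2 * m ^ 2 * c ^ 4)) ≤ εx)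
    (hεx' : εx ≤ 1 / 32 * (z ^ 12 * w ^ 4 / (k ^ 2 * m ^ 2 * c ^ 4)))
    (hεy : 1 / 2 ^ 12 * (z ^ 32 * w ^ 8 / (c ^ 12 * m ^ 4 * k ^ 4)) ≤ εy)
    (hεy' : εy ≤ 1 / 2 ^ 11 * (z ^ 32 * w ^ 8 / (c ^ 12 * m ^ 4 * k ^ 4)))
    (hηx : 1 / 2 ^ 82 * (w ^ 42 * z ^ 178 / (c ^ 62 * m ^ 39 * k ^ 29)) ≤ ηx)
    (hηx' : ηx ≤ 1 / 2 ^ 81 * (w ^ 42 * z ^ 178 / (c ^ 62 * m ^ 39 * k ^ 29)))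
    (hηy : 1 / 2 ^ 49 * (w ^ 24 * z ^ 108 / (c ^ 36 * m ^ 24 * k ^ 16)) ≤ ηy)
    (hηy' : ηy ≤ 1 / 2 ^ 48 * (w ^ 24 * z ^ 108 / (c ^ 36 * m ^ 24 * k ^ 16)))
    (p₀ : paramSet S A × paramSet S B) {N : ℕ} (hN0 : 0 < N)
    (hN : 2 ^ 100 * (m ^ 43 * k ^ 35 * c ^ 70 / (w ^ 50 * z ^ 194)) ≤ N) :
    G.avgGap εx εy ηx ηy p₀ N ≤ w ^ 4 := by
  have hc0 := one_pos.trans_le hc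
  have hm0 := one_pos.trans_le hm
  have hk0 := one_pos.trans_le hk
  have hεx0 : 0 < (εx : ℝ) := lt_of_lt_of_le (by positivity) hεx
  have hεy0 : 0 < (εy : ℝ) := lt_of_lt_of_le (by positivity) hεy
  have hηx0 : 0 < ηx := lt_of_lt_of_le (by positivity) hηx
  have hηy0 : 0 < ηy := lt_of_lt_of_le (by positivity) hηy
  have hζ : 0 < z ^ 4 := by positivity
  have hζ1 : z ^ 4 ≤ 1 := pow_le_one₀ hz.le hz1
  have e2 : (z ^ 4) ^ 2 = z ^ 8 := by ring
  have e3 : (z ^ 4) ^ 3 = z ^ 12 := by ring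
  have e4 : (z ^ 4) ^ 4 = z ^ 16 := by ring
  have em : √(m ^ 4) = m ^ 2 := by
    rw [show m ^ 4 = (m ^ 2) ^ 2 by ring, Real.sqrt_sq (by positivity)]
  set l := 2 * m ^ 4 / z ^ 12 with hl
  -- The weights `cT` and `cP` solve the two Young conditions of the drift lemma with equality, for
  -- error shares ε/4 and ε/16. The values `σ` and `vy` are the second moment bounds at the smallest
  -- admissible exploration, with numerical constants rounded up to powers of 2.
  set cT := 16 * k ^ 4 * c ^ 8 / (z ^ 8 * w ^ 4 * ηx) with hcT
  set cP := 2 ^ 18 * m ^ 8 * k ^ 12 * c ^ 24 / (z ^ 48 * w ^ 12 * ηy) with hcP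
  set σ := 2 ^ 10 * m ^ 5 * k * c ^ 2 / (z ^ 14 * w ^ 2) with hσ
  set vy := 2 ^ 25 * m ^ 12 * k ^ 4 * c ^ 12 / (z ^ 48 * w ^ 8) with hvy
  have hl0 : 0 < l := by positivity
  have hcT0 : 0 < cT := by positivity
  have hcP0 : 0 < cP := by positivity
  have hσ0 : 0 < σ := by positivity
  have hdrift := maxValue_sub_le_potential_drift (G := G) (M := m ^ 4) hζ hζ1 hG hC hCe hA hB hεx0
    hεy0 hηx0 hηy0 (l := l) (by rw [e3]) hcT0 hcP0 hσ0
    (by rw [e4]; exact second_moment_min_le hc hm hk hz hw (Nat.cast_nonneg _) hA hεx)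
    (vy := vy)
    (by rw [e4]; exact second_moment_max_le hc hm hk hz hw (Nat.cast_nonneg _) hB hεy)
    (α := 4 * l * k ^ 2 * c ^ 4 / z ^ 4) (by rw [hS]) (e := w ^ 4 / 4)
    (le_of_eq (by rw [hcT, hl]; field_simp; try norm_num)) (μ := w ^ 4 / 16)
    (le_of_eq (by rw [hcT, hcP, hl]; field_simp; try norm_num))
  have h := avgGap_le (G := G) εx εy ηx ηy p₀ (fun x => abs_maxValue_le hζ hζ1 hG)
    (abs_potential_le hζ hζ1 hG εx εy hl0.le hcT0.le hcP0.le) hdrift hN0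
  rw [e2, e3, em] at h
  have b1 := exploration_min_le hc hm hk hz hw hεx'
  have b2 := exploration_max_le hc hm hk hz hw hηx0 hεy'
  have b3 := variance_min_le hc hm hk hz hw hz1 hwz hηx0 hηx'
  have b4 := variance_max_le hc hm hk hz hw hηy0 hηy'
  have b5 := drift_min_le hc hm hk hz hw hηx0 hηx' hηy
  have b6 := initial_min_le hc hm hk hz hw hz1 hηx hN
  have b7 := initial_max_le hc hm hk hz hw hz1 hwz hηy hN
  rw [← hcT, ← hl] at b2
  rw [← hcT, ← hl, ← hσ] at b3
  rw [← hcP, ← hl, ← hvy] at b4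
  rw [← hcP, ← hσ] at b5
  rw [← hcT] at b6
  rw [← hcP] at b7
  have e5 : 2 * ((cT + cP) / z ^ 4) / N = 2 * cT / z ^ 4 / N + 2 * cP / z ^ 4 / N := by ring
  rw [mul_add, e5] at h
  have : 0 < w ^ 4 := by positivity
  -- One share of ε/4 and eight shares of ε/16 add up to 3ε/4.
  linarith

end StochasticGame

theorem theorem1 :
    ∃ a₁ b₁ a₂ b₂ a₃ b₃ a₄ b₄ K : ℝ,
      (0 < a₁ ∧ a₁ < b₁) ∧ (0 < a₂ ∧ a₂ < b₂) ∧ (0 < a₃ ∧ a₃ < b₃) ∧ (0 < a₄ ∧ a₄ < b₄) ∧ 0 < K ∧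
      ∀ (S : Type u) (A : Type v) (B : Type w) [Fintype S] [Fintype A] [Fintype B]
        [Nonempty A] [Nonempty B] (G : StochasticGame S A B) (ζ ε : ℝ)
        (εx εy : unitInterval) (ηx ηy : ℝ) (C M n Ex Ey Hx Hy : ℝ),
        0 < ζ → (∀ s a b, ζ ≤ G.stopProb s a b) → G.mismatch ≠ ⊤ → 0 < ε →
        C = G.mismatch.toReal →
        M = max (Fintype.card A : ℝ) (Fintype.card B : ℝ) →
        n = (Fintype.card S : ℝ) →
        Ex = ζ ^ 3 * ε / (√n * √M * C) →
        Ey = ζ ^ 8 * ε ^ 2 / (C ^ 3 * M * n) →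
        Hx = ε ^ (10.5 : ℝ) * ζ ^ (44.5 : ℝ) /
          (C ^ (15.5 : ℝ) * M ^ (9.75 : ℝ) * n ^ (7.25 : ℝ)) →
        Hy = ε ^ 6 * ζ ^ 27 / (C ^ 9 * M ^ 6 * n ^ 4) →
        (εx : ℝ) ∈ Set.Icc (a₁ * Ex) (b₁ * Ex) → (εy : ℝ) ∈ Set.Icc (a₂ * Ey) (b₂ * Ey) →
        ηx ∈ Set.Icc (a₃ * Hx) (b₃ * Hx) → ηy ∈ Set.Icc (a₄ * Hy) (b₄ * Hy) →
        ∀ (p₀ : paramSet S A × paramSet S B) (N : ℕ),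
          K * (M ^ (10.75 : ℝ) * n ^ (8.75 : ℝ) * C ^ (17.5 : ℝ) /
            (ε ^ (12.5 : ℝ) * ζ ^ (48.5 : ℝ))) ≤ N →
          G.avgGap εx εy ηx ηy p₀ N ≤ ε := by
  refine ⟨1 / 64, 1 / 32, 1 / 2 ^ 12, 1 / 2 ^ 11, 1 / 2 ^ 82, 1 / 2 ^ 81, 1 / 2 ^ 49, 1 / 2 ^ 48,
    2 ^ 100, by norm_num, by norm_num, by norm_num, by norm_num, by norm_num, ?_⟩
  intro S A B _ _ _ _ _ G ζ ε εx εy ηx ηy C M n Ex Ey Hx Hy hζ hG hC hε hCe hM hn hEx hEy hHx hHy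
    hεx hεy hηx hηy p₀ N hN
  have hS : Nonempty S := by
    by_contra h
    have h1 : ∑ s, G.rho s = 1 := G.rho.2.2
    rw [not_nonempty_iff] at h
    simp at h1
  have hζ1 : ζ ≤ 1 := by
    obtain ⟨s⟩ := hS
    obtain ⟨a⟩ := ‹Nonempty A›
    obtain ⟨b⟩ := ‹Nonempty B›
    exact (hG s a b).trans (G.stopProb_le_one s a b)
  have hC1 : 1 ≤ C := G.one_le_mismatch hζ hζ1 hG hC hCe
  have hM1 : 1 ≤ M := hM ▸ (Nat.one_le_cast.2 Fintype.card_pos).trans (le_max_left _ _)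
  have hn1 : 1 ≤ n := hn ▸ Nat.one_le_cast.2 Fintype.card_pos
  have hC0 := one_pos.trans_le hC1
  have hM0 := one_pos.trans_le hM1
  have hn0 := one_pos.trans_le hn1
  have hN0 : 0 < N := by
    have : (0 : ℝ) < N := lt_of_lt_of_le (by positivity) hN
    exact_mod_cast this
  -- If εζ ≥ 2, the trivial bound 2/ζ on the gap is already at most ε; otherwise εζ < 2 is available
  -- to the error budget.
  rcases le_or_gt 2 (ε * ζ) with h2 | h2
  · exact (G.avgGap_le_two_div hζ hζ1 hG εx εy ηx ηy p₀ hN0).trans ((div_le_iff₀ hζ).2 h2)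
  obtain ⟨c, hc, rfl⟩ := exists_pow_four hC0
  obtain ⟨m, hm, rfl⟩ := exists_pow_four hM0
  obtain ⟨k, hk, rfl⟩ := exists_pow_four hn0
  obtain ⟨z, hz, rfl⟩ := exists_pow_four hζ
  obtain ⟨w, hw, rfl⟩ := exists_pow_four hε
  have hsq : ∀ x : ℝ, √(x ^ 4) = x ^ 2 := fun x => by
    rw [show x ^ 4 = (x ^ 2) ^ 2 by ring, Real.sqrt_sq (by positivity)]
  have hroot : ∀ {x : ℝ}, 0 < x → 1 ≤ x ^ 4 → 1 ≤ x := fun hx h =>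
    (one_le_pow_iff_of_nonneg hx.le four_ne_zero).1 h
  rw [hsq, hsq, show (z ^ 4) ^ 3 * w ^ 4 = z ^ 12 * w ^ 4 by ring] at hEx
  rw [show (z ^ 4) ^ 8 * (w ^ 4) ^ 2 = z ^ 32 * w ^ 8 by ring,
    show (c ^ 4) ^ 3 = c ^ 12 by ring] at hEy
  rw [pow_four_rpow hw.le (j := 42) (by norm_num), pow_four_rpow hz.le (j := 178) (by norm_num),
    pow_four_rpow hc.le (j := 62) (by norm_num), pow_four_rpow hm.le (j := 39) (by norm_num),
    pow_four_rpow hk.le (j := 29) (by norm_num)] at hHx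
  rw [show (w ^ 4) ^ 6 * (z ^ 4) ^ 27 = w ^ 24 * z ^ 108 by ring,
    show (c ^ 4) ^ 9 * (m ^ 4) ^ 6 * (k ^ 4) ^ 4 = c ^ 36 * m ^ 24 * k ^ 16 by ring] at hHy
  rw [pow_four_rpow hm.le (j := 43) (by norm_num), pow_four_rpow hk.le (j := 35) (by norm_num),
    pow_four_rpow hc.le (j := 70) (by norm_num), pow_four_rpow hw.le (j := 50) (by norm_num),
    pow_four_rpow hz.le (j := 194) (by norm_num)] at hN
  subst hEx hEy hHx hHy
  exact G.avgGap_le_of_pow_four (hroot hc hC1) (hroot hm hM1) (hroot hk hn1) hz hw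
    ((pow_le_one_iff_of_nonneg hz.le four_ne_zero).1 hζ1) h2.le hG hC hCe
    (hM ▸ le_max_left _ _) (hM ▸ le_max_right _ _) (by rw [← hn, hsq]) hεx.1 hεx.2 hεy.1 hεy.2
    hηx.1 hηx.2 hηy.1 hηy.2 p₀ hN0 hN
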